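/- **Conventions.** Digraphs are finite, without loops and without parallel arcs in the same direction; antiparallel arcs are allowed. An acyclic $k$-coloring of a digraph $D$ is a map $\varphi:V(D)\to\{1,\dots,k\}$ such that each color class induces a subdigraph containing no directed cycle (of order $\ge 2$); the dichromatic number $\vec\chi(D)$ is the least $k\ge 0$ for which $D$ has an acyclic $k$-coloring. A digraph $D$ is $k$-critical if $\vec\chi(D)=k$ and $\vec\chi(D')<k$ for every proper subdigraph $D'$ of $D$. Let $\overrightarrow{\mathrm{CRI}}(k,n)$ be the class of $k$-critical digraphs with $n$ vertices, let $\overrightarrow{\mathrm{ext}}(k,n)=\min\{|A(D)| : D\in\overrightarrow{\mathrm{CRI}}(k,n)\}$, where $A(D)$ is the arc set of $D$, and let $\overrightarrow{\mathrm{EXT}}(k,n)=\{D\in\overrightarrow{\mathrm{CRI}}(k,n) : |A(D)|=\overrightarrow{\mathrm{ext}}(k,n)\}$. For a graph $G$, $D^{\pm}(G)$ is the digraph obtained by replacing each edge of $G$ by two opposite arcs. $K_m$ is the complete graph on $m$ vertices ($K_0$ is the empty graph) and $\vec C_3$ is the directed cycle on three vertices. The Dirac join $D_1\boxplus D_2$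 is obtained from the disjoint union of the digraphs $D_1$ and $D_2$ by adding all arcs in both directions between $V(D_1)$ and $V(D_2)$. For a digraph $K$ and a class $\mathcal D$ of digraphs, $K\boxplus\mathcal D=\{K\boxplus D : D\in\mathcal D\}$. For $m\ge 3$, $\mathcal{DG}(m)$ is the class of graphs $G$ whose vertex set is the disjoint union of three non-empty sets $X,Y_1,Y_2$ with $|Y_1|+|Y_2|=|X|+1=m-1$ and two further distinct vertices $v_1,v_2$, such that $G[X]$ and $G[Y_1\cup Y_2]$ are complete and not joined by any edge, and the neighborhood of $v_i$ in $G$ is $X\cup Y_i$ for $i=1,2$. Put $\overrightarrow{\mathcal{DG}}(2)=\{\vec C_3\}$ and $\overrightarrow{\mathcal{DG}}(m)=\{D^{\pm}(G) : G\in\mathcal{DG}(m)\}$ for $m\ge 3$. **Theorem 4.1.** Let $p,k,n$ be natural numbers with $1\le p\le k-1$ and $n=k+p$. Then, up to isomorphism of digraphs, $$\overrightarrow{\mathrm{EXT}}(k,n)=D^{\pm}(K_{k-p-1})\boxplus\overrightarrow{\mathcal{DG}}(p+1).$$ As a consequence, $\overrightarrow{\mathrm{CRI}}(k,n)$ is non-empty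 and $$\overrightarrow{\mathrm{ext}}(k,n)=\begin{cases}2\binom n2-3 & \text{if } p=1,\\[2pt] 2\left(\binom n2-(p^2+1)\right) & \text{if } 2\le p\le k-1.\end{cases}$$ -/

import Mathlib

universe u v

namespace Digraph

/-- No vertex carries a loop. (`Digraph` excludes parallel arcs in the same direction, allows
antiparallel arcs, and would allow loops.) -/
def IsLoopless {V : Type u} (D : Digraph V) : Prop := ∀ x, ¬ D.Adj x x

/-- The set of arcs. -/
def arcs {V : Type u} (D : Digraph V) : Set (V × V) := {a | D.Adj a.1 a.2}

/-- The directed cycle of order `n`; only used for `2 ≤ n`. -/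
def dirCycle (n : ℕ) : Digraph (ZMod n) where
  Adj i j := j = i + 1

/-- `D` is acyclic: it contains no directed cycle (of any order `n ≥ 2`) as a subdigraph. -/
def IsAcyclic {V : Type u} (D : Digraph V) : Prop :=
  ¬ ∃ n : ℕ, 2 ≤ n ∧ ∃ f : ZMod n → V, Function.Injective f ∧
    ∀ i j, (dirCycle n).Adj i j → D.Adj (f i) (f j)

/-- The subdigraph induced by a set of vertices. -/
def induced {V : Type u} (D : Digraph V) (X : Set V) : Digraph X where
  Adj x y := D.Adj x y

/-- `φ` is an acyclic `k`-coloring: every color class induces an acyclic subdigraph. -/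
def IsAcyclicColoring {V : Type u} (D : Digraph V) {k : ℕ} (φ : V → Fin k) : Prop :=
  ∀ c : Fin k, (D.induced {x | φ x = c}).IsAcyclic

/-- The dichromatic number: the least `k` for which there is an acyclic `k`-coloring. -/
noncomputable def dichromaticNumber {V : Type u} (D : Digraph V) : ℕ :=
  sInf {k : ℕ | ∃ φ : V → Fin k, D.IsAcyclicColoring φ}

/-- A subdigraph: a set of vertices with a set of arcs of `D` whose ends lie in that set. -/
structure Subdigraph {V : Type u} (D : Digraph V) where
  verts : Set V
  Adj : V → V → Prop
  adj_sub : ∀ {x y : V}, Adj x y → D.Adj x y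
  left_mem : ∀ {x y : V}, Adj x y → x ∈ verts
  right_mem : ∀ {x y : V}, Adj x y → y ∈ verts

/-- A subdigraph as a digraph on its own vertex set. -/
def Subdigraph.toDigraph {V : Type u} {D : Digraph V} (S : D.Subdigraph) : Digraph S.verts where
  Adj x y := S.Adj x y

/-- A subdigraph is proper if it misses a vertex or an arc of `D`. -/
def Subdigraph.IsProper {V : Type u} {D : Digraph V} (S : D.Subdigraph) : Prop :=
  S.verts ≠ Set.univ ∨ S.Adj ≠ D.Adj

/-- `D` is `k`-critical: `D` has dichromatic number `k`, and every proper subdigraph has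
a smaller one. -/
def IsCritical {V : Type u} (D : Digraph V) (k : ℕ) : Prop :=
  D.dichromaticNumber = k ∧
    ∀ S : D.Subdigraph, S.IsProper → S.toDigraph.dichromaticNumber < D.dichromaticNumber

/-- The class of `k`-critical (finite, loopless) digraphs of order `n`. -/
def IsCRI {V : Type u} [Fintype V] (D : Digraph V) (k n : ℕ) : Prop :=
  D.IsLoopless ∧ D.IsCritical k ∧ Fintype.card V = n

/-- The numbers of arcs of the `k`-critical digraphs of order `n`; up to isomorphism these
digraphs live on `Fin n`. -/
def criticalArcCounts (k n : ℕ) : Set ℕ :=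
  {m | ∃ D : Digraph (Fin n), D.IsCRI k n ∧ D.arcs.ncard = m}

/-- The minimum number of arcs of a `k`-critical digraph of order `n`. -/
noncomputable def extMin (k n : ℕ) : ℕ := sInf (criticalArcCounts k n)

/-- The class of `k`-critical digraphs of order `n` with the minimum number of arcs. -/
def IsEXT {V : Type u} [Fintype V] (D : Digraph V) (k n : ℕ) : Prop :=
  D.IsCRI k n ∧ D.arcs.ncard = extMin k n

/-- The complete biorientation of a graph: each edge is replaced by two opposite arcs. -/
def biorientation {V : Type u} (G : SimpleGraph V) : Digraph V where
  Adj x y := G.Adj x y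

/-- The Dirac join of two disjoint digraphs: all arcs in both directions between them are added. -/
def diracJoin {V : Type u} {W : Type v} (D : Digraph V) (E : Digraph W) : Digraph (V ⊕ W) where
  Adj
    | .inl x, .inl y => D.Adj x y
    | .inr x, .inr y => E.Adj x y
    | .inl _, .inr _ => True
    | .inr _, .inl _ => True

/-- The class of Dirac–Gallai graphs with parameter `k` (meant for `k ≥ 3`). The equations
`|Y₁| + |Y₂| = |X| + 1 = k - 1` are written without subtraction. -/
def IsDiracGallaiGraph {V : Type u} [Fintype V] (G : SimpleGraph V) (k : ℕ) : Prop :=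
  ∃ (X Y₁ Y₂ : Set V) (v₁ v₂ : V),
    X.Nonempty ∧ Y₁.Nonempty ∧ Y₂.Nonempty ∧
    Disjoint X Y₁ ∧ Disjoint X Y₂ ∧ Disjoint Y₁ Y₂ ∧
    v₁ ≠ v₂ ∧ v₁ ∉ X ∪ Y₁ ∪ Y₂ ∧ v₂ ∉ X ∪ Y₁ ∪ Y₂ ∧
    X ∪ Y₁ ∪ Y₂ ∪ {v₁, v₂} = Set.univ ∧
    Y₁.ncard + Y₂.ncard = X.ncard + 1 ∧ X.ncard + 2 = k ∧
    G.IsClique X ∧ G.IsClique (Y₁ ∪ Y₂) ∧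
    (∀ x ∈ X, ∀ y ∈ Y₁ ∪ Y₂, ¬ G.Adj x y) ∧
    G.neighborSet v₁ = X ∪ Y₁ ∧ G.neighborSet v₂ = X ∪ Y₂

/-- The digraph class: the directed triangle for `k = 2`, the complete biorientations of
Dirac–Gallai graphs for `k ≥ 3`. -/
def IsDiracGallaiDigraph {V : Type u} [Fintype V] (D : Digraph V) (k : ℕ) : Prop :=
  (k = 2 ∧ Nonempty (D.Adj ≃r (dirCycle 3).Adj)) ∨
    (3 ≤ k ∧ ∃ G : SimpleGraph V, IsDiracGallaiGraph G k ∧ D = biorientation G)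

end Digraph

/-!
A digraph is `k`-critical only if it is *vertex-critical*: its vertices can be covered by `k` acyclic
sets and by no fewer, but `k - 1` acyclic sets suffice after the deletion of any vertex. Minimising arcs
means maximising the number of *missing* arcs, and everything is proved for vertex-critical digraphs:
one of order `k + p` misses at most `maxMissing p` arcs, that is `0`, `3` or `2 p² + 2` for `p = 0`, `p = 1`
or `p ≥ 2`, and equality forces the join of a complete digraph and a Dirac–Gallai digraph
(`IsVertexCritical.bound`). Two vertices are *unlinked* if an arc between them is missing; every acyclic
set is a set of pairwise unlinked vertices, and every unlinked pair is acyclic.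

The proof is by induction on `p`. For `p = 0` or `p ≥ k` it is enough that every vertex has at least
`k - 1` out-neighbours. If the graph of unlinked pairs is disconnected, the digraph is a complete
two-way join, its two sides are vertex-critical, and `maxMissing` is strictly superadditive on
positive numbers. If that graph
is connected, Gallai's theorem on small critical graphs, in the form `card_ge_and_factorCritical` for
simplicial complexes, gives `|V| ≥ 2k - 1`. So `p = k - 1`, and the equality case of the theorem says
that the complement of each vertex has a perfect matching of unlinked pairs. It also says that a triple of
pairwise unlinked vertices whose complement has such a matching is not acyclic, and so carries a directed
triangle. These two properties are `IsFactorCritical`.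

In the factor-critical case the missing arcs are counted along a matching that leaves out one vertex `v`. To
each matched pair `v` misses at most two arcs (`IsFactorCritical.pair`). Hence `v` misses at most `2p`
arcs, and the bound is immediate unless some `v` misses exactly `2p`. Fix such a `v`. Two matched pairs then
miss at most four arcs between them (`IsFactorCritical.pair_pair`). If `v` is unlinked to both vertices of some
pair, these three vertices carry a directed triangle, which misses at most four arcs to every other pair
(`IsFactorCritical.triangle_pair`). Otherwise `v` lies on a five-cycle of unlinked pairs, which misses at most
eight arcs to every other pair (`IsFiveCycle.sum_defect_le`). Adding up (`sum_weight_le`) gives at most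
`2 p² + 1` and `2 p² + 2` missing arcs in the two cases.

Equality for `p ≥ 2` makes every one of these estimates tight. Then no triangle of unlinked pairs has a
perfectly matched complement (`IsFactorCritical.not_isCoMatched_triangle`), the unlinked
pairs form a blow-up of the five-cycle (`IsFiveCycle.exists_position`), and two
consecutive classes of this blow-up are singletons, as in a Dirac–Gallai graph
(`IsFiveCycle.isDiracGallaiDigraph`).

Conversely, the directed triangle and the Dirac–Gallai digraphs are vertex-critical and attain the bound,
and joining a complete digraph preserves this. A vertex-critical digraph attaining the bound is critical,
since an arc that could be removed without lowering the dichromatic number would give a digraph that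
violates the bound (`IsVertexCritical.isCritical`). So the minimum number of arcs is
`n (n - 1) - maxMissing p`, and the extremal digraphs are those described.
-/

namespace Digraph

open scoped Classical

/-! ### Involutions along a symmetric relation -/



section Involutions

variable {V : Type u}

/-- A matching along the relation `P`, encoded as an involution `f`: the vertices `x` and `f x` are
matched, and the unmatched vertices are the fixed points of `f`. -/
structure IsPairing (P : V → V → Prop) (f : Equiv.Perm V) : Prop where
  inv : ∀ x, f (f x) = x
  adj : ∀ x, f x ≠ x → P x (f x)

variable {P : V → V → Prop}

theorem IsPairing.piecewise {f h : Equiv.Perm V} (hf : IsPairing P f) (hh : IsPairing P h)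
    {X : Set V} (hfX : ∀ x ∈ X, f x ∈ X) (hhX : ∀ x ∈ X, h x ∈ X) :
    ∃ g, IsPairing P g ∧ (∀ x ∈ X, g x = f x) ∧ ∀ x, x ∉ X → g x = h x := by
  have hhX' : ∀ x, x ∉ X → h x ∉ X := fun x hx h' => hx (by simpa [hh.inv] using hhX _ h')
  have hinv : Function.Involutive (fun x => if x ∈ X then f x else h x) := by
    intro x
    by_cases hx : x ∈ X
    · simp [hx, hfX x hx, hf.inv]
    · simp [hx, hhX' x hx, hh.inv]
  refine ⟨hinv.toPerm, ⟨hinv, fun x hx => ?_⟩, fun x hx => by simp [hx], fun x hx => by simp [hx]⟩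
  by_cases h' : x ∈ X
  · simp only [Function.Involutive.coe_toPerm, h', if_true] at hx ⊢
    exact hf.adj x hx
  · simp only [Function.Involutive.coe_toPerm, h', if_false] at hx ⊢
    exact hh.adj x hx

/-- Two unmatched related vertices can be matched with each other. -/
theorem IsPairing.join {f : Equiv.Perm V} (hf : IsPairing P f) (hP : ∀ x y, P x y → P y x)
    {a b : V} (ha : f a = a) (hb : f b = b) (hab : P a b) :
    ∃ g, IsPairing P g ∧ g a = b ∧ g b = a ∧ ∀ z, z ≠ a → z ≠ b → g z = f z := by
  have hfa : ∀ z, f z = a → z = a := fun z hz => f.injective (hz.trans ha.symm)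
  have hfb : ∀ z, f z = b → z = b := fun z hz => f.injective (hz.trans hb.symm)
  have hinv : Function.Involutive (fun x => if x = a then b else if x = b then a else f x) := by
    intro x
    by_cases hx : x = a
    · by_cases hab' : b = a <;> simp [hx, hab']
    · by_cases hx' : x = b
      · simp [hx']
      · have h1 : f x ≠ a := fun h => hx (hfa x h)
        have h2 : f x ≠ b := fun h => hx' (hfb x h)
        simp [hx, hx', h1, h2, hf.inv]
  refine ⟨hinv.toPerm, ⟨hinv, fun x hx => ?_⟩, ?_, ?_, fun z h1 h2 => ?_⟩
  · simp only [Function.Involutive.coe_toPerm] at hx ⊢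
    split_ifs at hx ⊢ with h1 h2
    · exact h1 ▸ hab
    · exact h2 ▸ hP _ _ hab
    · exact hf.adj x hx
  · simp
  · by_cases hab' : b = a <;> simp [hab']
  · simp [h1, h2]

/-- A matched pair can be released. -/
theorem IsPairing.cut {f : Equiv.Perm V} (hf : IsPairing P f) (a : V) :
    ∃ g, IsPairing P g ∧ g a = a ∧ g (f a) = f a ∧ ∀ z, z ≠ a → z ≠ f a → g z = f z := by
  have h1 : IsPairing P (1 : Equiv.Perm V) := ⟨fun x => rfl, fun x hx => absurd rfl hx⟩
  obtain ⟨g, hg, hg1, hg2⟩ := h1.piecewise hf (X := {a, f a}) (by simp) (by simp [hf.inv])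
  exact ⟨g, hg, hg1 _ (by simp), hg1 _ (by simp), fun z h1 h2 => hg2 z (by simp [h1, h2])⟩

/-- The path through `y` in the union of the two matchings `f` and `h`, where `y` is unmatched
in `h`. It is the orbit `X` of `y` under the dihedral group generated by `f` and `h`. Either its other
end is unmatched in `f`, or its other end is unmatched in `h`. -/
theorem exists_alternating_path [Finite V] {f h : Equiv.Perm V} (hf : ∀ x, f (f x) = x)
    (hh : ∀ x, h (h x) = x) {y : V} (hy : h y = y) :
    ∃ X : Set V, y ∈ X ∧ (∀ x ∈ X, f x ∈ X) ∧ (∀ x ∈ X, h x ∈ X) ∧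
      (∀ Z : Set V, y ∈ Z → (∀ x ∈ Z, f x ∈ Z) → (∀ x ∈ Z, h x ∈ Z) → X ⊆ Z) ∧
      ((∃ u ∈ X, f u = u ∧ (∀ w ∈ X, f w = w → w = u) ∧ ∀ w ∈ X, h w = w → w = y) ∨
        ∃ w ∈ X, w ≠ y ∧ h w = w ∧ (∀ x ∈ X, f x ≠ x) ∧ ∀ x ∈ X, h x = x → x = y ∨ x = w) := by
  set r : Equiv.Perm V := h * f with hr
  have hfr : ∀ i : ℤ, ∀ x, f ((r ^ i) x) = (r ^ (-i)) (f x) := by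
    have h1 : f * f = 1 := Equiv.ext hf
    have h2 : h * h = 1 := Equiv.ext hh
    have hfi : f⁻¹ = f := inv_eq_of_mul_eq_one_left h1
    have hhi : h⁻¹ = h := inv_eq_of_mul_eq_one_left h2
    have hc : f * r * f⁻¹ = r⁻¹ := by
      rw [hr, mul_inv_rev, hhi, hfi, mul_assoc, mul_assoc, h1, mul_one]
    intro i x
    have h3 : f * r ^ i = r ^ (-i) * f := by
      have h4 : f * r ^ i * f⁻¹ = r ^ (-i) := by
        rw [← conj_zpow, hc, inv_zpow, zpow_neg]
      rw [← h4, inv_mul_cancel_right]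
    exact congrArg (fun g : Equiv.Perm V => g x) h3
  have hadd : ∀ i j : ℤ, ∀ x, (r ^ i) ((r ^ j) x) = (r ^ (i + j)) x := fun i j x => by
    rw [zpow_add]; rfl
  have hfy : f y = (r ^ (-1 : ℤ)) y := by
    have h1 : r ((r ^ (-1 : ℤ)) y) = y := by simp
    have h2 : r (f y) = y := by simp [hr, hf, hy]
    exact r.injective (h2.trans h1.symm)
  have hfX : ∀ i : ℤ, f ((r ^ i) y) = (r ^ (-i - 1)) y := fun i => by
    rw [hfr, hfy, hadd]; rfl
  have hhX : ∀ i : ℤ, h ((r ^ i) y) = (r ^ (-i)) y := fun i => by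
    have h1 : h ((r ^ i) y) = r (f ((r ^ i) y)) := by simp [hr, hf]
    rw [h1, hfX]
    have := hadd 1 (-i - 1) y
    rw [zpow_one] at this
    rw [this]; congr 2; ring
  set L : ℤ := (Function.minimalPeriod (r • ·) y : ℤ) with hL
  have hper : ∀ m : ℤ, (r ^ m) y = y ↔ L ∣ m := fun m =>
    MulAction.zpow_smul_eq_iff_minimalPeriod_dvd (a := r) (b := y) (n := m)
  have heq : ∀ i j : ℤ, (r ^ i) y = (r ^ j) y ↔ L ∣ i - j := fun i j => by
    rw [← hper]
    constructor
    · intro h'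
      have := congrArg (fun z => (r ^ (-j)) z) h'
      simp only [hadd] at this
      rw [sub_eq_add_neg, add_comm, this]; simp
    · intro h'
      have := congrArg (fun z => (r ^ j) z) h'
      simp only [hadd] at this
      rw [← this]; congr 2; ring
  have hLpos : 0 < L := by
    have hfin : IsOfFinOrder r := isOfFinOrder_of_finite r
    obtain ⟨n, hn, hn'⟩ := hfin.exists_pow_eq_one
    have h1 : L ∣ (n : ℤ) := (hper n).1 (by rw [zpow_natCast, hn']; rfl)
    rcases lt_or_eq_of_le (show 0 ≤ L from Int.natCast_nonneg _) with h2 | h2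
    · exact h2
    · rw [← h2, zero_dvd_iff] at h1; omega
  have hff : ∀ i : ℤ, f ((r ^ i) y) = (r ^ i) y ↔ L ∣ 2 * i + 1 := fun i => by
    rw [hfX, heq, ← dvd_neg]; congr! 1; ring
  have hhf : ∀ i : ℤ, h ((r ^ i) y) = (r ^ i) y ↔ L ∣ 2 * i := fun i => by
    rw [hhX, heq, ← dvd_neg]; congr! 1; ring
  refine ⟨{x | ∃ i : ℤ, x = (r ^ i) y}, ⟨0, by simp⟩, ?_, ?_, ?_, ?_⟩
  · rintro _ ⟨i, rfl⟩; exact ⟨_, hfX i⟩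
  · rintro _ ⟨i, rfl⟩; exact ⟨_, hhX i⟩
  · rintro Z hyZ hZf hZh _ ⟨i, rfl⟩
    have hstep : ∀ z ∈ Z, r z ∈ Z := fun z hz => hZh _ (hZf _ hz)
    have hstep' : ∀ z ∈ Z, r⁻¹ z ∈ Z := fun z hz => by
      have h1 : r⁻¹ z = f (h z) := by
        rw [Equiv.Perm.inv_eq_iff_eq]; simp [hr, hf, hh]
      rw [h1]; exact hZf _ (hZh _ hz)
    induction i using Int.induction_on with
    | zero => simpa using hyZ
    | succ i ih =>
      have := hstep _ ih
      have h2 := hadd 1 i y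
      rw [zpow_one] at h2
      rw [h2, add_comm] at this; exact this
    | pred i ih =>
      have := hstep' _ ih
      have h2 := hadd (-1) (-i) y
      rw [zpow_neg_one] at h2
      rw [h2] at this
      rwa [show (-(i : ℤ) - 1) = -1 + -i by ring]
  · rcases Int.even_or_odd' L with ⟨c, hc | hc⟩
    · right
      refine ⟨(r ^ c) y, ⟨c, rfl⟩, ?_, ?_, ?_, ?_⟩
      · rw [Ne, hper]; intro h1
        have := Int.le_of_dvd (by omega) h1
        omega
      · rw [hhf, hc]
      · rintro _ ⟨i, rfl⟩
        rw [Ne, hff, hc]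
        rintro ⟨d, hd⟩
        have : 2 * (c * d) = 2 * i + 1 := by rw [← mul_assoc]; exact hd.symm
        omega
      · rintro _ ⟨i, rfl⟩ hi
        rw [hhf, hc] at hi
        obtain ⟨d, hd⟩ := hi
        have hd' : i = c * d := by nlinarith
        rcases Int.even_or_odd' d with ⟨e, he | he⟩
        · left; rw [hper, hc]; exact ⟨e, by rw [hd', he]; ring⟩
        · right; rw [heq, hc]; exact ⟨e, by rw [hd', he]; ring⟩
    · left
      refine ⟨(r ^ c) y, ⟨c, rfl⟩, ?_, ?_, ?_⟩
      · rw [hff, hc]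
      · rintro _ ⟨i, rfl⟩ hi
        rw [hff] at hi; rw [heq]
        obtain ⟨d, hd⟩ := hi
        have h3 : L ∣ 2 * (i - c) := ⟨d - 1, by linear_combination hd + hc⟩
        have : IsCoprime L 2 := ⟨1, -c, by rw [hc]; ring⟩
        exact this.dvd_of_dvd_mul_left h3
      · rintro _ ⟨i, rfl⟩ hi
        rw [hhf] at hi; rw [hper]
        have : IsCoprime L 2 := ⟨1, -c, by rw [hc]; ring⟩
        exact this.dvd_of_dvd_mul_left hi

end Involutions

/-! ### Maximum matchings and barriers -/

section Matchings

variable {V : Type u} (P : V → V → Prop)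

/-- A matching whose edges lie inside the vertex set `U`. -/
def IsMatchingOn (U : Finset V) (f : Equiv.Perm V) : Prop :=
  IsPairing P f ∧ ∀ x, f x ≠ x → x ∈ U

/-- The vertices of `U` left unmatched by `f`. -/
noncomputable def unmatched (U : Finset V) (f : Equiv.Perm V) : Finset V :=
  U.filter (fun x => f x = x)

/-- A maximum matching inside `U`. -/
def IsMaxMatchingOn (U : Finset V) (f : Equiv.Perm V) : Prop :=
  IsMatchingOn P U f ∧ ∀ g, IsMatchingOn P U g → (unmatched U f).card ≤ (unmatched U g).card

/-- The vertices of `U` that are missed by some maximum matching inside `U`. -/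
noncomputable def missable (U : Finset V) : Finset V :=
  U.filter (fun x => ∃ f, IsMaxMatchingOn P U f ∧ f x = x)

variable {P}

theorem mem_unmatched {U : Finset V} {f : Equiv.Perm V} {x : V} :
    x ∈ unmatched U f ↔ x ∈ U ∧ f x = x := by simp [unmatched]

theorem mem_missable {U : Finset V} {x : V} :
    x ∈ missable P U ↔ x ∈ U ∧ ∃ f, IsMaxMatchingOn P U f ∧ f x = x := by simp [missable]

theorem IsMatchingOn.map_mem {U : Finset V} {f : Equiv.Perm V} (hf : IsMatchingOn P U f) {x : V}
    (hx : x ∈ U) : f x ∈ U := by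
  by_cases h : f x = x
  · rwa [h]
  · exact hf.2 _ (fun h' => h (f.injective h'))

theorem exists_isMaxMatchingOn (U : Finset V) : ∃ f, IsMaxMatchingOn P U f := by
  have h1 : ∃ n f, IsMatchingOn P U f ∧ (unmatched U f).card = n :=
    ⟨_, 1, ⟨⟨fun x => rfl, fun x hx => absurd rfl hx⟩, fun x hx => absurd rfl hx⟩, rfl⟩
  obtain ⟨f, hf, hfn⟩ := Nat.find_spec h1
  exact ⟨f, hf, fun g hg => hfn ▸ Nat.find_min' h1 ⟨g, hg, rfl⟩⟩

theorem IsMaxMatchingOn.card_eq {U : Finset V} {f g : Equiv.Perm V} (hf : IsMaxMatchingOn P U f)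
    (hg : IsMaxMatchingOn P U g) : (unmatched U f).card = (unmatched U g).card :=
  le_antisymm (hf.2 _ hg.1) (hg.2 _ hf.1)

theorem IsMaxMatchingOn.of_card_le {U : Finset V} {f g : Equiv.Perm V}
    (hf : IsMaxMatchingOn P U f) (hg : IsMatchingOn P U g)
    (h : (unmatched U g).card ≤ (unmatched U f).card) : IsMaxMatchingOn P U g :=
  ⟨hg, fun _ hg' => h.trans (hf.2 _ hg')⟩

/-- The pairs and singletons of a matching on an invariant set, with their number. -/
theorem exists_blocks {f : Equiv.Perm V} (hf : ∀ x, f (f x) = x) {T : Finset V}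
    (hT : ∀ x ∈ T, f x ∈ T) :
    ∃ 𝒪 : Finset (Finset V), 2 * 𝒪.card = T.card + (unmatched T f).card ∧
      (∀ x ∈ T, ({x, f x} : Finset V) ∈ 𝒪) ∧ ∀ Q ∈ 𝒪, ∃ x ∈ T, Q = {x, f x} := by
  refine ⟨T.image (fun x => ({x, f x} : Finset V)), ?_,
    fun x hx => Finset.mem_image_of_mem _ hx, fun Q hQ => ?_⟩
  · rw [Finset.card_eq_sum_card_image (fun x => ({x, f x} : Finset V)) T,
      Finset.card_eq_sum_card_fiberwise (f := fun x => ({x, f x} : Finset V)) (s := unmatched T f)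
        (t := T.image (fun x => ({x, f x} : Finset V)))
        (fun x hx => Finset.mem_coe.2
          (Finset.mem_image_of_mem _ (mem_unmatched.1 (Finset.mem_coe.1 hx)).1)),
      ← Finset.sum_add_distrib, mul_comm, ← smul_eq_mul, ← Finset.sum_const]
    refine Finset.sum_congr rfl fun Q hQ => ?_
    obtain ⟨x, hx, rfl⟩ := Finset.mem_image.1 hQ
    have key : ∀ z, ({z, f z} : Finset V) = {x, f x} ↔ z = x ∨ z = f x := by
      intro z
      constructor
      · intro h
        have : z ∈ ({x, f x} : Finset V) := h ▸ Finset.mem_insert_self _ _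
        simpa using this
      · rintro (rfl | rfl)
        · rfl
        · rw [hf, Finset.pair_comm]
    have h1 : T.filter (fun z => ({z, f z} : Finset V) = {x, f x}) = {x, f x} := by
      ext z
      simp only [Finset.mem_filter, key, Finset.mem_insert, Finset.mem_singleton]
      constructor
      · exact fun h => h.2
      · rintro (rfl | rfl)
        · exact ⟨hx, Or.inl rfl⟩
        · exact ⟨hT _ hx, Or.inr rfl⟩
    rw [h1]
    by_cases hfx : f x = x
    · have h2 : (unmatched T f).filter (fun z => ({z, f z} : Finset V) = {x, f x}) = {x} := by
        ext z
        simp only [Finset.mem_filter, key, mem_unmatched, Finset.mem_singleton]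
        constructor
        · rintro ⟨-, h | h⟩
          exacts [h, h.trans hfx]
        · rintro rfl; exact ⟨⟨hx, hfx⟩, Or.inl rfl⟩
      rw [h2, hfx]; simp
    · have h2 : (unmatched T f).filter (fun z => ({z, f z} : Finset V) = {x, f x}) = ∅ := by
        ext z
        simp only [Finset.mem_filter, key, mem_unmatched, Finset.notMem_empty, iff_false]
        rintro ⟨⟨-, h⟩, rfl | rfl⟩
        · exact hfx h
        · rw [hf] at h; exact hfx h.symm
      rw [h2, Finset.card_pair (Ne.symm hfx)]; rfl
  · obtain ⟨x, hx, rfl⟩ := Finset.mem_image.1 hQ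
    exact ⟨x, hx, rfl⟩

theorem IsMatchingOn.parity {U : Finset V} {f : Equiv.Perm V} (hf : IsMatchingOn P U f) :
    ∃ m, 2 * m = U.card + (unmatched U f).card := by
  obtain ⟨𝒪, h, -⟩ := exists_blocks hf.1.inv (T := U) (fun x hx => hf.map_mem hx)
  exact ⟨_, h⟩

theorem IsMatchingOn.piecewise {U : Finset V} {f h : Equiv.Perm V} (hf : IsMatchingOn P U f)
    (hh : IsMatchingOn P U h) {X : Set V} (hfX : ∀ x ∈ X, f x ∈ X) (hhX : ∀ x ∈ X, h x ∈ X) :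
    ∃ g, IsMatchingOn P U g ∧ (∀ x ∈ X, g x = f x) ∧ (∀ x, x ∉ X → g x = h x) ∧
      (unmatched U g).card + ((unmatched U h).filter (· ∈ X)).card =
        (unmatched U h).card + ((unmatched U f).filter (· ∈ X)).card := by
  obtain ⟨g, hg, h1, h2⟩ := hf.1.piecewise hh.1 hfX hhX
  refine ⟨g, ⟨hg, fun x hx => ?_⟩, h1, h2, ?_⟩
  · by_cases hxX : x ∈ X
    · exact hf.2 x (h1 x hxX ▸ hx)
    · exact hh.2 x (h2 x hxX ▸ hx)
  · have e1 := Finset.card_filter_add_card_filter_not (s := unmatched U g) (· ∈ X)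
    have e2 := Finset.card_filter_add_card_filter_not (s := unmatched U h) (· ∈ X)
    have e3 : (unmatched U g).filter (· ∈ X) = (unmatched U f).filter (· ∈ X) := by
      ext x
      simp only [Finset.mem_filter, mem_unmatched]
      constructor <;> rintro ⟨⟨a, b⟩, c⟩
      · exact ⟨⟨a, h1 x c ▸ b⟩, c⟩
      · exact ⟨⟨a, (h1 x c).trans b⟩, c⟩
    have e4 : (unmatched U g).filter (fun x => ¬ x ∈ X) =
        (unmatched U h).filter (fun x => ¬ x ∈ X) := by
      ext x
      simp only [Finset.mem_filter, mem_unmatched]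
      constructor <;> rintro ⟨⟨a, b⟩, c⟩
      · exact ⟨⟨a, h2 x c ▸ b⟩, c⟩
      · exact ⟨⟨a, (h2 x c).trans b⟩, c⟩
    rw [e3, e4] at e1
    omega

/-- Exchange of two matchings along the alternating path that starts at a vertex `y` missed
by `h`. -/
theorem IsMatchingOn.exchange [Finite V] {U : Finset V} {f h : Equiv.Perm V}
    (hf : IsMatchingOn P U f) (hh : IsMatchingOn P U h) {y : V} (hyU : y ∈ U) (hy : h y = y) :
    (∃ u ∈ U, f u = u ∧ ∃ g, IsMatchingOn P U g ∧ g y = y ∧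
        (unmatched U g).card = (unmatched U f).card ∧ ∀ w, f w = w → w ≠ u → w ∈ U → g w = w) ∨
      ∃ w ∈ U, w ≠ y ∧ h w = w ∧
        (∃ g, IsMatchingOn P U g ∧ (unmatched U g).card + 2 = (unmatched U h).card ∧
          ∀ z, h z = z → z ≠ y → z ≠ w → g z = z) ∧
        ∃ g, IsMatchingOn P U g ∧ (unmatched U g).card = (unmatched U f).card + 2 ∧
          g y = y ∧ g w = w ∧ ∀ z, f z = z → g z = z := by
  obtain ⟨X, hyX, hXf, hXh, hmin, hX⟩ := exists_alternating_path hf.1.inv hh.1.inv hy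
  have hXU : X ⊆ (U : Set V) := hmin _ hyU (fun x hx => hf.map_mem hx) (fun x hx => hh.map_mem hx)
  rcases hX with ⟨u, huX, hfu, hu, hhu⟩ | ⟨w, hwX, hwy, hhw, hXf0, hw⟩
  · left
    obtain ⟨g, hg, hg1, hg2, hgc⟩ := hh.piecewise hf hXh hXf
    have e1 : (unmatched U f).filter (· ∈ X) = {u} := by
      ext x
      simp only [Finset.mem_filter, mem_unmatched, Finset.mem_singleton]
      constructor
      · rintro ⟨⟨-, b⟩, c⟩; exact hu x c b
      · rintro rfl; exact ⟨⟨hXU huX, hfu⟩, huX⟩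
    have e2 : (unmatched U h).filter (· ∈ X) = {y} := by
      ext x
      simp only [Finset.mem_filter, mem_unmatched, Finset.mem_singleton]
      constructor
      · rintro ⟨⟨-, b⟩, c⟩; exact hhu x c b
      · rintro rfl; exact ⟨⟨hyU, hy⟩, hyX⟩
    rw [e1, e2] at hgc
    simp only [Finset.card_singleton] at hgc
    refine ⟨u, hXU huX, hfu, g, hg, (hg1 y hyX).trans hy, by omega, fun w hw hwu hwU => ?_⟩
    rw [hg2 w (fun hwX => hwu (hu w hwX hw)), hw]
  · right
    have e1 : (unmatched U f).filter (· ∈ X) = ∅ := by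
      ext x
      simp only [Finset.mem_filter, mem_unmatched, Finset.notMem_empty, iff_false]
      rintro ⟨⟨-, b⟩, c⟩; exact hXf0 x c b
    have e2 : (unmatched U h).filter (· ∈ X) = {y, w} := by
      ext x
      simp only [Finset.mem_filter, mem_unmatched, Finset.mem_insert, Finset.mem_singleton]
      constructor
      · rintro ⟨⟨-, b⟩, c⟩; exact hw x c b
      · rintro (rfl | rfl)
        · exact ⟨⟨hyU, hy⟩, hyX⟩
        · exact ⟨⟨hXU hwX, hhw⟩, hwX⟩
    refine ⟨w, hXU hwX, hwy, hhw, ?_, ?_⟩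
    · obtain ⟨g, hg, hg1, hg2, hgc⟩ := hf.piecewise hh hXf hXh
      rw [e1, e2, Finset.card_pair hwy.symm] at hgc
      refine ⟨g, hg, by simpa using hgc, fun z hz hzy hzw => ?_⟩
      rw [hg2 z (fun hzX => (hw z hzX hz).elim hzy hzw), hz]
    · obtain ⟨g, hg, hg1, hg2, hgc⟩ := hh.piecewise hf hXh hXf
      rw [e1, e2, Finset.card_pair hwy.symm] at hgc
      refine ⟨g, hg, by simpa using hgc, (hg1 y hyX).trans hy, (hg1 w hwX).trans hhw,
        fun z hz => ?_⟩
      rw [hg2 z (fun hzX => hXf0 z hzX hz), hz]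

theorem IsMatchingOn.join {U : Finset V} {f : Equiv.Perm V} (hf : IsMatchingOn P U f)
    (hP : ∀ x y, P x y → P y x) {a b : V} (haU : a ∈ U) (hbU : b ∈ U) (ha : f a = a)
    (hb : f b = b) (hne : a ≠ b) (hab : P a b) :
    ∃ g, IsMatchingOn P U g ∧ g a = b ∧ g b = a ∧ (∀ z, z ≠ a → z ≠ b → g z = f z) ∧
      (unmatched U g).card + 2 = (unmatched U f).card := by
  obtain ⟨g, hg, h1, h2, h3⟩ := hf.1.join hP ha hb hab
  refine ⟨g, ⟨hg, fun x hx => ?_⟩, h1, h2, h3, ?_⟩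
  · by_cases hxa : x = a
    · exact hxa ▸ haU
    by_cases hxb : x = b
    · exact hxb ▸ hbU
    exact hf.2 x (h3 x hxa hxb ▸ hx)
  · have e : unmatched U f = insert a (insert b (unmatched U g)) := by
      ext x
      simp only [Finset.mem_insert, mem_unmatched]
      by_cases hxa : x = a
      · subst hxa; simp [ha, haU]
      by_cases hxb : x = b
      · subst hxb; simp [hb, hbU]
      simp [hxa, hxb, h3 x hxa hxb]
    rw [e, Finset.card_insert_of_notMem, Finset.card_insert_of_notMem]
    · simp [mem_unmatched, h2, hne]
    · simp [mem_unmatched, h1, hne, hne.symm]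

theorem IsMatchingOn.cut {U : Finset V} {f : Equiv.Perm V} (hf : IsMatchingOn P U f) {a : V}
    (ha : f a ≠ a) :
    ∃ g, IsMatchingOn P U g ∧ g a = a ∧ (∀ z, f z = z → g z = z) ∧
      (unmatched U g).card = (unmatched U f).card + 2 := by
  obtain ⟨g, hg, h1, h2, h3⟩ := hf.1.cut a
  have haU := hf.2 a ha
  refine ⟨g, ⟨hg, fun x hx => ?_⟩, h1, fun z hz => ?_, ?_⟩
  · by_cases hxa : x = a
    · exact hxa ▸ haU
    by_cases hxb : x = f a
    · exact hxb ▸ hf.map_mem haU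
    exact hf.2 x (h3 x hxa hxb ▸ hx)
  · by_cases hza : z = a
    · exact hza ▸ h1
    by_cases hzb : z = f a
    · exact hzb ▸ h2
    rw [h3 z hza hzb, hz]
  · have e : unmatched U g = insert a (insert (f a) (unmatched U f)) := by
      ext x
      simp only [Finset.mem_insert, mem_unmatched]
      by_cases hxa : x = a
      · subst hxa; simp [h1, haU]
      by_cases hxb : x = f a
      · subst hxb; simp [h2, hf.map_mem haU]
      simp [hxa, hxb, h3 x hxa hxb]
    rw [e, Finset.card_insert_of_notMem, Finset.card_insert_of_notMem]
    · simp [mem_unmatched, hf.1.inv, Ne.symm ha]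
    · simp [mem_unmatched, Ne.symm ha, ha]

theorem isMatchingOn_erase_iff {U : Finset V} {a : V} {h : Equiv.Perm V} :
    IsMatchingOn P (U.erase a) h ↔ IsMatchingOn P U h ∧ h a = a := by
  constructor
  · rintro ⟨h1, h2⟩
    exact ⟨⟨h1, fun x hx => Finset.mem_of_mem_erase (h2 x hx)⟩,
      by_contra fun ha => (Finset.notMem_erase a U) (h2 a ha)⟩
  · rintro ⟨⟨h1, h2⟩, h3⟩
    exact ⟨h1, fun x hx => Finset.mem_erase.2 ⟨fun hxa => hx (hxa ▸ h3), h2 x hx⟩⟩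

theorem card_unmatched_erase {U : Finset V} {a : V} {h : Equiv.Perm V} (ha : a ∈ U)
    (hh : h a = a) : (unmatched (U.erase a) h).card + 1 = (unmatched U h).card := by
  have : unmatched (U.erase a) h = (unmatched U h).erase a := by
    ext x; simp only [Finset.mem_erase, mem_unmatched]; tauto
  rw [this, Finset.card_erase_add_one (mem_unmatched.2 ⟨ha, hh⟩)]

/-- Gallai's stability lemma: deleting a vertex that is not missable, but related to a missable one,
changes neither the set of missable vertices nor, apart from the deleted vertex, the size of a
maximum matching by more than the edge that is lost. -/
theorem missable_erase [Finite V] (hP : ∀ x y, P x y → P y x) {U : Finset V} {a d : V}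
    (ha : a ∈ U) (haD : a ∉ missable P U) (hd : d ∈ missable P U) (had : P a d) :
    missable P (U.erase a) = missable P U ∧ ∀ f g, IsMaxMatchingOn P U f →
      IsMaxMatchingOn P (U.erase a) g →
        (unmatched (U.erase a) g).card = (unmatched U f).card + 1 := by
  obtain ⟨hdU, f, hf, hfd⟩ := mem_missable.1 hd
  have hnd : ∀ g, IsMaxMatchingOn P U g → g a ≠ a := fun g hg h =>
    haD (mem_missable.2 ⟨ha, g, hg, h⟩)
  -- a matching of `U` that misses `a` is not maximum, hence by parity misses two further vertices
  have hlow : ∀ g, IsMatchingOn P (U.erase a) g →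
      (unmatched U f).card + 1 ≤ (unmatched (U.erase a) g).card := by
    intro g hg
    obtain ⟨hg1, hg2⟩ := isMatchingOn_erase_iff.1 hg
    have h1 := card_unmatched_erase ha hg2
    have h2 := hf.2 g hg1
    have h3 : (unmatched U g).card ≠ (unmatched U f).card := fun h3 =>
      hnd g (hf.of_card_le hg1 h3.le) hg2
    obtain ⟨m1, hm1⟩ := hf.1.parity
    obtain ⟨m2, hm2⟩ := hg1.parity
    omega
  have hcut : ∀ f', IsMaxMatchingOn P U f' → ∃ g, IsMaxMatchingOn P (U.erase a) g ∧
      (unmatched (U.erase a) g).card = (unmatched U f').card + 1 ∧ ∀ z, f' z = z → g z = z := by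
    intro f' hf'
    obtain ⟨g, hg, hga, hgz, hgc⟩ := hf'.1.cut (hnd f' hf')
    have h1 := card_unmatched_erase ha hga
    refine ⟨g, ⟨isMatchingOn_erase_iff.2 ⟨hg, hga⟩, fun g' hg' => ?_⟩, by omega, hgz⟩
    have := hlow g' hg'
    have := hf'.card_eq hf
    omega
  refine ⟨?_, ?_⟩
  · ext y
    constructor
    · intro hy
      obtain ⟨hyU', h, hh, hhy⟩ := mem_missable.1 hy
      obtain ⟨hya, hyU⟩ := Finset.mem_erase.1 hyU'
      obtain ⟨hhU, hha⟩ := isMatchingOn_erase_iff.1 hh.1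
      obtain ⟨g0, hg0, hg0c, -⟩ := hcut f hf
      have hhc := card_unmatched_erase ha hha
      have hc : (unmatched U h).card = (unmatched U f).card + 2 := by
        have := hh.card_eq hg0; omega
      rcases hf.1.exchange hhU hyU hhy with ⟨u, -, -, g, hg, hgy, hgc, -⟩ |
        ⟨w, hwU, hwy, hhw, ⟨g, hg, hgc, hgz⟩, ⟨g', hg', hgc', hgy', hgw', hgz'⟩⟩
      · exact mem_missable.2 ⟨hyU, g, hf.of_card_le hg hgc.le, hgy⟩
      · by_cases hwa : w = a
        · subst hwa
          have hdw : w ≠ d := fun h => haD (h ▸ hd)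
          by_cases hyd : y = d
          · exact hyd ▸ hd
          obtain ⟨k, hk, -, -, hkz, hkc⟩ := hg'.join hP ha hdU hgw' (hgz' d hfd) hdw had
          refine mem_missable.2 ⟨hyU, k, hf.of_card_le hk (by omega), ?_⟩
          rw [hkz y hya hyd, hgy']
        · exact absurd (hgz a hha (Ne.symm hya) (Ne.symm hwa))
            (hnd g (hf.of_card_le hg (by omega)))
    · intro hy
      obtain ⟨hyU, f', hf', hfy⟩ := mem_missable.1 hy
      obtain ⟨g, hg, -, hgz⟩ := hcut f' hf'
      exact mem_missable.2 ⟨Finset.mem_erase.2 ⟨fun h => haD (h ▸ hy), hyU⟩, g, hg, hgz y hfy⟩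
  · intro f' g' hf' hg'
    obtain ⟨g, hg, hgc, -⟩ := hcut f' hf'
    rw [← hgc, hg'.card_eq hg]

/-- The Gallai–Edmonds barrier: a set `A` of vertices that are not missable, which contains all
vertices of `U` outside the set of missable vertices that are related to a missable vertex, and whose
deletion increases the number of unmatched vertices by its size. -/
theorem exists_barrier [Finite V] (hP : ∀ x y, P x y → P y x) (U : Finset V) :
    ∃ A ⊆ U, Disjoint A (missable P U) ∧ missable P (U \ A) = missable P U ∧
      (∀ f g, IsMaxMatchingOn P U f → IsMaxMatchingOn P (U \ A) g →
        (unmatched (U \ A) g).card = (unmatched U f).card + A.card) ∧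
      ∀ x ∈ missable P U, ∀ y ∈ U, P x y → y ∈ missable P U ∨ y ∈ A := by
  induction hn : U.card generalizing U with
  | zero =>
    rw [Finset.card_eq_zero] at hn
    subst hn
    exact ⟨∅, by simp, by simp, by simp, fun f g hf hg => by simpa using hg.card_eq hf, by simp⟩
  | succ n ih =>
    by_cases hA : ∃ a ∈ U, a ∉ missable P U ∧ ∃ d ∈ missable P U, P a d
    · obtain ⟨a, ha, haD, d, hd, had⟩ := hA
      obtain ⟨h1, h2⟩ := missable_erase hP ha haD hd had
      obtain ⟨A, hAU, hAD, hAm, hAc, hAN⟩ := ih (U.erase a) (by rw [Finset.card_erase_of_mem ha]; omega)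
      have haA : a ∉ A := fun h => Finset.notMem_erase a U (hAU h)
      have hUA : U \ insert a A = U.erase a \ A := by
        ext x; simp only [Finset.mem_sdiff, Finset.mem_insert, Finset.mem_erase]; tauto
      refine ⟨insert a A, ?_, ?_, ?_, ?_, ?_⟩
      · exact Finset.insert_subset ha (hAU.trans (Finset.erase_subset _ _))
      · rw [h1] at hAD
        rw [Finset.disjoint_insert_left]; exact ⟨haD, hAD⟩
      · rw [hUA, hAm, h1]
      · rw [hUA]
        intro f g hf hg
        obtain ⟨g0, hg0⟩ := exists_isMaxMatchingOn (P := P) (U.erase a)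
        rw [hAc g0 g hg0 hg, h2 f g0 hf hg0, Finset.card_insert_of_notMem haA]; ring
      · intro x hx y hy hxy
        by_cases hya : y = a
        · exact Or.inr (hya ▸ Finset.mem_insert_self _ _)
        rw [← h1] at hx ⊢
        exact (hAN x hx y (Finset.mem_erase.2 ⟨hya, hy⟩) hxy).imp_right (Finset.mem_insert_of_mem)
    · push Not at hA
      refine ⟨∅, by simp, by simp, by simp, fun f g hf hg => ?_, fun x hx y hy hxy => ?_⟩
      · rw [Finset.sdiff_empty] at hg ⊢
        simpa using hg.card_eq hf
      · exact Or.inl (by_contra fun h => hA y hy h x hx (hP _ _ hxy))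

/-- Gallai's lemma: being never missed simultaneously by a maximum matching is a transitive relation
on the missable vertices. -/
theorem missed_trans [Finite V] {U : Finset V} {x y z : V} (hx : x ∈ U) (hy : y ∈ missable P U)
    (hz : z ∈ U)
    (hxy : ∀ f, IsMaxMatchingOn P U f → f x = x → f y = y → x = y)
    (hyz : ∀ f, IsMaxMatchingOn P U f → f y = y → f z = z → y = z)
    (f : Equiv.Perm V) (hf : IsMaxMatchingOn P U f) (hfx : f x = x) (hfz : f z = z) : x = z := by
  by_contra hxz
  obtain ⟨hyU, h, hh, hhy⟩ := mem_missable.1 hy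
  rcases hf.1.exchange hh.1 hyU hhy with ⟨u, -, -, g, hg, hgy, hgc, hgw⟩ |
    ⟨w, hwU, hwy, hhw, ⟨g, hg, hgc, hgz⟩, -⟩
  · have hgm := hf.of_card_le hg hgc.le
    by_cases hxu : x = u
    · have hzu : z ≠ u := fun h => hxz (hxu.trans h.symm)
      have e1 := hyz g hgm hgy (hgw z hfz hzu hz)
      subst e1
      exact hxz (hxy f hf hfx hfz)
    · have e1 := hxy g hgm (hgw x hfx hxu hx) hgy
      subst e1
      exact hxz (hyz f hf hfx hfz)
  · have := hh.2 g hg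
    omega

end Matchings

/-! ### Covers by members of a simplicial complex -/

section Covers

variable {V : Type u}

/-- The set `S` is covered by at most `m` members of the family `F`. -/
def IsCoverable (F : Finset V → Prop) (S : Finset V) (m : ℕ) : Prop :=
  ∃ 𝒬 : Finset (Finset V), 𝒬.card ≤ m ∧ (∀ Q ∈ 𝒬, F Q) ∧ ∀ x ∈ S, ∃ Q ∈ 𝒬, x ∈ Q

variable {F : Finset V → Prop}

theorem IsCoverable.mono {S T : Finset V} {m n : ℕ} (h : IsCoverable F S m) (hTS : T ⊆ S)
    (hmn : m ≤ n) : IsCoverable F T n := by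
  obtain ⟨𝒬, h1, h2, h3⟩ := h
  exact ⟨𝒬, h1.trans hmn, h2, fun x hx => h3 x (hTS hx)⟩

theorem IsCoverable.union {S T : Finset V} {m n : ℕ} (hS : IsCoverable F S m)
    (hT : IsCoverable F T n) : IsCoverable F (S ∪ T) (m + n) := by
  obtain ⟨𝒬, h1, h2, h3⟩ := hS
  obtain ⟨ℛ, k1, k2, k3⟩ := hT
  refine ⟨𝒬 ∪ ℛ, (Finset.card_union_le _ _).trans (by omega), fun Q hQ => ?_, fun x hx => ?_⟩
  · rcases Finset.mem_union.1 hQ with h | h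
    exacts [h2 Q h, k2 Q h]
  · rcases Finset.mem_union.1 hx with h | h
    · obtain ⟨Q, hQ, hxQ⟩ := h3 x h
      exact ⟨Q, Finset.mem_union_left _ hQ, hxQ⟩
    · obtain ⟨Q, hQ, hxQ⟩ := k3 x h
      exact ⟨Q, Finset.mem_union_right _ hQ, hxQ⟩

theorem isCoverable_one {Q : Finset V} (hQ : F Q) : IsCoverable F Q 1 :=
  ⟨{Q}, by simp, by simpa using hQ, fun x hx => ⟨Q, by simp, hx⟩⟩

theorem isCoverable_empty (m : ℕ) : IsCoverable F ∅ m := ⟨∅, by simp, by simp, by simp⟩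

/-- A cover can be turned into a partition into at most as many members. -/
theorem IsCoverable.exists_partition (hmono : ∀ Q Q', Q' ⊆ Q → F Q → F Q') {S : Finset V} {m : ℕ}
    (h : IsCoverable F S m) :
    ∃ φ : V → Finset V, (S.image φ).card ≤ m ∧
      ∀ Q ∈ S.image φ, F (S.filter (fun x => φ x = Q)) := by
  obtain ⟨𝒬, h1, h2, h3⟩ := h
  choose! φ hφ hφ' using h3
  refine ⟨φ, (Finset.card_le_card fun Q hQ => ?_).trans h1, fun Q hQ => ?_⟩
  · obtain ⟨x, hx, rfl⟩ := Finset.mem_image.1 hQ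
    exact hφ x hx
  · obtain ⟨x, hx, rfl⟩ := Finset.mem_image.1 hQ
    refine hmono _ _ (fun z hz => ?_) (h2 _ (hφ x hx))
    obtain ⟨hz1, hz2⟩ := Finset.mem_filter.1 hz
    exact hz2 ▸ hφ' z hz1

theorem isCoverable_of_pairing {P : V → V → Prop} (hsing : ∀ x, F {x})
    (hpair : ∀ x y, P x y → F {x, y}) {f : Equiv.Perm V} (hf : IsPairing P f) {T : Finset V}
    (hT : ∀ x ∈ T, f x ∈ T) :
    ∃ m, 2 * m = T.card + (unmatched T f).card ∧ IsCoverable F T m := by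
  obtain ⟨𝒪, h1, h2, h3⟩ := exists_blocks hf.inv hT
  refine ⟨_, h1, 𝒪, le_rfl, fun Q hQ => ?_, fun x hx => ⟨_, h2 x hx, by simp⟩⟩
  obtain ⟨x, -, rfl⟩ := h3 Q hQ
  by_cases hx : f x = x
  · simpa [hx] using hsing x
  · exact hpair _ _ (hf.adj x hx)

theorem unmatched_union {P : V → V → Prop} {U T : Finset V} {f : Equiv.Perm V} (hf : IsMatchingOn P U f)
    (hUT : Disjoint U T) :
    IsMatchingOn P (U ∪ T) f ∧ (unmatched (U ∪ T) f).card = (unmatched U f).card + T.card := by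
  refine ⟨⟨hf.1, fun x hx => Finset.mem_union_left _ (hf.2 x hx)⟩, ?_⟩
  have : unmatched (U ∪ T) f = unmatched U f ∪ T := by
    ext x
    simp only [mem_unmatched, Finset.mem_union]
    constructor
    · rintro ⟨h | h, h'⟩
      exacts [Or.inl ⟨h, h'⟩, Or.inr h]
    · rintro (⟨h, h'⟩ | h)
      · exact ⟨Or.inl h, h'⟩
      · exact ⟨Or.inr h, by_contra fun h' => Finset.disjoint_left.1 hUT (hf.2 x h') h⟩
  rw [this, Finset.card_union_of_disjoint]
  exact hUT.mono_left (Finset.filter_subset _ _)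

/-- Restricting a maximum matching to the complement of a barrier `A`. -/
theorem exists_restrict_barrier {P : V → V → Prop} {U A : Finset V} (hAU : A ⊆ U)
    {f : Equiv.Perm V} (hf : IsMatchingOn P U f)
    (hc : ∀ g, IsMaxMatchingOn P (U \ A) g →
      (unmatched (U \ A) g).card = (unmatched U f).card + A.card) :
    ∃ g, IsMaxMatchingOn P (U \ A) g ∧ (∀ x, g x ≠ x → g x = f x) ∧
      (∀ x, f x = x → g x = x) ∧ ∀ a ∈ A, f a ∈ U \ A ∧ g (f a) = f a := by
  obtain ⟨g, hg, h1, h2⟩ := (⟨fun x => rfl, fun x hx => absurd rfl hx⟩ :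
    IsPairing P (1 : Equiv.Perm V)).piecewise hf.1 (X := {x | x ∈ A ∨ f x ∈ A}) (fun x hx => hx)
      (fun x hx => by simpa [hf.1.inv, or_comm] using hx)
  have hgA : ∀ a, a ∈ A → g a = a := fun a ha => h1 a (Or.inl ha)
  have hgA' : ∀ a, f a ∈ A → g a = a := fun a ha => h1 a (Or.inr ha)
  have hgf : ∀ x, g x ≠ x → g x = f x := fun x hx => h2 x (fun h => hx (h1 x h))
  have hgm : IsMatchingOn P (U \ A) g := ⟨hg, fun x hx => Finset.mem_sdiff.2
    ⟨hf.2 x (hgf x hx ▸ hx), fun h => hx (hgA x h)⟩⟩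
  obtain ⟨g0, hg0⟩ := exists_isMaxMatchingOn (P := P) (U \ A)
  have hsub : unmatched (U \ A) g ⊆ unmatched U f ∪ (A.image f) \ A := by
    intro x hx
    obtain ⟨hxU, hgx⟩ := mem_unmatched.1 hx
    obtain ⟨hxU, hxA⟩ := Finset.mem_sdiff.1 hxU
    by_cases hfx : f x ∈ A
    · exact Finset.mem_union_right _ (Finset.mem_sdiff.2
        ⟨Finset.mem_image.2 ⟨f x, hfx, hf.1.inv x⟩, hxA⟩)
    · refine Finset.mem_union_left _ (mem_unmatched.2 ⟨hxU, ?_⟩)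
      rw [← h2 x (by simp [hxA, hfx]), hgx]
  have c1 := Finset.card_le_card hsub
  have c2 := Finset.card_union_le (unmatched U f) ((A.image f) \ A)
  have c3 := hc g0 hg0
  have c4 := hg0.2 g hgm
  have c5 : (A.image f).card ≤ A.card := Finset.card_image_le
  have c6 : ((A.image f) \ A).card ≤ (A.image f).card := Finset.card_le_card Finset.sdiff_subset
  have c7 : (A.image f) \ A = A.image f :=
    Finset.eq_of_subset_of_card_le Finset.sdiff_subset (by omega)
  refine ⟨g, hg0.of_card_le hgm (by omega), hgf, fun x hx => ?_, fun a ha => ⟨?_, ?_⟩⟩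
  · by_contra h
    exact h (hgf x h ▸ hx)
  · have : f a ∈ (A.image f) \ A := by rw [c7]; exact Finset.mem_image_of_mem f ha
    exact Finset.mem_sdiff.2 ⟨hf.map_mem (hAU ha), (Finset.mem_sdiff.1 this).2⟩
  · exact hgA' _ (by rwa [hf.1.inv])

end Covers

section SmallCritical

variable {V : Type u} [Fintype V] {P : V → V → Prop} {F : Finset V → Prop}

/-- A partition of the vertex set into members of `F`, split into a family `𝒞` of blocks of size at
least two and a matching `f` of the remaining vertices, which stands for blocks of size one and two;
there are at most `k` blocks in total. -/
def IsMixedPartition (P : V → V → Prop) (F : Finset V → Prop) (k : ℕ) (𝒞 : Finset (Finset V))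
    (f : Equiv.Perm V) : Prop :=
  (𝒞 : Set (Finset V)).PairwiseDisjoint id ∧ (∀ Q ∈ 𝒞, F Q ∧ 2 ≤ Q.card) ∧
    IsMatchingOn P (Finset.univ \ 𝒞.biUnion id) f ∧
    2 * 𝒞.card + (Finset.univ \ 𝒞.biUnion id).card +
      (unmatched (Finset.univ \ 𝒞.biUnion id) f).card ≤ 2 * k

theorem exists_isMixedPartition (hmono : ∀ Q Q', Q' ⊆ Q → F Q → F Q') {k : ℕ}
    (h : IsCoverable F Finset.univ k) : ∃ 𝒞 f, IsMixedPartition P F k 𝒞 f := by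
  obtain ⟨φ, h1, h2⟩ := h.exists_partition hmono
  set fib : Finset V → Finset V := fun Q => Finset.univ.filter (fun x => φ x = Q) with hfib
  set I := Finset.univ.image φ with hI
  set 𝒞 := (I.filter (fun Q => 2 ≤ (fib Q).card)).image fib with h𝒞
  set U := Finset.univ \ 𝒞.biUnion id with hU
  have hUc : U.card ≤ (I.filter (fun Q => ¬ 2 ≤ (fib Q).card)).card := by
    refine Finset.card_le_card_of_injOn φ (fun x hx => ?_) (fun x hx y hy hxy => ?_)
    · refine Finset.mem_coe.2 (Finset.mem_filter.2
        ⟨Finset.mem_image_of_mem _ (Finset.mem_univ _), fun h2 => ?_⟩)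
      refine (Finset.mem_sdiff.1 (Finset.mem_coe.1 hx)).2 (Finset.mem_biUnion.2 ⟨fib (φ x), ?_, ?_⟩)
      · exact Finset.mem_image_of_mem _ (Finset.mem_filter.2
          ⟨Finset.mem_image_of_mem _ (Finset.mem_univ _), h2⟩)
      · simp [hfib]
    · by_contra hne
      have h2 : 2 ≤ (fib (φ x)).card := by
        rw [← Finset.card_pair hne]
        exact Finset.card_le_card (by intro z hz; simp at hz; rcases hz with rfl | rfl <;> simp [hfib, hxy])
      refine (Finset.mem_sdiff.1 (Finset.mem_coe.1 hx)).2 (Finset.mem_biUnion.2 ⟨fib (φ x), ?_, ?_⟩)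
      · exact Finset.mem_image_of_mem _ (Finset.mem_filter.2
          ⟨Finset.mem_image_of_mem _ (Finset.mem_univ _), h2⟩)
      · simp [hfib]
  have hsum := Finset.card_filter_add_card_filter_not (s := I) (fun Q => 2 ≤ (fib Q).card)
  have h𝒞c : 𝒞.card ≤ (I.filter (fun Q => 2 ≤ (fib Q).card)).card := Finset.card_image_le
  refine ⟨𝒞, 1, ?_, ?_, ⟨⟨fun x => rfl, fun x hx => absurd rfl hx⟩, fun x hx => absurd rfl hx⟩, ?_⟩
  · intro Q hQ R hR hQR
    obtain ⟨Q', -, rfl⟩ := Finset.mem_image.1 (Finset.mem_coe.1 hQ)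
    obtain ⟨R', -, rfl⟩ := Finset.mem_image.1 (Finset.mem_coe.1 hR)
    refine Finset.disjoint_left.2 fun x hx hx' => hQR ?_
    simp only [hfib, id, Finset.mem_filter, Finset.mem_univ, true_and] at hx hx' ⊢
    rw [← hx, ← hx']
  · intro Q hQ
    obtain ⟨Q', hQ', rfl⟩ := Finset.mem_image.1 hQ
    exact ⟨h2 _ (Finset.mem_filter.1 hQ').1, (Finset.mem_filter.1 hQ').2⟩
  · have : (unmatched U (1 : Equiv.Perm V)).card ≤ U.card := Finset.card_filter_le _ _
    rw [← hU]
    omega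

/-- In a mixed partition with as few singletons as possible, and then with as few big blocks as
possible, a vertex that can be made a singleton is unrelated to all vertices of big blocks. -/
theorem not_adj_block (hP : ∀ x y, P x y → P y x) (hmono : ∀ Q Q', Q' ⊆ Q → F Q → F Q')
    {k : ℕ} {𝒞 : Finset (Finset V)} {f : Equiv.Perm V} (h : IsMixedPartition P F k 𝒞 f)
    (hmin : ∀ 𝒞' f', IsMixedPartition P F k 𝒞' f' →
      (unmatched (Finset.univ \ 𝒞.biUnion id) f).card ≤
          (unmatched (Finset.univ \ 𝒞'.biUnion id) f').card ∧
        ((unmatched (Finset.univ \ 𝒞'.biUnion id) f').card =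
          (unmatched (Finset.univ \ 𝒞.biUnion id) f).card → 𝒞.card ≤ 𝒞'.card))
    {x y : V} (hx : x ∈ Finset.univ \ 𝒞.biUnion id) (hfx : f x = x)
    (hy : y ∉ Finset.univ \ 𝒞.biUnion id) : ¬ P x y := by
  intro hxy
  obtain ⟨h1, h2, h3, h4⟩ := h
  set U := Finset.univ \ 𝒞.biUnion id with hU
  simp only [hU, Finset.mem_sdiff, Finset.mem_univ, true_and, not_not] at hy
  obtain ⟨Q, hQ, hyQ⟩ := Finset.mem_biUnion.1 hy
  simp only [id] at hyQ
  have hdisj : ∀ R ∈ 𝒞, R ≠ Q → ∀ z ∈ R, z ∉ Q := fun R hR hRQ z hzR hzQ =>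
    Finset.disjoint_left.1 (h1 (Finset.mem_coe.2 hR) (Finset.mem_coe.2 hQ) hRQ) hzR hzQ
  have hUQ : ∀ z ∈ U, z ∉ Q := fun z hz hzQ =>
    (Finset.mem_sdiff.1 hz).2 (Finset.mem_biUnion.2 ⟨Q, hQ, hzQ⟩)
  have hyU : y ∉ U := fun h => hUQ y h hyQ
  have hfy : f y = y := by_contra fun h => hyU (h3.2 y h)
  have hne : x ≠ y := fun h => hyU (h ▸ hx)
  have hpos : 0 < 𝒞.card := Finset.card_pos.2 ⟨Q, hQ⟩
  have hec := Finset.card_erase_of_mem hQ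
  by_cases hQ2 : Q.card = 2
  · have hU' : Finset.univ \ (𝒞.erase Q).biUnion id = U ∪ Q := by
      ext z
      simp only [hU, Finset.mem_sdiff, Finset.mem_univ, true_and, Finset.mem_biUnion,
        Finset.mem_erase, Finset.mem_union, id]
      constructor
      · intro hz
        by_cases hzQ : z ∈ Q
        · exact Or.inr hzQ
        · exact Or.inl fun ⟨R, hR, hzR⟩ => hz ⟨R, ⟨fun h => hzQ (h ▸ hzR), hR⟩, hzR⟩
      · rintro (hz | hz) ⟨R, ⟨hRQ, hR⟩, hzR⟩
        · exact hz ⟨R, hR, hzR⟩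
        · exact hdisj R hR hRQ z hzR hz
    have hUQd : Disjoint U Q := Finset.disjoint_left.2 hUQ
    obtain ⟨k1, k2⟩ := unmatched_union h3 hUQd
    obtain ⟨g, hg, -, -, -, hgc⟩ := k1.join hP (Finset.mem_union_left _ hx)
      (Finset.mem_union_right _ hyQ) hfx hfy hne hxy
    have hm := hmin (𝒞.erase Q) g ⟨h1.subset (by simp), fun R hR => h2 R (Finset.mem_of_mem_erase hR),
      by rw [hU']; exact hg, by rw [hU', Finset.card_union_of_disjoint hUQd]; omega⟩
    rw [hU'] at hm
    have := hm.2 (by omega)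
    omega
  · have hQ3 : 3 ≤ Q.card := by have := (h2 Q hQ).2; omega
    have hU' : Finset.univ \ (insert (Q.erase y) (𝒞.erase Q)).biUnion id = U ∪ {y} := by
      ext z
      simp only [hU, Finset.mem_sdiff, Finset.mem_univ, true_and, Finset.mem_biUnion,
        Finset.mem_erase, Finset.mem_union, id, Finset.mem_insert, Finset.mem_singleton]
      constructor
      · intro hz
        by_cases hzy : z = y
        · exact Or.inr hzy
        · refine Or.inl fun ⟨R, hR, hzR⟩ => ?_
          by_cases hRQ : R = Q
          · exact hz ⟨Q.erase y, Or.inl rfl, Finset.mem_erase.2 ⟨hzy, hRQ ▸ hzR⟩⟩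
          · exact hz ⟨R, Or.inr ⟨hRQ, hR⟩, hzR⟩
      · rintro (hz | hz) ⟨R, rfl | ⟨hRQ, hR⟩, hzR⟩
        · exact hz ⟨Q, hQ, Finset.mem_of_mem_erase hzR⟩
        · exact hz ⟨R, hR, hzR⟩
        · exact (Finset.mem_erase.1 hzR).1 hz
        · exact hdisj R hR hRQ z hzR (hz ▸ hyQ)
    have hUQd : Disjoint U {y} := by simpa using hyU
    obtain ⟨k1, k2⟩ := unmatched_union h3 hUQd
    obtain ⟨g, hg, -, -, -, hgc⟩ := k1.join hP (Finset.mem_union_left _ hx)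
      (Finset.mem_union_right _ (Finset.mem_singleton_self _)) hfx hfy hne hxy
    have hcle := Finset.card_insert_le (Q.erase y) (𝒞.erase Q)
    rw [Finset.card_singleton] at k2
    have hm := hmin (insert (Q.erase y) (𝒞.erase Q)) g ⟨?_, ?_, by rw [hU']; exact hg, by
      rw [hU', Finset.card_union_of_disjoint hUQd, Finset.card_singleton]; omega⟩
    · rw [hU'] at hm
      omega
    · rw [Finset.coe_insert, Set.pairwiseDisjoint_insert]
      refine ⟨h1.subset (by simp), fun R hR _ => Finset.disjoint_left.2 fun z hz hzR => ?_⟩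
      obtain ⟨hRQ, hR⟩ := Finset.mem_erase.1 (Finset.mem_coe.1 hR)
      exact hdisj R hR hRQ z hzR (Finset.mem_of_mem_erase hz)
    · intro R hR
      rcases Finset.mem_insert.1 hR with rfl | hR
      · exact ⟨hmono _ _ (Finset.erase_subset _ _) (h2 Q hQ).1, by
          rw [Finset.card_erase_of_mem hyQ]; omega⟩
      · exact h2 R (Finset.mem_of_mem_erase hR)

/-- If `V` cannot be covered by `j` members of `F`, then neither can an invariant set `K` of a mixed
partition be covered by fewer members than the mixed partition uses on it. -/
theorem le_of_isCoverable_invariant (hsing : ∀ x, F {x}) (hpair : ∀ x y, P x y → F {x, y})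
    {j : ℕ} (hj : ¬ IsCoverable F Finset.univ j) {U : Finset V} {c : ℕ}
    (hc : IsCoverable F (Finset.univ \ U) c) {f : Equiv.Perm V} (hf : IsMatchingOn P U f)
    (hcU : 2 * c + U.card + (unmatched U f).card ≤ 2 * j + 2) {K : Finset V} (hKU : K ⊆ U)
    (hK : ∀ x ∈ K, f x ∈ K) {m : ℕ} (hm : IsCoverable F K m) :
    K.card + (unmatched K f).card ≤ 2 * m := by
  have hT : ∀ x ∈ U \ K, f x ∈ U \ K := fun x hx => by
    obtain ⟨h1, h2⟩ := Finset.mem_sdiff.1 hx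
    exact Finset.mem_sdiff.2 ⟨hf.map_mem h1, fun h => h2 (by simpa [hf.1.inv] using hK _ h)⟩
  obtain ⟨m', h1, h2⟩ := isCoverable_of_pairing hsing hpair hf.1 hT
  have e1 := Finset.card_sdiff_add_card_eq_card hKU
  have e2 : (unmatched (U \ K) f).card + (unmatched K f).card = (unmatched U f).card := by
    rw [← Finset.card_union_of_disjoint]
    · congr 1
      ext x
      simp only [Finset.mem_union, mem_unmatched, Finset.mem_sdiff]
      have := @hKU x
      tauto
    · refine Finset.disjoint_left.2 fun x hx hx' => ?_
      exact (Finset.mem_sdiff.1 (mem_unmatched.1 hx).1).2 (mem_unmatched.1 hx').1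
  by_contra hlt
  refine hj (((hc.union h2).union hm).mono (fun x _ => ?_) (by omega))
  simp only [Finset.mem_union, Finset.mem_sdiff, Finset.mem_univ, true_and]
  tauto

end SmallCritical

/-! ### Small vertex-critical complexes -/

section SmallCritical

variable {V : Type u} [Fintype V] {P : V → V → Prop} {F : Finset V → Prop}

/-- The factor-critical part of a barrier decomposition needs many members of `F`: a family that covers
the missable vertices has at least as many members meeting them as the mixed partition has blocks
on them and on the barrier. -/
theorem le_card_filter_meeting (hP : ∀ x y, P x y → P y x) (hsing : ∀ x, F {x})
    (hpair : ∀ x y, P x y → F {x, y}) (hcl : ∀ Q, F Q → ∀ x ∈ Q, ∀ y ∈ Q, x ≠ y → P x y)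
    {j : ℕ} (hj : ¬ IsCoverable F Finset.univ j) {U A : Finset V} {c s : ℕ}
    (hc : IsCoverable F (Finset.univ \ U) c)
    (hs : ∀ f, IsMaxMatchingOn P U f → (unmatched U f).card = s)
    (hcU : 2 * c + U.card + s ≤ 2 * j + 2) (hAU : A ⊆ U)
    (hDA : missable P (U \ A) = missable P U)
    (hAc : ∀ g, IsMaxMatchingOn P (U \ A) g → (unmatched (U \ A) g).card = s + A.card)
    (hN : ∀ x ∈ missable P U, ∀ y ∈ U, P x y → y ∈ missable P U ∨ y ∈ A)
    {𝒬 : Finset (Finset V)} (h𝒬 : ∀ Q ∈ 𝒬, F Q) (hcov : ∀ x ∈ missable P U, ∃ Q ∈ 𝒬, x ∈ Q) :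
    (missable P U).card + s + A.card ≤ 2 * (𝒬.filter (fun Q => ∃ y ∈ Q, y ∈ missable P U)).card := by
  set D := missable P U with hD
  set R : V → V → Prop := fun x y => ∀ g, IsMaxMatchingOn P (U \ A) g → g x = x → g y = y → x = y
    with hR
  have hDUA : ∀ x ∈ D, x ∈ U \ A := fun x hx => by
    rw [← hDA] at hx; exact (mem_missable.1 hx).1
  have hRsymm : ∀ x y, R x y → R y x := fun x y h g hg h1 h2 => (h g hg h2 h1).symm
  have hRtrans : ∀ x y z, x ∈ D → y ∈ D → z ∈ D → R x y → R y z → R x z :=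
    fun x y z hx hy hz hxy hyz g hg h1 h2 =>
      missed_trans (hDUA x hx) (by rwa [hDA]) (hDUA z hz) hxy hyz g hg h1 h2
  have hRadj : ∀ x y, x ∈ D → y ∈ D → P x y → R x y := by
    intro x y hx hy hxy g hg h1 h2
    by_contra hne
    obtain ⟨g', hg', -, -, -, hc'⟩ := hg.1.join hP (hDUA x hx) (hDUA y hy) h1 h2 hne hxy
    have := hg.2 g' hg'
    omega
  set cls : V → Finset V := fun x => D.filter (R x) with hcls
  have hself : ∀ x ∈ D, x ∈ cls x := fun x hx => Finset.mem_filter.2 ⟨hx, fun _ _ _ _ => rfl⟩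
  have hcls_eq : ∀ x y, x ∈ D → y ∈ D → R x y → cls x = cls y := by
    intro x y hx hy hxy
    ext z
    simp only [hcls, Finset.mem_filter]
    exact ⟨fun ⟨h1, h2⟩ => ⟨h1, hRtrans y x z hy hx h1 (hRsymm x y hxy) h2⟩,
      fun ⟨h1, h2⟩ => ⟨h1, hRtrans x y z hx hy h1 hxy h2⟩⟩
  have hrestr : ∀ f, IsMaxMatchingOn P U f → ∃ g, IsMaxMatchingOn P (U \ A) g ∧
      (∀ x, g x ≠ x → g x = f x) ∧ (∀ x, f x = x → g x = x) ∧
        ∀ a ∈ A, f a ∈ U \ A ∧ g (f a) = f a := fun f hf =>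
    exists_restrict_barrier hAU hf.1 (fun g hg => by rw [hAc g hg, hs f hf])
  -- each class needs more than half as many members of `F` as it has vertices
  have hbound : ∀ x ∈ D, (cls x).card + 1 ≤
      2 * (𝒬.filter (fun Q => ∃ y ∈ Q, y ∈ cls x)).card := by
    intro x hx
    obtain ⟨hxU, f, hf, hfx⟩ := mem_missable.1 hx
    obtain ⟨g, hg, hgf, hfg, -⟩ := hrestr f hf
    have hgx := hfg x hfx
    have hKf : ∀ y ∈ cls x, y ≠ x → f y ≠ y ∧ f y ∈ cls x := by
      intro y hy hyx
      obtain ⟨hyD, hxy⟩ := Finset.mem_filter.1 hy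
      have hgy : g y ≠ y := fun h => hyx (hxy g hg hgx h).symm
      have hfy : f y = g y := (hgf y hgy).symm
      have hPy : P y (f y) := hfy ▸ hg.1.1.adj y hgy
      have hfyU : f y ∈ U \ A := hfy ▸ hg.1.map_mem (hDUA y hyD)
      have hfyD : f y ∈ D := (hN y hyD (f y) (Finset.mem_sdiff.1 hfyU).1 hPy).resolve_right
        (Finset.mem_sdiff.1 hfyU).2
      exact ⟨fun h => hgy (hfy ▸ h), Finset.mem_filter.2
        ⟨hfyD, hRtrans x y (f y) hx hyD hfyD hxy (hRadj y (f y) hyD hfyD hPy)⟩⟩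
    have hKU : cls x ⊆ U := fun y hy =>
      (Finset.mem_sdiff.1 (hDUA y (Finset.mem_filter.1 hy).1)).1
    have hinv : ∀ y ∈ cls x, f y ∈ cls x := by
      intro y hy
      by_cases hyx : y = x
      · rw [hyx, hfx]; exact hself x hx
      · exact (hKf y hy hyx).2
    have hunm : unmatched (cls x) f = {x} := by
      ext y
      simp only [mem_unmatched, Finset.mem_singleton]
      constructor
      · rintro ⟨hy, hfy⟩
        by_contra hyx
        exact (hKf y hy hyx).1 hfy
      · rintro rfl; exact ⟨hself y hx, hfx⟩
    have := le_of_isCoverable_invariant hsing hpair hj hc hf.1 (by rw [hs f hf]; exact hcU) hKU hinv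
      (m := (𝒬.filter (fun Q => ∃ y ∈ Q, y ∈ cls x)).card)
      ⟨_, le_rfl, fun Q hQ => h𝒬 Q (Finset.mem_filter.1 hQ).1, fun y hy => by
        obtain ⟨Q, hQ, hyQ⟩ := hcov y (Finset.mem_filter.1 hy).1
        exact ⟨Q, Finset.mem_filter.2 ⟨hQ, y, hyQ, hy⟩, hyQ⟩⟩
    rwa [hunm, Finset.card_singleton] at this
  set 𝒦 := D.image cls with h𝒦
  have hcardD : D.card = ∑ K ∈ 𝒦, K.card := by
    rw [Finset.card_eq_sum_card_image cls D]
    refine Finset.sum_congr rfl fun K hK => ?_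
    obtain ⟨x, hx, rfl⟩ := Finset.mem_image.1 hK
    congr 1
    ext y
    constructor
    · intro hy
      obtain ⟨hyD, hyx⟩ := Finset.mem_filter.1 hy
      exact hyx ▸ hself y hyD
    · intro hy
      obtain ⟨hyD, hxy⟩ := Finset.mem_filter.1 hy
      exact Finset.mem_filter.2 ⟨hyD, (hcls_eq x y hx hyD hxy).symm⟩
  have hcard𝒦 : s + A.card ≤ 𝒦.card := by
    obtain ⟨g, hg⟩ := exists_isMaxMatchingOn (P := P) (U \ A)
    have hgD : ∀ x ∈ unmatched (U \ A) g, x ∈ D := fun x hx => by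
      rw [← hDA]
      exact mem_missable.2 ⟨(mem_unmatched.1 hx).1, g, hg, (mem_unmatched.1 hx).2⟩
    rw [← hAc g hg]
    refine Finset.card_le_card_of_injOn cls
      (fun x hx => Finset.mem_coe.2 (Finset.mem_image_of_mem _ (hgD x hx))) ?_
    intro x hx y hy hxy
    have hy' : y ∈ cls x := by
      rw [hxy]; exact hself y (hgD y hy)
    exact (Finset.mem_filter.1 hy').2 g hg (mem_unmatched.1 hx).2 (mem_unmatched.1 hy).2
  have hdisj : (𝒦 : Set (Finset V)).PairwiseDisjoint
      (fun K => 𝒬.filter (fun Q => ∃ y ∈ Q, y ∈ K)) := by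
    intro K hK K' hK' hne
    obtain ⟨x, hx, rfl⟩ := Finset.mem_image.1 (Finset.mem_coe.1 hK)
    obtain ⟨x', hx', rfl⟩ := Finset.mem_image.1 (Finset.mem_coe.1 hK')
    refine Finset.disjoint_left.2 fun Q hQ hQ' => hne ?_
    obtain ⟨hQ1, y, hyQ, hy⟩ := Finset.mem_filter.1 hQ
    obtain ⟨-, y', hyQ', hy'⟩ := Finset.mem_filter.1 hQ'
    obtain ⟨hyD, hxy⟩ := Finset.mem_filter.1 hy
    obtain ⟨hyD', hxy'⟩ := Finset.mem_filter.1 hy'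
    rw [hcls_eq x y hx hyD hxy, hcls_eq x' y' hx' hyD' hxy']
    by_cases hyy : y = y'
    · rw [hyy]
    · exact hcls_eq y y' hyD hyD' (hRadj y y' hyD hyD' (hcl Q (h𝒬 Q hQ1) y hyQ y' hyQ' hyy))
  have hsum : ∑ K ∈ 𝒦, (𝒬.filter (fun Q => ∃ y ∈ Q, y ∈ K)).card ≤
      (𝒬.filter (fun Q => ∃ y ∈ Q, y ∈ D)).card := by
    rw [← Finset.card_biUnion hdisj]
    refine Finset.card_le_card fun Q hQ => ?_
    obtain ⟨K, hK, hQ⟩ := Finset.mem_biUnion.1 hQ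
    obtain ⟨x, hx, rfl⟩ := Finset.mem_image.1 hK
    obtain ⟨hQ1, y, hyQ, hy⟩ := Finset.mem_filter.1 hQ
    exact Finset.mem_filter.2 ⟨hQ1, y, hyQ, (Finset.mem_filter.1 hy).1⟩
  have hle : ∑ K ∈ 𝒦, (K.card + 1) ≤
      ∑ K ∈ 𝒦, 2 * (𝒬.filter (fun Q => ∃ y ∈ Q, y ∈ K)).card := by
    refine Finset.sum_le_sum fun K hK => ?_
    obtain ⟨x, hx, rfl⟩ := Finset.mem_image.1 hK
    exact hbound x hx
  rw [Finset.sum_add_distrib, ← hcardD, ← Finset.mul_sum, Finset.sum_const, smul_eq_mul,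
    mul_one] at hle
  omega

/-- A simplicial complex `F` that is vertex-critical for covers by more than `j` members, and whose
graph `P` of pairs is connected, has at least `2 * j + 1` vertices; if it has exactly that many, then
its graph of pairs is factor-critical. -/
theorem card_ge_and_factorCritical (hP : ∀ x y, P x y → P y x) (hsing : ∀ x, F {x})
    (hmono : ∀ Q Q', Q' ⊆ Q → F Q → F Q')
    (hpair : ∀ x y, P x y → F {x, y}) (hcl : ∀ Q, F Q → ∀ x ∈ Q, ∀ y ∈ Q, x ≠ y → P x y)
    {j : ℕ} (hj : ¬ IsCoverable F Finset.univ j)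
    (herase : ∀ a, IsCoverable F (Finset.univ.erase a) j)
    (hconn : ∀ S : Finset V, S.Nonempty → (∀ x ∈ S, ∀ y, P x y → y ∈ S) → S = Finset.univ) :
    2 * j + 1 ≤ Fintype.card V ∧
      (Fintype.card V = 2 * j + 1 → ∀ v, ∃ f, IsPairing P f ∧ ∀ x, f x = x ↔ x = v) := by
  have hne : Nonempty V := by
    by_contra h
    rw [not_nonempty_iff] at h
    exact hj ⟨∅, by simp, by simp, fun x => (h.false x).elim⟩
  obtain ⟨v0⟩ := hne
  have hcov1 : IsCoverable F Finset.univ (j + 1) :=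
    ((herase v0).union (isCoverable_one (hsing v0))).mono
      (fun x _ => by by_cases h : x = v0 <;> simp [h]) le_rfl
  have hex : ∃ n 𝒞 f, IsMixedPartition P F (j + 1) 𝒞 f ∧
      (unmatched (Finset.univ \ 𝒞.biUnion id) f).card = n := by
    obtain ⟨𝒞, f, h⟩ := exists_isMixedPartition (P := P) hmono hcov1
    exact ⟨_, 𝒞, f, h, rfl⟩
  have hex' : ∃ c 𝒞 f, IsMixedPartition P F (j + 1) 𝒞 f ∧
      (unmatched (Finset.univ \ 𝒞.biUnion id) f).card = Nat.find hex ∧ 𝒞.card = c := by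
    obtain ⟨𝒞, f, h1, h2⟩ := Nat.find_spec hex
    exact ⟨_, 𝒞, f, h1, h2, rfl⟩
  obtain ⟨𝒞, f, hmix, hfs, hfc⟩ := Nat.find_spec hex'
  have hmin1 : ∀ 𝒞' f', IsMixedPartition P F (j + 1) 𝒞' f' →
      (unmatched (Finset.univ \ 𝒞.biUnion id) f).card ≤
        (unmatched (Finset.univ \ 𝒞'.biUnion id) f').card := fun 𝒞' f' h' =>
    hfs ▸ Nat.find_min' hex ⟨𝒞', f', h', rfl⟩
  have hmin2 : ∀ 𝒞' f', IsMixedPartition P F (j + 1) 𝒞' f' →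
      (unmatched (Finset.univ \ 𝒞'.biUnion id) f').card =
        (unmatched (Finset.univ \ 𝒞.biUnion id) f).card → 𝒞.card ≤ 𝒞'.card := fun 𝒞' f' h' h'' =>
    hfc ▸ Nat.find_min' hex' ⟨𝒞', f', h', h''.trans hfs, rfl⟩
  clear hfs hfc hex hex'
  set U := Finset.univ \ 𝒞.biUnion id with hU
  obtain ⟨hdis, h𝒞, hfU, hcnt⟩ := hmix
  rw [← hU] at hfU hcnt
  have hmixU : ∀ g, IsMatchingOn P U g → (unmatched U g).card ≤ (unmatched U f).card →
      IsMixedPartition P F (j + 1) 𝒞 g := fun g hg hle =>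
    ⟨hdis, h𝒞, hg, by rw [← hU]; omega⟩
  have hfmax : IsMaxMatchingOn P U f := ⟨hfU, fun g hg => by
    by_contra hlt
    have := hmin1 𝒞 g (hmixU g hg (by omega))
    rw [← hU] at this
    omega⟩
  have hs : ∀ g, IsMaxMatchingOn P U g → (unmatched U g).card = (unmatched U f).card :=
    fun g hg => hg.card_eq hfmax
  have hout : ∀ x ∈ missable P U, ∀ y, P x y → y ∈ U := by
    intro x hx y hxy
    obtain ⟨hxU, g, hg, hgx⟩ := mem_missable.1 hx
    by_contra hy
    refine not_adj_block hP hmono (hmixU g hg.1 (hs g hg).le) (fun 𝒞' f' h' => ?_) hxU hgx hy hxy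
    rw [← hU, hs g hg]
    exact ⟨hmin1 𝒞' f' h', hmin2 𝒞' f' h'⟩
  have hUc : Finset.univ \ U = 𝒞.biUnion id := by rw [hU]; simp
  have hcC : IsCoverable F (Finset.univ \ U) 𝒞.card := by
    refine ⟨𝒞, le_rfl, fun Q hQ => (h𝒞 Q hQ).1, fun x hx => ?_⟩
    rw [hUc] at hx
    simpa using hx
  obtain ⟨A, hAU, hAD, hDA, hAc, hN⟩ := exists_barrier hP U
  have hAc' : ∀ g, IsMaxMatchingOn P (U \ A) g →
      (unmatched (U \ A) g).card = (unmatched U f).card + A.card := fun g hg => hAc f g hfmax hg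
  have hfD : unmatched U f ⊆ missable P U := fun x hx =>
    mem_missable.2 ⟨(mem_unmatched.1 hx).1, f, hfmax, (mem_unmatched.1 hx).2⟩
  -- vertex-criticality forces the barrier to be empty
  have hA0 : A = ∅ := by
    by_contra hA
    obtain ⟨a, ha⟩ := Finset.nonempty_iff_ne_empty.2 hA
    obtain ⟨𝒬, hq1, hq2, hq3⟩ := herase a
    have haD : a ∉ missable P U := Finset.disjoint_left.1 hAD ha
    have hle := le_card_filter_meeting hP hsing hpair hcl hj hcC hs (by omega) hAU hDA
      hAc' hN hq2 (fun x hx => hq3 x (Finset.mem_erase.2 ⟨fun h => haD (h ▸ hx), Finset.mem_univ _⟩))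
    have hsum := Finset.card_filter_add_card_filter_not (s := 𝒬)
      (fun Q => ∃ y ∈ Q, y ∈ missable P U)
    have hR : IsCoverable F (Finset.univ \ (missable P U ∪ A))
        (𝒬.filter (fun Q => ¬ ∃ y ∈ Q, y ∈ missable P U)).card := by
      refine ⟨_, le_rfl, fun Q hQ => hq2 Q (Finset.mem_filter.1 hQ).1, fun x hx => ?_⟩
      obtain ⟨-, hx⟩ := Finset.mem_sdiff.1 hx
      rw [Finset.mem_union, not_or] at hx
      obtain ⟨Q, hQ, hxQ⟩ := hq3 x (Finset.mem_erase.2 ⟨fun h => hx.2 (h ▸ ha), Finset.mem_univ _⟩)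
      refine ⟨Q, Finset.mem_filter.2 ⟨hQ, fun ⟨y, hyQ, hy⟩ => ?_⟩, hxQ⟩
      have hyx : P y x := hcl Q (hq2 Q hQ) y hyQ x hxQ (fun h => hx.1 (h ▸ hy))
      exact (hN y hy x (hout y hy x hyx) hyx).elim hx.1 hx.2
    obtain ⟨g, hg, hgf, hfg, hgA⟩ := exists_restrict_barrier hAU hfU hAc'
    have hfA : ∀ b ∈ A, f b ∈ missable P U := fun b hb => by
      rw [← hDA]
      exact mem_missable.2 ⟨(hgA b hb).1, g, hg, (hgA b hb).2⟩
    obtain ⟨m, hm1, hm2⟩ := isCoverable_of_pairing hsing hpair hfU.1 (T := missable P U ∪ A) (by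
      intro x hx
      rcases Finset.mem_union.1 hx with hx | hx
      · by_cases hfx : f x = x
        · rw [hfx]; exact Finset.mem_union_left _ hx
        · have := hfU.1.adj x hfx
          exact Finset.mem_union.2 (hN x hx _ (hout x hx _ this) this)
      · exact Finset.mem_union_left _ (hfA x hx))
    rw [Finset.card_union_of_disjoint hAD.symm] at hm1
    have hms : (unmatched (missable P U ∪ A) f).card ≤ (unmatched U f).card := by
      refine Finset.card_le_card fun x hx => ?_
      obtain ⟨hx1, hx2⟩ := mem_unmatched.1 hx
      refine mem_unmatched.2 ⟨?_, hx2⟩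
      rcases Finset.mem_union.1 hx1 with hx | hx
      exacts [(mem_missable.1 hx).1, hAU hx]
    refine hj ((hR.union hm2).mono (fun x _ => ?_) (by omega))
    simp only [Finset.mem_union, Finset.mem_sdiff, Finset.mem_univ, true_and]
    tauto
  subst hA0
  simp only [Finset.notMem_empty, or_false] at hN
  have hVU : Fintype.card V = U.card + (𝒞.biUnion id).card := by
    have := Finset.card_sdiff_add_card_eq_card (Finset.subset_univ U)
    rw [← hUc, ← Finset.card_univ]
    omega
  have hlow : 2 * j + 2 ≤ 2 * 𝒞.card + U.card + (unmatched U f).card := by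
    obtain ⟨m, hm1, hm2⟩ := isCoverable_of_pairing hsing hpair hfU.1 (T := U)
      (fun x hx => hfU.map_mem hx)
    by_contra hlt
    refine hj ((hcC.union hm2).mono (fun x _ => ?_) (by omega))
    simp only [Finset.mem_union, Finset.mem_sdiff, Finset.mem_univ, true_and]
    tauto
  have hbig : 2 * 𝒞.card ≤ (𝒞.biUnion id).card := by
    rw [Finset.card_biUnion hdis, mul_comm, ← smul_eq_mul, ← Finset.sum_const]
    exact Finset.sum_le_sum fun Q hQ => (h𝒞 Q hQ).2
  by_cases hs0 : (unmatched U f).card = 0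
  · exact ⟨by omega, fun h => by omega⟩
  obtain ⟨z, hz⟩ := Finset.card_pos.1 (Nat.pos_of_ne_zero hs0)
  have hDuniv : missable P U = Finset.univ := hconn _ ⟨z, hfD hz⟩
    (fun x hx y hxy => hN x hx y (hout x hx y hxy) hxy)
  have hUuniv : U = Finset.univ := by
    refine Finset.eq_univ_of_forall fun x => ?_
    have : x ∈ missable P U := hDuniv ▸ Finset.mem_univ x
    exact (mem_missable.1 this).1
  -- by Gallai's lemma no maximum matching misses two vertices
  have hall : ∀ x y, ∀ g, IsMaxMatchingOn P U g → g x = x → g y = y → x = y := by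
    intro x
    have := hconn (Finset.univ.filter
      (fun y => ∀ g, IsMaxMatchingOn P U g → g x = x → g y = y → x = y))
      ⟨x, by simp⟩ (fun y hy w hyw => ?_)
    · intro y
      have hy : y ∈ Finset.univ.filter
          (fun y => ∀ g, IsMaxMatchingOn P U g → g x = x → g y = y → x = y) := by
        rw [this]; exact Finset.mem_univ y
      exact (Finset.mem_filter.1 hy).2
    · refine Finset.mem_filter.2 ⟨Finset.mem_univ _, ?_⟩
      refine missed_trans (by rw [hUuniv]; exact Finset.mem_univ _) (by rw [hDuniv]; exact Finset.mem_univ y)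
        (by rw [hUuniv]; exact Finset.mem_univ _) (Finset.mem_filter.1 hy).2 ?_
      intro g hg h1 h2
      by_contra hne
      obtain ⟨g', hg', -, -, -, hc'⟩ := hg.1.join hP (by rw [hUuniv]; exact Finset.mem_univ _)
        (by rw [hUuniv]; exact Finset.mem_univ _) h1 h2 hne hyw
      have := hg.2 g' hg'
      omega
  have hs1 : (unmatched U f).card ≤ 1 := Finset.card_le_one.2 fun x hx y hy =>
    hall x y f hfmax (mem_unmatched.1 hx).2 (mem_unmatched.1 hy).2
  refine ⟨by omega, fun _ v => ?_⟩
  have hv : v ∈ missable P U := hDuniv ▸ Finset.mem_univ v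
  obtain ⟨-, g, hg, hgv⟩ := mem_missable.1 hv
  exact ⟨g, hg.1.1, fun x => ⟨fun h => hall x v g hg h hgv, fun h => h ▸ hgv⟩⟩

end SmallCritical

/-! ### Missing arcs and nearly perfect matchings of unlinked pairs -/

section Unlinked

variable {V : Type u}

/-- Two distinct vertices are unlinked if they are not joined by arcs in both directions; these are
the pairs that induce an acyclic subdigraph. -/
def Unlinked (D : Digraph V) (x y : V) : Prop := x ≠ y ∧ ¬ (D.Adj x y ∧ D.Adj y x)

/-- The indicator of a missing arc from `x` to `y`. -/
noncomputable def missingArc (D : Digraph V) (x y : V) : ℕ := if x ≠ y ∧ ¬ D.Adj x y then 1 else 0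

/-- The number of missing arcs between `x` and `y`, in both directions. -/
noncomputable def defect (D : Digraph V) (x y : V) : ℕ := D.missingArc x y + D.missingArc y x

/-- The three vertices carry a directed triangle in one of the two orientations. -/
def IsCyclicTriple (D : Digraph V) (x y z : V) : Prop :=
  (D.Adj x y ∧ D.Adj y z ∧ D.Adj z x) ∨ (D.Adj y x ∧ D.Adj z y ∧ D.Adj x z)

variable {D : Digraph V}

theorem Unlinked.symm {x y : V} (h : D.Unlinked x y) : D.Unlinked y x :=
  ⟨h.1.symm, fun h' => h.2 h'.symm⟩

theorem unlinked_symm (D : Digraph V) : ∀ x y, D.Unlinked x y → D.Unlinked y x :=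
  fun _ _ h => h.symm

theorem defect_comm (D : Digraph V) (x y : V) : D.defect x y = D.defect y x := add_comm _ _

theorem defect_self (D : Digraph V) (x : V) : D.defect x x = 0 := by simp [defect, missingArc]

theorem defect_le_two (D : Digraph V) (x y : V) : D.defect x y ≤ 2 := by
  unfold defect missingArc; split_ifs <;> simp

theorem defect_pos {x y : V} : 0 < D.defect x y ↔ D.Unlinked x y := by
  unfold defect missingArc Unlinked
  have : x ≠ y ↔ y ≠ x := ne_comm
  split_ifs <;> simp <;> tauto

theorem defect_eq_zero {x y : V} : D.defect x y = 0 ↔ ¬ D.Unlinked x y := by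
  rw [← defect_pos]; omega

theorem IsCyclicTriple.defect_eq {x y z : V} (h : D.IsCyclicTriple x y z) (hxy : D.Unlinked x y)
    (hyz : D.Unlinked y z) (hxz : D.Unlinked x z) :
    D.defect x y = 1 ∧ D.defect y z = 1 ∧ D.defect x z = 1 := by
  obtain ⟨a1, a2⟩ := hxy
  obtain ⟨b1, b2⟩ := hyz
  obtain ⟨c1, c2⟩ := hxz
  unfold defect missingArc
  rcases h with ⟨h1, h2, h3⟩ | ⟨h1, h2, h3⟩
  · have e1 : ¬ D.Adj y x := fun h => a2 ⟨h1, h⟩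
    have e2 : ¬ D.Adj z y := fun h => b2 ⟨h2, h⟩
    have e3 : ¬ D.Adj x z := fun h => c2 ⟨h, h3⟩
    simp [*, a1.symm, b1.symm, c1.symm]
  · have e1 : ¬ D.Adj x y := fun h => a2 ⟨h, h1⟩
    have e2 : ¬ D.Adj y z := fun h => b2 ⟨h, h2⟩
    have e3 : ¬ D.Adj z x := fun h => c2 ⟨h3, h⟩
    simp [*, a1.symm, b1.symm, c1.symm]

/-- The vertices outside `T` can be perfectly matched along unlinked pairs. -/
def IsCoMatched (D : Digraph V) (T : Set V) : Prop :=
  ∃ f, IsPairing D.Unlinked f ∧ ∀ x, f x = x ↔ x ∈ T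

theorem IsCoMatched.congr {S T : Set V} (h : D.IsCoMatched S) (hST : ∀ x, x ∈ S ↔ x ∈ T) :
    D.IsCoMatched T := by
  obtain ⟨f, hf, h'⟩ := h
  exact ⟨f, hf, fun x => (h' x).trans (hST x)⟩

theorem IsCoMatched.join {S T : Set V} (h : D.IsCoMatched S) {a b : V} (hab : D.Unlinked a b)
    (ha : a ∈ S) (hb : b ∈ S) (hT : ∀ x, x ∈ T ↔ x ∈ S ∧ x ≠ a ∧ x ≠ b) : D.IsCoMatched T := by
  obtain ⟨f, hf, h'⟩ := h
  obtain ⟨g, hg, h1, h2, h3⟩ := hf.join (unlinked_symm D) ((h' a).2 ha) ((h' b).2 hb) hab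
  refine ⟨g, hg, fun x => ?_⟩
  rw [hT]
  by_cases hxa : x = a
  · subst hxa; simp [h1, hab.1.symm]
  by_cases hxb : x = b
  · subst hxb; simp [h2, hab.1]
  rw [h3 x hxa hxb, h' x]; simp [hxa, hxb]

theorem IsCoMatched.cut {S T : Set V} {f : Equiv.Perm V} (hf : IsPairing D.Unlinked f)
    (hS : ∀ x, f x = x ↔ x ∈ S) (a : V) (hT : ∀ x, x ∈ T ↔ x ∈ S ∨ x = a ∨ x = f a) :
    D.IsCoMatched T := by
  obtain ⟨g, hg, h1, h2, h3⟩ := hf.cut a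
  refine ⟨g, hg, fun x => ?_⟩
  rw [hT]
  by_cases hxa : x = a
  · subst hxa; simp [h1]
  by_cases hxb : x = f a
  · subst hxb; simp [h2]
  rw [h3 x hxa hxb, hS x]; simp [hxa, hxb]

/-- The two properties of a vertex-critical digraph of order `2 * p + 1` and dichromatic number
`p + 1` without linked bipartition that determine its extremal structure: each vertex-deleted
subdigraph is perfectly matched by unlinked pairs, and a triangle of unlinked pairs whose complement is
so matched is a directed triangle. -/
structure IsFactorCritical (D : Digraph V) : Prop where
  erase : ∀ v, D.IsCoMatched {v}
  cyclic : ∀ x y z, D.Unlinked x y → D.Unlinked y z → D.Unlinked x z → D.IsCoMatched {x, y, z} →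
    D.IsCyclicTriple x y z

variable [Finite V]

/-- If a set `C` has a perfectly matched complement, then any other vertex `a` can replace some vertex
of `C`. -/
theorem IsFactorCritical.replace (hD : D.IsFactorCritical) {C : Set V} (hC : D.IsCoMatched C) {a : V} :
    ∃ x ∈ C, D.IsCoMatched (insert a (C \ {x})) := by
  obtain ⟨f, hf, hfC⟩ := hC
  obtain ⟨g, hg, hga⟩ := hD.erase a
  obtain ⟨X, haX, hXf, hXg, -, hX⟩ := exists_alternating_path hf.inv hg.inv ((hga a).2 rfl)
  rcases hX with ⟨u, huX, hfu, hu, -⟩ | ⟨w, -, hwa, hgw, -⟩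
  · refine ⟨u, (hfC u).1 hfu, ?_⟩
    obtain ⟨k, hk, h1, h2⟩ := hg.piecewise hf hXg hXf
    refine ⟨k, hk, fun x => ?_⟩
    by_cases hx : x ∈ X
    · rw [h1 x hx, hga]
      simp only [Set.mem_singleton_iff, Set.mem_insert_iff, Set.mem_sdiff, ← hfC]
      constructor
      · exact Or.inl
      · rintro (h | ⟨h, h'⟩)
        exacts [h, absurd (hu x hx h) h']
    · rw [h2 x hx, hfC]
      simp only [Set.mem_singleton_iff, Set.mem_insert_iff, Set.mem_sdiff]
      constructor
      · exact fun h => Or.inr ⟨h, fun h' => hx (h' ▸ huX)⟩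
      · rintro (h | ⟨h, h'⟩)
        exacts [absurd (h ▸ haX) hx, h]
  · exact absurd ((hga w).1 hgw) hwa

/-- Three of the four vertices of two matched pairs, or one vertex of each pair with the vertex `v`
missed by the matching, have a perfectly matched complement. -/
theorem IsFactorCritical.two_pairs (hD : D.IsFactorCritical) {f : Equiv.Perm V}
    (hf : IsPairing D.Unlinked f) {v : V} (hfv : ∀ x, f x = x ↔ x = v) {a c : V} (hav : a ≠ v)
    (hcv : c ≠ v) (hca : c ≠ a) (hcfa : c ≠ f a) :
    D.IsCoMatched {a, c, f c} ∨ D.IsCoMatched {v, a, c} ∨ D.IsCoMatched {a, f a, c} := by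
  have hfc : f c ≠ c := fun h => hcv ((hfv c).1 h)
  have hfa : f a ≠ a := fun h => hav ((hfv a).1 h)
  have hvfc : f c ≠ v := fun h => hcv (by rw [← hf.inv c, h, (hfv v).2 rfl])
  have hfca : f c ≠ a := fun h => hcfa (by rw [← h, hf.inv])
  have hfcfa : f c ≠ f a := fun h => hca (f.injective h)
  obtain ⟨f₁, hf₁, h1c, h1d, h1⟩ := hf.cut c
  have hf₁fix : ∀ x, f₁ x = x → x = v ∨ x = c ∨ x = f c := fun x hx => by
    by_contra! h
    exact h.1 ((hfv x).1 (h1 x h.2.1 h.2.2 ▸ hx))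
  have hf₁a : f₁ a = f a := h1 a hca.symm hfca.symm
  have hf₁v : f₁ v = v := (h1 v hcv.symm hvfc.symm).trans ((hfv v).2 rfl)
  obtain ⟨g, hg, hga⟩ := hD.erase a
  simp only [Set.mem_singleton_iff] at hga
  obtain ⟨X, haX, hXf, hXg, -, hX⟩ := exists_alternating_path hf₁.inv hg.inv ((hga a).2 rfl)
  obtain ⟨u, huX, hfu, hu, -⟩ : ∃ u ∈ X, f₁ u = u ∧ (∀ w ∈ X, f₁ w = w → w = u) ∧
      ∀ w ∈ X, g w = w → w = a :=
    hX.resolve_right fun ⟨w, _, hwa, hgw, _⟩ => hwa ((hga w).1 hgw)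
  -- the end of the alternating path from `a` in the complement of the second pair
  have key : ∀ T : Set V, (∀ x, x ∈ T ↔ x = a ∨ ((x = v ∨ x = c ∨ x = f c) ∧ x ≠ u)) →
      D.IsCoMatched T := by
    intro T hT
    obtain ⟨k, hk, k1, k2⟩ := hg.piecewise hf₁ hXg hXf
    refine ⟨k, hk, fun x => ?_⟩
    rw [hT]
    by_cases hx : x ∈ X
    · rw [k1 x hx, hga]
      constructor
      · exact Or.inl
      · rintro (h | ⟨rfl | rfl | rfl, h⟩)
        · exact h
        · exact absurd (hu _ hx hf₁v) h
        · exact absurd (hu _ hx h1c) h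
        · exact absurd (hu _ hx h1d) h
    · rw [k2 x hx]
      constructor
      · exact fun h => Or.inr ⟨hf₁fix x h, fun h' => hx (h' ▸ huX)⟩
      · rintro (h | ⟨rfl | rfl | rfl, h⟩)
        · exact absurd (h ▸ haX) hx
        · exact hf₁v
        · exact h1c
        · exact h1d
  rcases hf₁fix u hfu with rfl | rfl | rfl
  · left
    refine key _ fun x => ?_
    simp only [Set.mem_insert_iff, Set.mem_singleton_iff]
    constructor
    · rintro (rfl | rfl | rfl) <;> simp [hcv, hvfc]
    · tauto
  · right; right
    obtain ⟨g', hg', g1, g2⟩ := hf₁.piecewise hg hXf hXg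
    have hg'fix : ∀ x, g' x = x ↔ x = u := by
      intro x
      by_cases hx : x ∈ X
      · rw [g1 x hx]; exact ⟨hu x hx, fun h => h ▸ hfu⟩
      · rw [g2 x hx, hga]
        exact ⟨fun h => absurd (h ▸ haX) hx, fun h => absurd (h ▸ huX) hx⟩
    have hg'a : g' a = f a := (g1 a haX).trans hf₁a
    have hg'fa : g' (f a) = a := by rw [← hg'a, hg'.inv]
    obtain ⟨Y, huY, hYf, hYg, hYmin, hY⟩ :=
      exists_alternating_path hf.inv hg'.inv ((hg'fix u).2 rfl)
    obtain ⟨w, hwY, hfw, hw, -⟩ : ∃ w ∈ Y, f w = w ∧ (∀ z ∈ Y, f z = z → z = w) ∧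
        ∀ z ∈ Y, g' z = z → z = u :=
      hY.resolve_right fun ⟨w, _, hwa, hgw, _⟩ => hwa ((hg'fix w).1 hgw)
    have hYsub : Y ⊆ {x | x ≠ a ∧ x ≠ f a} := by
      refine hYmin _ ⟨hca, hcfa⟩ (fun x hx => ⟨fun h => hx.2 ?_, fun h => hx.1 (f.injective h)⟩)
        (fun x hx => ⟨fun h => hx.2 ?_, fun h => hx.1 ?_⟩)
      · rw [← h, hf.inv]
      · rw [← hg'a, ← h, hg'.inv]
      · rw [← hg'fa, ← h, hg'.inv]
    have haY : a ∉ Y := fun h => (hYsub h).1 rfl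
    obtain ⟨k, hk, k1, k2⟩ := hg'.piecewise hf hYg hYf
    have hwv : w = v := (hfv w).1 hfw
    have hkfix : ∀ x, k x = x ↔ x ∈ ({u} : Set V) := by
      intro x
      rw [Set.mem_singleton_iff]
      by_cases hx : x ∈ Y
      · rw [k1 x hx, hg'fix]
      · rw [k2 x hx, hfv]
        exact ⟨fun h => absurd (by rw [h, ← hwv]; exact hwY) hx, fun h => absurd (h ▸ huY) hx⟩
    refine IsCoMatched.cut hk hkfix a fun x => ?_
    rw [k2 a haY]
    simp only [Set.mem_insert_iff, Set.mem_singleton_iff]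
    tauto
  · right; left
    refine key _ fun x => ?_
    simp only [Set.mem_insert_iff, Set.mem_singleton_iff]
    constructor
    · rintro (rfl | rfl | rfl)
      · exact Or.inr ⟨Or.inl rfl, hvfc.symm⟩
      · exact Or.inl rfl
      · exact Or.inr ⟨Or.inr (Or.inl rfl), hfc.symm⟩
    · tauto

end Unlinked

/-! ### Missing arcs at a vertex and at a triangle -/

section LocalBounds

variable {V : Type u} {D : Digraph V}

/-- A vertex misses at most two arcs to each pair of a matching that leaves out this vertex only: if it is
unlinked to both vertices of the pair, then the three of them carry a directed triangle. -/
theorem IsFactorCritical.pair (hD : D.IsFactorCritical) {f : Equiv.Perm V}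
    (hf : IsPairing D.Unlinked f) {v : V} (hfv : ∀ x, f x = x ↔ x = v) {x : V} (hx : x ≠ v) :
    D.defect v x + D.defect v (f x) ≤ 2 ∧
      (D.Unlinked v x → D.Unlinked v (f x) → D.IsCyclicTriple v x (f x) ∧
        D.defect v x = 1 ∧ D.defect v (f x) = 1 ∧ D.defect x (f x) = 1) := by
  have hfx : f x ≠ x := fun h => hx ((hfv x).1 h)
  have key : D.Unlinked v x → D.Unlinked v (f x) → D.IsCyclicTriple v x (f x) ∧
        D.defect v x = 1 ∧ D.defect v (f x) = 1 ∧ D.defect x (f x) = 1 := by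
    intro h1 h2
    have h3 := hf.adj x hfx
    have hc : D.IsCoMatched {v, x, f x} :=
      IsCoMatched.cut (S := {v}) hf (fun y => by rw [hfv]; rfl) x
        (fun y => by simp only [Set.mem_insert_iff, Set.mem_singleton_iff])
    have h4 := hD.cyclic v x (f x) h1 h3 h2 hc
    have h5 := h4.defect_eq h1 h3 h2
    exact ⟨h4, h5.1, h5.2.2, h5.2.1⟩
  refine ⟨?_, key⟩
  have e1 := D.defect_le_two v x
  have e2 := D.defect_le_two v (f x)
  rcases Nat.eq_zero_or_pos (D.defect v x) with h | h
  · omega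
  rcases Nat.eq_zero_or_pos (D.defect v (f x)) with h' | h'
  · omega
  have := key (defect_pos.1 h) (defect_pos.1 h')
  omega

/-- If the vertices `x`, `y`, `z` are the unmatched ones, and `z` is unlinked to the partner of `a`, then `a` can
take the place of `z` in a triangle. -/
theorem cyclicTriple_of_swap (hD : D.IsFactorCritical) {f : Equiv.Perm V}
    (hf : IsPairing D.Unlinked f) {S : Set V} (hS : ∀ x, f x = x ↔ x ∈ S) {x y z a : V}
    (hSz : ∀ w, w ∈ S ↔ w = x ∨ w = y ∨ w = z) (hxy : D.Unlinked x y) (hxz : x ≠ z) (hyz : y ≠ z)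
    (ha : a ∉ S) (hxa : D.Unlinked x a) (hya : D.Unlinked y a) (hzb : D.Unlinked z (f a)) :
    D.IsCyclicTriple x y a ∧ D.defect x y = 1 ∧ D.defect x a = 1 ∧ D.defect y a = 1 := by
  have hfa : f a ∉ S := fun h => ha ((hS a).1 (f.injective ((hS _).2 h)))
  have hfa' : f a ≠ a := fun h => ha ((hS a).1 h)
  have h1 : D.IsCoMatched {w | w ∈ S ∨ w = a ∨ w = f a} :=
    IsCoMatched.cut hf hS a (fun _ => Iff.rfl)
  have h2 : D.IsCoMatched {x, y, a} := by
    refine h1.join hzb (Or.inl ((hSz z).2 (by simp))) (by simp) fun w => ?_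
    have e1 : a ≠ z := fun h => ha ((hSz a).2 (by simp [h]))
    have e2 : f a ≠ x := fun h => hfa ((hSz _).2 (by simp [h]))
    have e3 : f a ≠ y := fun h => hfa ((hSz _).2 (by simp [h]))
    simp only [Set.mem_insert_iff, Set.mem_singleton_iff, Set.mem_ofPred_eq, hSz]
    constructor
    · rintro (rfl | rfl | rfl) <;> simp [*, Ne.symm hfa', Ne.symm e2, Ne.symm e3]
    · tauto
  have h3 := hD.cyclic x y a hxy hya hxa h2
  have h4 := h3.defect_eq hxy hya hxa
  exact ⟨h3, h4.1, h4.2.2, h4.2.1⟩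

/-- Two faces of a tetrahedron of unlinked pairs cannot both be directed triangles in addition to the face
`x y z`. -/
theorem not_two_cyclicTriples {x y z a : V} (h : D.IsCyclicTriple x y z) (hxy : D.Unlinked x y)
    (hyz : D.Unlinked y z) (hxz : D.Unlinked x z)
    (hxa : D.Unlinked x a) (hya : D.Unlinked y a) (hza : D.Unlinked z a) :
    ¬ (D.IsCyclicTriple x y a ∧ D.IsCyclicTriple y z a) ∧
      ¬ (D.IsCyclicTriple x y a ∧ D.IsCyclicTriple x z a) ∧
        ¬ (D.IsCyclicTriple x z a ∧ D.IsCyclicTriple y z a) := by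
  obtain ⟨-, h1⟩ := hxy
  obtain ⟨-, h2⟩ := hyz
  obtain ⟨-, h3⟩ := hxz
  obtain ⟨-, h4⟩ := hxa
  obtain ⟨-, h5⟩ := hya
  obtain ⟨-, h6⟩ := hza
  unfold IsCyclicTriple at *
  refine ⟨?_, ?_, ?_⟩ <;> grind

variable [Finite V]

/-- A vertex unlinked to all of a directed triangle with matched complement misses at most four arcs
to it. -/
theorem IsFactorCritical.replace_triangle (hD : D.IsFactorCritical) {x y z : V}
    (hxy : D.Unlinked x y) (hyz : D.Unlinked y z) (hxz : D.Unlinked x z)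
    (hC : D.IsCoMatched {x, y, z}) {a : V} (hxa : D.Unlinked x a) (hya : D.Unlinked y a)
    (hza : D.Unlinked z a) :
    D.defect x a + D.defect y a + D.defect z a ≤ 4 := by
  obtain ⟨u, hu, h⟩ := hD.replace hC (a := a)
  have e1 := D.defect_le_two x a
  have e2 := D.defect_le_two y a
  have e3 := D.defect_le_two z a
  simp only [Set.mem_insert_iff, Set.mem_singleton_iff] at hu
  rcases hu with rfl | rfl | rfl
  · have := (hD.cyclic y z a hyz hza hya (h.congr fun w => by
      have := hxy.1; have := hxz.1
      simp only [Set.mem_insert_iff, Set.mem_sdiff, Set.mem_singleton_iff]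
      constructor
      · tauto
      · rintro (rfl | rfl | rfl) <;> simp [hxy.1.symm, hxz.1.symm])).defect_eq hyz hza hya
    omega
  · have := (hD.cyclic x z a hxz hza hxa (h.congr fun w => by
      simp only [Set.mem_insert_iff, Set.mem_sdiff, Set.mem_singleton_iff]
      constructor
      · tauto
      · rintro (rfl | rfl | rfl) <;> simp [hxy.1, hyz.1.symm])).defect_eq hxz hza hxa
    omega
  · have := (hD.cyclic x y a hxy hya hxa (h.congr fun w => by
      simp only [Set.mem_insert_iff, Set.mem_sdiff, Set.mem_singleton_iff]
      constructor
      · tauto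
      · rintro (rfl | rfl | rfl) <;> simp [hyz.1, hxz.1])).defect_eq hxy hya hxa
    omega

/-- Between a directed triangle with matched complement and a pair of that matching at most four arcs
are missing. -/
theorem IsFactorCritical.triangle_pair (hD : D.IsFactorCritical) {x y z : V}
    (hxy : D.Unlinked x y) (hyz : D.Unlinked y z) (hxz : D.Unlinked x z) {f : Equiv.Perm V}
    (hf : IsPairing D.Unlinked f) (hfC : ∀ w, f w = w ↔ w = x ∨ w = y ∨ w = z) {a : V}
    (ha : f a ≠ a) :
    D.defect x a + D.defect y a + D.defect z a + D.defect x (f a) + D.defect y (f a) +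
      D.defect z (f a) ≤ 4 := by
  have hC : D.IsCoMatched {x, y, z} := ⟨f, hf, fun w => by rw [hfC]; rfl⟩
  have hcyc := hD.cyclic x y z hxy hyz hxz hC
  have hne := hfC a
  have hfb : f (f a) ≠ f a := fun h => ha (f.injective h)
  have haS : a ∉ ({x, y, z} : Set V) := fun h => ha ((hfC a).2 (by simpa using h))
  have hbS : f a ∉ ({x, y, z} : Set V) := fun h => hfb ((hfC _).2 (by simpa using h))
  have hS : ∀ w, f w = w ↔ w ∈ ({x, y, z} : Set V) := fun w => by rw [hfC]; rfl
  -- each of the six ways to exchange the pair with an edge of the triangle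
  have s1 : ∀ b, b ∉ ({x, y, z} : Set V) → D.Unlinked x b → D.Unlinked y b →
      D.Unlinked z (f b) → D.IsCyclicTriple x y b ∧ D.defect x b = 1 ∧ D.defect y b = 1 :=
    fun b hb h1 h2 h3 => by
      have := cyclicTriple_of_swap hD hf hS (x := x) (y := y) (z := z)
        (fun w => by simp) hxy hxz.1 hyz.1 hb h1 h2 h3
      exact ⟨this.1, this.2.2⟩
  have s2 : ∀ b, b ∉ ({x, y, z} : Set V) → D.Unlinked y b → D.Unlinked z b →
      D.Unlinked x (f b) → D.IsCyclicTriple y z b ∧ D.defect y b = 1 ∧ D.defect z b = 1 :=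
    fun b hb h1 h2 h3 => by
      have := cyclicTriple_of_swap hD hf hS (x := y) (y := z) (z := x)
        (fun w => by simp; tauto) hyz hxy.1.symm hxz.1.symm hb h1 h2 h3
      exact ⟨this.1, this.2.2⟩
  have s3 : ∀ b, b ∉ ({x, y, z} : Set V) → D.Unlinked x b → D.Unlinked z b →
      D.Unlinked y (f b) → D.IsCyclicTriple x z b ∧ D.defect x b = 1 ∧ D.defect z b = 1 :=
    fun b hb h1 h2 h3 => by
      have := cyclicTriple_of_swap hD hf hS (x := x) (y := z) (z := y)
        (fun w => by simp; tauto) hxz hxy.1 hyz.1.symm hb h1 h2 h3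
      exact ⟨this.1, this.2.2⟩
  -- no vertex outside a directed triangle forms directed triangles with two of its edges
  have q : ∀ b, b ∉ ({x, y, z} : Set V) → 0 < D.defect x b → 0 < D.defect y b → 0 < D.defect z b →
      (D.defect x (f b) = 0 ∧ D.defect y (f b) = 0) ∨
        (D.defect x (f b) = 0 ∧ D.defect z (f b) = 0) ∨
          (D.defect y (f b) = 0 ∧ D.defect z (f b) = 0) := by
    intro b hb h1 h2 h3
    rw [defect_pos] at h1 h2 h3
    obtain ⟨k1, k2, k3⟩ := not_two_cyclicTriples hcyc hxy hyz hxz h1 h2 h3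
    simp only [defect_eq_zero]
    have r1 := s1 b hb h1 h2
    have r2 := s2 b hb h2 h3
    have r3 := s3 b hb h1 h3
    tauto
  have p : ∀ v, (v = x ∨ v = y ∨ v = z) → D.defect v a + D.defect v (f a) ≤ 2 ∧
      (0 < D.defect v a → 0 < D.defect v (f a) → D.defect v a = 1 ∧ D.defect v (f a) = 1) := by
    have aux : ∀ v s t, D.Unlinked s t → (∀ w, f w = w ↔ w = v ∨ w = s ∨ w = t) → v ≠ s → v ≠ t →
        D.defect v a + D.defect v (f a) ≤ 2 ∧
        (0 < D.defect v a → 0 < D.defect v (f a) → D.defect v a = 1 ∧ D.defect v (f a) = 1) := by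
      intro v s t hst hfix hvs hvt
      obtain ⟨g, hg, g1, g2, g3⟩ := hf.join (unlinked_symm D) ((hfix s).2 (by simp))
        ((hfix t).2 (by simp)) hst
      have has : a ≠ s := fun h => ha ((hfix a).2 (by simp [h]))
      have hat : a ≠ t := fun h => ha ((hfix a).2 (by simp [h]))
      have hav : a ≠ v := fun h => ha ((hfix a).2 (by simp [h]))
      have hgv : ∀ w, g w = w ↔ w = v := by
        intro w
        by_cases hws : w = s
        · subst hws; rw [g1]; exact ⟨fun h => absurd h.symm hst.1, fun h => absurd h.symm hvs⟩
        by_cases hwt : w = t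
        · subst hwt; rw [g2]; exact ⟨fun h => absurd h hst.1, fun h => absurd h.symm hvt⟩
        rw [g3 w hws hwt, hfix]; simp [hws, hwt]
      have := hD.pair hg hgv hav
      rw [g3 a has hat] at this
      exact ⟨this.1, fun h1 h2 =>
        (this.2 (defect_pos.1 h1) (defect_pos.1 h2)).2.imp_right And.left⟩
    rintro v (rfl | rfl | rfl)
    · exact aux v y z hyz hfC hxy.1 hxz.1
    · exact aux v x z hxz (fun w => by rw [hfC]; tauto) hxy.1.symm hyz.1
    · exact aux v x y hxy (fun w => by rw [hfC]; tauto) hxz.1.symm hyz.1.symm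
  have px := p x (by simp)
  have py := p y (by simp)
  have pz := p z (by simp)
  have qa := q a haS
  have qb := q (f a) hbS
  have ra : 0 < D.defect x a → 0 < D.defect y a → 0 < D.defect z a →
      D.defect x a + D.defect y a + D.defect z a ≤ 4 := fun h1 h2 h3 =>
    hD.replace_triangle hxy hyz hxz hC (defect_pos.1 h1) (defect_pos.1 h2) (defect_pos.1 h3)
  have rb : 0 < D.defect x (f a) → 0 < D.defect y (f a) → 0 < D.defect z (f a) →
      D.defect x (f a) + D.defect y (f a) + D.defect z (f a) ≤ 4 := fun h1 h2 h3 =>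
    hD.replace_triangle hxy hyz hxz hC (defect_pos.1 h1) (defect_pos.1 h2) (defect_pos.1 h3)
  have a1 := s1 a haS
  have a2 := s2 a haS
  have a3 := s3 a haS
  have b1 := s1 (f a) hbS
  have b2 := s2 (f a) hbS
  have b3 := s3 (f a) hbS
  rw [hf.inv] at qb b1 b2 b3
  simp only [← defect_pos] at a1 a2 a3 b1 b2 b3
  replace a1 := fun h1 h2 h3 => (a1 h1 h2 h3).2
  replace a2 := fun h1 h2 h3 => (a2 h1 h2 h3).2
  replace a3 := fun h1 h2 h3 => (a3 h1 h2 h3).2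
  replace b1 := fun h1 h2 h3 => (b1 h1 h2 h3).2
  replace b2 := fun h1 h2 h3 => (b2 h1 h2 h3).2
  replace b3 := fun h1 h2 h3 => (b3 h1 h2 h3).2
  clear s1 s2 s3 q p hne hcyc hC hxy hyz hxz
  generalize D.defect x a = xa at *
  generalize D.defect y a = ya at *
  generalize D.defect z a = za at *
  generalize D.defect x (f a) = xb at *
  generalize D.defect y (f a) = yb at *
  generalize D.defect z (f a) = zb at *
  rcases Nat.eq_zero_or_pos xa with h1 | h1 <;> rcases Nat.eq_zero_or_pos ya with h2 | h2 <;>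
  rcases Nat.eq_zero_or_pos za with h3 | h3 <;> rcases Nat.eq_zero_or_pos xb with h4 | h4 <;>
  rcases Nat.eq_zero_or_pos yb with h5 | h5 <;> rcases Nat.eq_zero_or_pos zb with h6 | h6 <;>
  simp only [h1, h2, h3, h4, h5, h6, forall_const, lt_irrefl, false_implies, implies_true] at * <;> omega

end LocalBounds

/-! ### Missing arcs between two matched pairs -/

section PairPair

variable {V : Type u} {D : Digraph V}

theorem IsPairing.cut_two {f : Equiv.Perm V} (hf : IsPairing D.Unlinked f) {v : V}
    (hfv : ∀ x, f x = x ↔ x = v) {a c : V} (hca : c ≠ a) (hcfa : c ≠ f a) :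
    ∃ g, IsPairing D.Unlinked g ∧
      (∀ x, g x = x ↔ x ∈ ({v, a, f a, c, f c} : Set V)) ∧
        ∀ x, x ≠ a → x ≠ f a → x ≠ c → x ≠ f c → g x = f x := by
  obtain ⟨g, hg, g1, g2, g3⟩ := hf.cut a
  obtain ⟨h, hh, h1, h2, h3⟩ := hg.cut c
  rw [g3 c hca hcfa] at h2 h3
  refine ⟨h, hh, fun x => ?_, fun x xa xb xc xd => (h3 x xc xd).trans (g3 x xa xb)⟩
  simp only [Set.mem_insert_iff, Set.mem_singleton_iff]
  by_cases hxc : x = c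
  · subst hxc; simp [h1]
  by_cases hxd : x = f c
  · subst hxd; simp [h2]
  rw [h3 x hxc hxd]
  by_cases hxa : x = a
  · subst hxa; simp [g1]
  by_cases hxb : x = f a
  · subst hxb; simp [g2]
  rw [g3 x hxa hxb, hfv]; simp [*]

variable [Finite V]

/-- The bound for two pairs `a, f a` and `c, f c` in the case that `f a` and `f c` are linked to `v`. -/
theorem IsFactorCritical.pair_pair_aux (hD : D.IsFactorCritical) {v : V}
    (hlow : ∀ f, IsPairing D.Unlinked f → (∀ x, f x = x ↔ x = v) → ∀ x, x ≠ v →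
      D.defect v x + D.defect v (f x) = 2) {f : Equiv.Perm V}
    (hf : IsPairing D.Unlinked f) (hfv : ∀ x, f x = x ↔ x = v) {a c : V} (hav : a ≠ v)
    (hcv : c ≠ v) (hca : c ≠ a) (hcfa : c ≠ f a) (hva : D.defect v a = 2)
    (hvc : D.defect v c = 2) :
    D.defect a c + D.defect a (f c) + D.defect (f a) c + D.defect (f a) (f c) ≤ 4 := by
  have hfc : f c ≠ c := fun h => hcv ((hfv c).1 h)
  have hfa : f a ≠ a := fun h => hav ((hfv a).1 h)
  have hvfc : f c ≠ v := fun h => hcv (by rw [← hf.inv c, h, (hfv v).2 rfl])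
  have hvfa : f a ≠ v := fun h => hav (by rw [← hf.inv a, h, (hfv v).2 rfl])
  have hfca : f c ≠ a := fun h => hcfa (by rw [← h, hf.inv])
  have hfcfa : f c ≠ f a := fun h => hca (f.injective h)
  have Pab := hf.adj a hfa
  have Pcd := hf.adj c hfc
  have Pva : D.Unlinked v a := defect_pos.1 (by omega)
  have Pvc : D.Unlinked v c := defect_pos.1 (by omega)
  obtain ⟨g, hg, hgS, -⟩ := hf.cut_two hfv hca hcfa
  have hcm : D.IsCoMatched {v, a, f a, c, f c} := ⟨g, hg, hgS⟩
  -- exchanging the two pairs for `a, c` and `f a, f c`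
  have h1 : ¬ (D.Unlinked a c ∧ D.Unlinked (f a) (f c)) := by
    rintro ⟨h, h'⟩
    obtain ⟨g', hg', k1, k2, k3⟩ := hg.join (unlinked_symm D) ((hgS a).2 (by simp))
      ((hgS c).2 (by simp)) h
    obtain ⟨g'', hg'', l1, l2, l3⟩ := hg'.join (unlinked_symm D)
      ((k3 (f a) hfa hcfa.symm).trans ((hgS _).2 (by simp)))
      ((k3 (f c) hfca hfc).trans ((hgS _).2 (by simp))) h'
    have e : g'' a = c := (l3 a hfa.symm hfca.symm).trans k1
    have := hlow g'' hg'' (fun x => by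
      by_cases x1 : x = f a
      · subst x1; rw [l1]; simp [hfcfa, hvfa]
      by_cases x2 : x = f c
      · subst x2; rw [l2]; simp [hfcfa.symm, hvfc]
      rw [l3 x x1 x2]
      by_cases x3 : x = a
      · subst x3; rw [k1]; simp [hca, hav]
      by_cases x4 : x = c
      · subst x4; rw [k2]; simp [hca.symm, hcv]
      rw [k3 x x3 x4, hgS]; simp [x1, x2, x3, x4]) a hav
    rw [e] at this
    omega
  have h2 : D.Unlinked a (f c) → D.Unlinked (f a) (f c) →
      D.defect a (f c) = 1 ∧ D.defect (f a) (f c) = 1 := by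
    intro h h'
    have hc : D.IsCoMatched {a, f a, f c} := hcm.join Pvc (by simp) (by simp) fun x => by
      simp only [Set.mem_insert_iff, Set.mem_singleton_iff]
      constructor
      · rintro (rfl | rfl | rfl) <;> simp [hav, hca.symm, hvfa, hcfa.symm, hvfc, hfc]
      · tauto
    have := (hD.cyclic _ _ _ Pab h' h hc).defect_eq Pab h' h
    omega
  have h3 : D.Unlinked (f a) c → D.Unlinked (f a) (f c) →
      D.defect (f a) c = 1 ∧ D.defect (f a) (f c) = 1 := by
    intro h h'
    have hc : D.IsCoMatched {f a, c, f c} := hcm.join Pva (by simp) (by simp) fun x => by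
      simp only [Set.mem_insert_iff, Set.mem_singleton_iff]
      constructor
      · rintro (rfl | rfl | rfl) <;> simp [hcv, hca, hvfa, hfa, hvfc, hfca]
      · tauto
    have := (hD.cyclic _ _ _ h Pcd h' hc).defect_eq h Pcd h'
    omega
  have h4 : D.Unlinked a c → D.Unlinked a (f c) → D.Unlinked (f a) c →
      (D.defect a c = 1 ∧ D.defect a (f c) = 1) ∨ (D.defect a c = 1 ∧ D.defect (f a) c = 1) := by
    intro h h' h''
    rcases hD.two_pairs hf hfv hav hcv hca hcfa with hc | hc | hc
    · have := (hD.cyclic _ _ _ h Pcd h' hc).defect_eq h Pcd h'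
      omega
    · have := (hD.cyclic _ _ _ Pva h Pvc hc).defect_eq Pva h Pvc
      omega
    · have := (hD.cyclic _ _ _ Pab h'' h hc).defect_eq Pab h'' h
      omega
  have e1 := D.defect_le_two a c
  have e2 := D.defect_le_two a (f c)
  have e3 := D.defect_le_two (f a) c
  have e4 := D.defect_le_two (f a) (f c)
  simp only [← defect_pos] at h1 h2 h3 h4
  omega

/-- Between two pairs of a matching that misses only the vertex `v` there are at most four missing
arcs, provided that every matching has exactly two missing arcs between `v` and each of its pairs. -/
theorem IsFactorCritical.pair_pair (hD : D.IsFactorCritical) {v : V}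
    (hlow : ∀ f, IsPairing D.Unlinked f → (∀ x, f x = x ↔ x = v) → ∀ x, x ≠ v →
      D.defect v x + D.defect v (f x) = 2) {f : Equiv.Perm V}
    (hf : IsPairing D.Unlinked f) (hfv : ∀ x, f x = x ↔ x = v) {x y : V} (hx : x ≠ v)
    (hy : y ≠ v) :
    D.defect x y + D.defect x (f y) + D.defect (f x) y + D.defect (f x) (f y) ≤ 4 := by
  have hne : ∀ {z}, z ≠ v → f z ≠ z := fun h h' => h ((hfv _).1 h')
  have hnv : ∀ {z}, z ≠ v → f z ≠ v := fun {z} h h' => h (by rw [← hf.inv z, h', (hfv v).2 rfl])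
  by_cases hyx : y = x
  · subst hyx
    have := D.defect_le_two y (f y)
    rw [defect_self, defect_self, D.defect_comm (f y) y]; omega
  by_cases hyfx : y = f x
  · subst hyfx
    have := D.defect_le_two x (f x)
    rw [hf.inv, defect_self, defect_self, D.defect_comm (f x) x]; omega
  -- a pair both of whose vertices are unlinked to `v`
  have tri : ∀ {x y}, x ≠ v → y ≠ v → y ≠ x → y ≠ f x → D.Unlinked v x → D.Unlinked v (f x) →
      D.defect x y + D.defect x (f y) + D.defect (f x) y + D.defect (f x) (f y) ≤ 4 := by
    intro x y hx hy h1 h2 h3 h4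
    obtain ⟨g, hg, g1, g2, g3⟩ := hf.cut x
    have gy := g3 y h1 h2
    have := hD.triangle_pair h3 (hf.adj x (hne hx)) h4 hg (fun w => by
      by_cases x1 : w = x
      · subst x1; simp [g1]
      by_cases x2 : w = f x
      · subst x2; simp [g2]
      rw [g3 w x1 x2, hfv]; simp [x1, x2]) (a := y) (by rw [gy]; exact hne hy)
    rw [gy] at this
    omega
  have hyx' : x ≠ f y := fun h => hyfx (by rw [h, hf.inv])
  by_cases tx : D.Unlinked v x ∧ D.Unlinked v (f x)
  · exact tri hx hy hyx hyfx tx.1 tx.2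
  by_cases ty : D.Unlinked v y ∧ D.Unlinked v (f y)
  · have := tri hy hx (Ne.symm hyx) hyx' ty.1 ty.2
    rw [D.defect_comm y x, D.defect_comm y, D.defect_comm (f y) x, D.defect_comm (f y)] at this
    omega
  have lx := hlow f hf hfv x hx
  have ly := hlow f hf hfv y hy
  rw [← defect_pos, ← defect_pos] at tx ty
  have hfyx : f y ≠ x := hyx'.symm
  have hfyfx : f y ≠ f x := fun h => hyx (f.injective h)
  rcases Nat.eq_zero_or_pos (D.defect v x) with h1 | h1 <;>
  rcases Nat.eq_zero_or_pos (D.defect v y) with h2 | h2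
  · have := hD.pair_pair_aux hlow hf hfv (hnv hx) (hnv hy) hfyfx (by rw [hf.inv]; exact hfyx)
      (by omega) (by omega)
    simp only [hf.inv] at this
    omega
  · have := hD.pair_pair_aux hlow hf hfv (hnv hx) hy hyfx (by rw [hf.inv]; exact hyx)
      (by omega) (by omega)
    simp only [hf.inv] at this
    omega
  · have := hD.pair_pair_aux hlow hf hfv hx (hnv hy) hfyx hfyfx
      (by omega) (by omega)
    simp only [hf.inv] at this
    omega
  · exact hD.pair_pair_aux hlow hf hfv hx hy hyx hyfx (by omega) (by omega)

end PairPair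

/-! ### Five-cycles of unlinked pairs -/

section FiveCycle

variable {V : Type u} {D : Digraph V}

/-- The vertices `c 0, …, c 4` form a cycle of unlinked pairs, and `f` matches exactly the vertices off
this cycle. -/
structure IsFiveCycle (D : Digraph V) (f : Equiv.Perm V) (c : Fin 5 → V) : Prop where
  pairing : IsPairing D.Unlinked f
  inj : Function.Injective c
  adj : ∀ i, D.Unlinked (c i) (c (i + 1))
  fix : ∀ w, f w = w ↔ w ∈ Set.range c

variable {f : Equiv.Perm V} {c : Fin 5 → V}

theorem IsFiveCycle.shift (h : D.IsFiveCycle f c) (i : Fin 5) :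
    D.IsFiveCycle f (fun t => c (i + t)) where
  pairing := h.pairing
  inj := fun _ _ e => add_left_cancel (h.inj e)
  adj t := by rw [← add_assoc]; exact h.adj (i + t)
  fix w := by
    rw [h.fix]
    constructor
    · rintro ⟨j, rfl⟩; exact ⟨j - i, by simp⟩
    · rintro ⟨j, rfl⟩; exact ⟨_, rfl⟩

theorem IsFiveCycle.reflect (h : D.IsFiveCycle f c) : D.IsFiveCycle f (fun t => c (-t)) where
  pairing := h.pairing
  inj := fun _ _ e => neg_injective (h.inj e)
  adj t := by
    have := (h.adj (-(t + 1))).symm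
    rwa [show -(t + 1) + 1 = -t by abel] at this
  fix w := by
    rw [h.fix]
    constructor
    · rintro ⟨j, rfl⟩; exact ⟨-j, by simp⟩
    · rintro ⟨j, rfl⟩; exact ⟨_, rfl⟩

theorem mem_range_five {w : V} :
    w ∈ Set.range c ↔ w = c 0 ∨ w = c 1 ∨ w = c 2 ∨ w = c 3 ∨ w = c 4 := by
  constructor
  · rintro ⟨i, rfl⟩; fin_cases i <;> simp
  · rintro (h | h | h | h | h) <;> exact ⟨_, h.symm⟩

theorem IsFiveCycle.ne (h : D.IsFiveCycle f c) {a : V} (ha : f a ≠ a) (i : Fin 5) : c i ≠ a :=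
  fun e => ha ((h.fix a).2 ⟨i, e⟩)

theorem IsFiveCycle.isCoMatched (h : D.IsFiveCycle f c) : D.IsCoMatched (Set.range c) :=
  ⟨f, h.pairing, h.fix⟩

/-- The vertex `a` off the cycle can take the place of the cycle vertex `c i`: the rest has a perfectly
matched complement. -/
def Replaces (D : Digraph V) (c : Fin 5 → V) (a : V) (i : Fin 5) : Prop :=
  D.IsCoMatched (insert a (Set.range c \ {c i}))

theorem IsFiveCycle.replaces_of_unlinked (h : D.IsFiveCycle f c) {a : V} (ha : f a ≠ a) {i : Fin 5}
    (hi : D.Unlinked (c i) (f a)) : D.Replaces c a i := by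
  have h1 : D.IsCoMatched {w | w ∈ Set.range c ∨ w = a ∨ w = f a} :=
    IsCoMatched.cut h.pairing h.fix a (fun _ => Iff.rfl)
  refine h1.join hi (Or.inl ⟨i, rfl⟩) (by simp) fun w => ?_
  have hfa : ∀ j, c j ≠ f a := h.ne (fun e => ha (f.injective e))
  simp only [Set.mem_insert_iff, Set.mem_sdiff, Set.mem_singleton_iff, Set.mem_ofPred_eq]
  constructor
  · rintro (rfl | ⟨⟨j, rfl⟩, e⟩)
    · exact ⟨by simp, (h.ne ha i).symm, ha.symm⟩
    · exact ⟨by simp, e, hfa j⟩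
  · tauto

theorem IsFiveCycle.isCoMatched_of_replaces_zero (h : D.IsFiveCycle f c)
    {a : V} (ha : f a ≠ a) (h0 : D.Replaces c a 0) : D.IsCoMatched {c 1, c 2, a} := by
  have n : ∀ {i j : Fin 5}, i ≠ j → c i ≠ c j := fun e => h.inj.ne e
  refine IsCoMatched.join h0 (h.adj 3) (by simp [n]) (by simp [n]) fun w => ?_
  simp only [Set.mem_insert_iff, Set.mem_sdiff, Set.mem_singleton_iff, mem_range_five]
  constructor
  · rintro (rfl | rfl | rfl)
    · simp [n]
    · simp [n]
    · simp [(h.ne ha _).symm]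
  · simp only [Fin.isValue, Fin.reduceAdd]
    tauto

/-- If `a` replaces a neighbour of the edge `c i, c (i + 1)`, then the two remaining vertices of the cycle can
be matched with each other. -/
theorem IsFiveCycle.isCoMatched_of_replaces (h : D.IsFiveCycle f c)
    {a : V} (ha : f a ≠ a) {i : Fin 5} (hr : D.Replaces c a (i - 1) ∨ D.Replaces c a (i + 2)) :
    D.IsCoMatched {c i, c (i + 1), a} := by
  have aux : ∀ {c : Fin 5 → V} (_ : D.IsFiveCycle f c) {i : Fin 5},
      D.Replaces c a (i - 1) → D.IsCoMatched {c i, c (i + 1), a} := by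
    intro c h i hr
    have := (h.shift (i - 1)).isCoMatched_of_replaces_zero ha
    simp only [show i - 1 + 1 = i by abel, show i - 1 + 2 = i + 1 by abel] at this
    refine this (hr.congr fun w => ?_)
    simp only [Set.mem_insert_iff, Set.mem_sdiff, Set.mem_singleton_iff, ← h.fix,
      ← (h.shift (i - 1)).fix, add_zero]
  rcases hr with hr | hr
  · exact aux h hr
  · have e1 : -(-(i + 1) + 1) = i := by abel
    have e2 : -(-(i + 1) - 1) = i + 2 :=
      (show ∀ i : Fin 5, -(-(i + 1) - 1) = i + 2 by decide) i
    have := aux h.reflect (i := -(i + 1)) (hr.congr fun w => by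
        simp only [Set.mem_insert_iff, Set.mem_sdiff, Set.mem_singleton_iff, ← h.fix,
          ← h.reflect.fix, e2])
    simp only [neg_neg, e1] at this
    exact this.congr fun w => by simp only [Set.mem_insert_iff, Set.mem_singleton_iff]; tauto

/-- A cycle of odd length cannot alternate. -/
theorem IsFiveCycle.exists_not_isCyclicTriple {a : V} (h : ∀ i, D.Unlinked (c i) a) :
    ∃ i, ¬ D.IsCyclicTriple (c i) (c (i + 1)) a := by
  by_contra! hc
  have key : ∀ i, (D.Adj a (c i) ↔ ¬ D.Adj a (c (i + 1))) := by
    intro i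
    have h1 := (h i).2
    have h2 := (h (i + 1)).2
    rcases hc i with hh | hh <;> tauto
  have h0 := key 0
  have h1 := key 1
  have h2 := key 2
  have h3 := key 3
  have h4 := key 4
  simp only [Fin.isValue, Fin.reduceAdd, zero_add] at h0 h1 h2 h3 h4
  tauto

/-- The other four vertices of the cycle can be matched along the cycle, so that only `c i` is left out. -/
theorem IsFiveCycle.exists_isPairing (h : D.IsFiveCycle f c) (i : Fin 5) :
    ∃ k, IsPairing D.Unlinked k ∧ (∀ w, k w = w ↔ w = c i) ∧ k (c (i + 1)) = c (i + 2) ∧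
      k (c (i + 3)) = c (i + 4) ∧ ∀ w, f w ≠ w → k w = f w := by
  have aux : ∀ {c : Fin 5 → V}, D.IsFiveCycle f c → ∃ k, IsPairing D.Unlinked k ∧
      (∀ w, k w = w ↔ w = c 0) ∧ k (c 1) = c 2 ∧ k (c 3) = c 4 ∧ ∀ w, f w ≠ w → k w = f w := by
    intro c h
    have n : ∀ {i j : Fin 5}, i ≠ j → c i ≠ c j := fun e => h.inj.ne e
    have hfix : ∀ i, f (c i) = c i := fun i => (h.fix _).2 ⟨i, rfl⟩
    obtain ⟨g, hg, g1, g2, g3⟩ := h.pairing.join (unlinked_symm D) (hfix 1) (hfix 2) (h.adj 1)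
    obtain ⟨k, hk, k1, k2, k3⟩ := hg.join (unlinked_symm D) (a := c 3) (b := c 4)
      ((g3 _ (n (by decide)) (n (by decide))).trans (hfix 3))
      ((g3 _ (n (by decide)) (n (by decide))).trans (hfix 4)) (h.adj 3)
    refine ⟨k, hk, fun w => ?_, (k3 _ (n (by decide)) (n (by decide))).trans g1, k1,
      fun w hw => ?_⟩
    · by_cases w3 : w = c 3
      · subst w3; rw [k1]; simp [n]
      by_cases w4 : w = c 4
      · subst w4; rw [k2]; simp [n]
      rw [k3 w w3 w4]
      by_cases w1 : w = c 1
      · subst w1; rw [g1]; simp [n]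
      by_cases w2 : w = c 2
      · subst w2; rw [g2]; simp [n]
      rw [g3 w w1 w2, h.fix, mem_range_five]; simp [*]
    · rw [k3 w (h.ne hw 3).symm (h.ne hw 4).symm, g3 w (h.ne hw 1).symm (h.ne hw 2).symm]
  simpa using aux (h.shift i)

/-- A vertex of the cycle misses at most two arcs to each matched pair. -/
theorem IsFiveCycle.pair (hD : D.IsFactorCritical) (h : D.IsFiveCycle f c)
    {a : V} (ha : f a ≠ a) (i : Fin 5) :
    D.defect (c i) a + D.defect (c i) (f a) ≤ 2 ∧
      (D.Unlinked (c i) a → D.Unlinked (c i) (f a) → D.IsCoMatched {c i, a, f a} ∧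
        D.defect (c i) a = 1 ∧ D.defect (c i) (f a) = 1) := by
  obtain ⟨k, hk, hkfix, -, -, hkf⟩ := h.exists_isPairing i
  have hka := hkf a ha
  have := hD.pair hk hkfix (x := a) (h.ne ha i).symm
  rw [hka] at this
  refine ⟨this.1, fun h1 h2 => ⟨?_, (this.2 h1 h2).2.1, (this.2 h1 h2).2.2.1⟩⟩
  refine IsCoMatched.cut (S := {c i}) hk (fun w => by rw [hkfix]; rfl) a fun w => ?_
  simp only [Set.mem_insert_iff, Set.mem_singleton_iff, hka]

theorem IsFiveCycle.defect_add_le (hD : D.IsFactorCritical) (h : D.IsFiveCycle f c) (i : Fin 5) :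
    D.defect (c i) (c (i + 1)) + D.defect (c i) (c (i + 2)) ≤ 2 ∧
      D.defect (c i) (c (i + 3)) + D.defect (c i) (c (i + 4)) ≤ 2 := by
  obtain ⟨k, hk, hkfix, k1, k2, -⟩ := h.exists_isPairing i
  have n : ∀ j, j ≠ 0 → c (i + j) ≠ c i := fun j hj => h.inj.ne (by simpa using hj)
  constructor
  · rw [← k1]; exact (hD.pair hk hkfix (n 1 (by decide))).1
  · rw [← k2]; exact (hD.pair hk hkfix (n 3 (by decide))).1

/-- At most ten arcs are missing inside the cycle; the sum counts each of them twice. -/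
theorem IsFiveCycle.sum_defect_self_le (hD : D.IsFactorCritical) (h : D.IsFiveCycle f c) :
    ∑ i, ∑ j, D.defect (c i) (c j) ≤ 20 ∧ (∑ i, ∑ j, D.defect (c i) (c j) = 20 → ∀ i,
      D.defect (c i) (c (i + 1)) + D.defect (c i) (c (i + 2)) = 2 ∧
      D.defect (c i) (c (i + 3)) + D.defect (c i) (c (i + 4)) = 2) := by
  have e : ∀ i, ∑ j, D.defect (c i) (c j) =
      D.defect (c i) (c (i + 1)) + D.defect (c i) (c (i + 2)) +
      (D.defect (c i) (c (i + 3)) + D.defect (c i) (c (i + 4))) := fun i => by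
    rw [← Equiv.sum_comp (Equiv.addLeft i), Fin.sum_univ_five]
    simp only [Equiv.coe_addLeft, add_zero, defect_self]
    omega
  have hle : ∀ i ∈ Finset.univ, ∑ j, D.defect (c i) (c j) ≤ 4 := fun i _ => by
    have := h.defect_add_le hD i
    rw [e]; omega
  have h20 : ∑ _i : Fin 5, 4 = 20 := by simp
  refine ⟨h20 ▸ Finset.sum_le_sum hle, fun heq i => ?_⟩
  have := (Finset.sum_eq_sum_iff_of_le hle).1 (heq.trans h20.symm) i (Finset.mem_univ i)
  rw [e] at this
  have := h.defect_add_le hD i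
  omega

end FiveCycle

section FiveCycleTable

/-- Two cyclically consecutive elements of `a` next to an element of `b`. -/
def fiveTrigger (a b : Fin 5 → Bool) (i : Fin 5) : Bool :=
  a i && a (i + 1) && (b (i - 1) || b (i + 2))

/-- The upper bound for the number of missing arcs between the cycle vertex with index `i` and a matched
pair, where `a` and `b` are the sets of cycle vertices unlinked to the two vertices of the pair. -/
def fiveBound (a b : Fin 5 → Bool) (i : Fin 5) : ℕ :=
  bif a i && b i then 2 else
  bif a i then (bif fiveTrigger a b i || fiveTrigger a b (i - 1) then 1 else 2) else
  bif b i then (bif fiveTrigger b a i || fiveTrigger b a (i - 1) then 1 else 2) else 0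

set_option maxRecDepth 100000 in
theorem fiveBound_table : ∀ a0 a1 a2 a3 a4 b0 b1 b2 b3 b4 : Bool,
    let a : Fin 5 → Bool := ![a0, a1, a2, a3, a4]
    let b : Fin 5 → Bool := ![b0, b1, b2, b3, b4]
    (fiveBound a b 0 + fiveBound a b 1 + fiveBound a b 2 + fiveBound a b 3 + fiveBound a b 4 ≤ 8) ∨
      (∀ i, fiveTrigger a b i) ∨ (∀ i, fiveTrigger b a i) ∨ (∀ i, a i && !b i) ∨
        (∀ i, b i && !a i) := by
  decide

/-- The bounds `fiveBound` add up to at most `8` apart from the cases in which one vertex of the pair is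
unlinked to the whole cycle and either the other vertex is linked to all of it or all triangles are
triggered. -/
theorem fiveBound_le (a b : Fin 5 → Bool) : ∑ i, fiveBound a b i ≤ 8 ∨
    (∀ i, fiveTrigger a b i) ∨ (∀ i, fiveTrigger b a i) ∨ (∀ i, a i && !b i) ∨
      (∀ i, b i && !a i) := by
  have h := fiveBound_table (a 0) (a 1) (a 2) (a 3) (a 4) (b 0) (b 1) (b 2) (b 3) (b 4)
  have e : ∀ x : Fin 5 → Bool, ![x 0, x 1, x 2, x 3, x 4] = x := fun x => by
    ext i; fin_cases i <;> rfl
  simp only [e] at h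
  rwa [Fin.sum_univ_five]

set_option maxRecDepth 100000 in
theorem five_alternating_table : ∀ a0 a1 a2 a3 a4 b0 b1 b2 b3 b4 : Bool,
    let a : Fin 5 → Bool := ![a0, a1, a2, a3, a4]
    let b : Fin 5 → Bool := ![b0, b1, b2, b3, b4]
    (∀ i, !fiveTrigger a b i && !fiveTrigger b a i && !(a i && b i)) →
    (∃ i, !(a (i + 1) && a (i + 2)) && !(a (i + 3) && a (i + 4))) →
    (∃ i, !(b (i + 1) && b (i + 2)) && !(b (i + 3) && b (i + 4))) →
    (∃ i, ∀ t, t ≠ i → a t || b t) →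
    ∃ j j', (j' = j + 1 ∨ j = j' + 1) ∧ ∀ t, (a t ↔ t = j - 1 ∨ t = j + 1) ∧
      (b t ↔ t = j' - 1 ∨ t = j' + 1) := by
  decide

/-- Two disjoint sets that cover the cycle up to one element, trigger no triangle, and each avoid, for some `i`,
the edges `{i + 1, i + 2}` and `{i + 3, i + 4}`, are the neighbourhoods of two consecutive elements. -/
theorem five_alternating {a b : Fin 5 → Bool}
    (h1 : ∀ i, !fiveTrigger a b i && !fiveTrigger b a i && !(a i && b i))
    (h2 : ∃ i, !(a (i + 1) && a (i + 2)) && !(a (i + 3) && a (i + 4)))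
    (h3 : ∃ i, !(b (i + 1) && b (i + 2)) && !(b (i + 3) && b (i + 4)))
    (h4 : ∃ i, ∀ t, t ≠ i → a t || b t) :
    ∃ j j', (j' = j + 1 ∨ j = j' + 1) ∧ ∀ t, (a t ↔ t = j - 1 ∨ t = j + 1) ∧
      (b t ↔ t = j' - 1 ∨ t = j' + 1) := by
  have h := five_alternating_table (a 0) (a 1) (a 2) (a 3) (a 4) (b 0) (b 1) (b 2) (b 3) (b 4)
  have e : ∀ x : Fin 5 → Bool, ![x 0, x 1, x 2, x 3, x 4] = x := fun x => by
    ext i; fin_cases i <;> rfl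
  simp only [e] at h
  exact h h1 h2 h3 h4

end FiveCycleTable

section FiveCyclePair

variable {V : Type u} {D : Digraph V} {f : Equiv.Perm V} {c : Fin 5 → V}

/-- The combinatorial condition `fiveTrigger` yields a triangle of unlinked pairs with matched complement. -/
theorem IsFiveCycle.isCoMatched_of_fiveTrigger
    (h : D.IsFiveCycle f c) {a : V} (ha : f a ≠ a) {i : Fin 5}
    (ht : fiveTrigger (fun i => decide (D.Unlinked (c i) a))
      (fun i => decide (D.Unlinked (c i) (f a))) i) :
    D.Unlinked (c i) a ∧ D.Unlinked (c (i + 1)) a ∧ D.IsCoMatched {c i, c (i + 1), a} := by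
  simp only [fiveTrigger, Bool.and_eq_true, Bool.or_eq_true, decide_eq_true_eq] at ht
  exact ⟨ht.1.1, ht.1.2, h.isCoMatched_of_replaces ha
    (ht.2.imp (h.replaces_of_unlinked ha) (h.replaces_of_unlinked ha))⟩

theorem IsFiveCycle.defect_eq_of_isCyclicTriple (h : D.IsFiveCycle f c) {a : V} {i : Fin 5}
    (hi : D.Unlinked (c i) a) (hi' : D.Unlinked (c (i + 1)) a)
    (hc : D.IsCyclicTriple (c i) (c (i + 1)) a) :
    D.defect (c i) a = 1 ∧ D.defect (c (i + 1)) a = 1 := by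
  have := hc.defect_eq (h.adj i) hi' hi
  exact ⟨this.2.2, this.2.1⟩

theorem IsFiveCycle.exists_replaces [Finite V] (hD : D.IsFactorCritical)
    (h : D.IsFiveCycle f c) (a : V) : ∃ i, D.Replaces c a i := by
  obtain ⟨_, ⟨i, rfl⟩, hi⟩ := hD.replace h.isCoMatched (a := a)
  exact ⟨i, hi⟩

/-- Between a five-cycle of unlinked pairs with matched complement and a pair of that matching at most
eight arcs are missing. -/
theorem IsFiveCycle.sum_defect_le [Finite V] (hD : D.IsFactorCritical) (h : D.IsFiveCycle f c)
    {a : V} (ha : f a ≠ a) : ∑ i, (D.defect (c i) a + D.defect (c i) (f a)) ≤ 8 := by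
  have hb : f (f a) ≠ f a := fun e => ha (f.injective e)
  have hpair := h.pair hD ha
  -- a vertex `a` unlinked to the whole cycle, and a partner linked to the whole cycle
  have full : ∀ {a : V}, f a ≠ a → (∀ i, D.Unlinked (c i) a ∧ ¬ D.Unlinked (c i) (f a)) →
      ∑ i, (D.defect (c i) a + D.defect (c i) (f a)) ≤ 8 := by
    intro a ha hf
    obtain ⟨i, hi⟩ := h.exists_replaces hD a
    have d : ∀ j, j - 1 = i ∨ j + 2 = i → D.defect (c j) a = 1 ∧ D.defect (c (j + 1)) a = 1 := by
      intro j hj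
      refine h.defect_eq_of_isCyclicTriple (hf j).1 (hf _).1
        (hD.cyclic _ _ _ (h.adj j) (hf _).1 (hf j).1 (h.isCoMatched_of_replaces ha ?_))
      rcases hj with hj | hj <;> simp [hj, hi]
    have z : ∀ j, D.defect (c j) (f a) = 0 := fun j => defect_eq_zero.2 (hf j).2
    have d1 := d (i + 1) (by simp)
    have d2 := d (i + 3) (Or.inr ((show ∀ i : Fin 5, i + 3 + 2 = i by decide) i))
    have e := D.defect_le_two (c i) a
    rw [← Equiv.sum_comp (Equiv.addLeft i), Fin.sum_univ_five]
    simp only [Equiv.coe_addLeft, z, add_zero]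
    rw [add_assoc i] at d1 d2
    simp only [Fin.isValue, Fin.reduceAdd] at d1 d2
    omega
  set A : Fin 5 → Bool := fun i => decide (D.Unlinked (c i) a) with hA
  set B : Fin 5 → Bool := fun i => decide (D.Unlinked (c i) (f a)) with hB
  have cyc : ∀ {a i}, D.Unlinked (c i) a ∧ D.Unlinked (c (i + 1)) a ∧
      D.IsCoMatched {c i, c (i + 1), a} → D.IsCyclicTriple (c i) (c (i + 1)) a ∧
        D.defect (c i) a = 1 ∧ D.defect (c (i + 1)) a = 1 := fun {a i} hh => by
    have := hD.cyclic _ _ _ (h.adj i) hh.2.1 hh.1 hh.2.2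
    exact ⟨this, h.defect_eq_of_isCyclicTriple hh.1 hh.2.1 this⟩
  have tA : ∀ {i}, fiveTrigger A B i → _ := fun hi => cyc (h.isCoMatched_of_fiveTrigger ha hi)
  have tB : ∀ {i}, fiveTrigger B A i → _ := fun {i} hi =>
    cyc (h.isCoMatched_of_fiveTrigger hb (i := i) (by simpa only [h.pairing.inv] using hi))
  have hle : ∀ i, D.defect (c i) a + D.defect (c i) (f a) ≤ fiveBound A B i := by
    intro i
    have p := hpair i
    have zA : A i = false → D.defect (c i) a = 0 := fun e => defect_eq_zero.2 (by simpa [hA] using e)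
    have zB : B i = false → D.defect (c i) (f a) = 0 :=
      fun e => defect_eq_zero.2 (by simpa [hB] using e)
    unfold fiveBound
    have d1 := fun hi => (tA (i := i) hi).2
    have d2 := fun hi => (tA (i := i - 1) hi).2
    have d3 := fun hi => (tB (i := i) hi).2
    have d4 := fun hi => (tB (i := i - 1) hi).2
    rw [sub_add_cancel] at d2 d4
    cases hAi : A i <;> cases hBi : B i
    · simp [zA hAi, zB hBi]
    · cases h3 : fiveTrigger B A i <;> cases h4 : fiveTrigger B A (i - 1) <;>
        simp only [h3, h4, zA hAi] at * <;> simp at * <;> omega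
    · cases h3 : fiveTrigger A B i <;> cases h4 : fiveTrigger A B (i - 1) <;>
        simp only [h3, h4, zB hBi] at * <;> simp at * <;> omega
    · simpa using p.1
  rcases fiveBound_le A B with hh | hh | hh | hh | hh
  · exact (Finset.sum_le_sum fun i _ => hle i).trans hh
  · obtain ⟨i, hi⟩ := IsFiveCycle.exists_not_isCyclicTriple (D := D) (c := c) (a := a) fun i => by
      have := hh i
      simp only [fiveTrigger, Bool.and_eq_true, hA, decide_eq_true_eq] at this
      exact this.1.1
    exact absurd (tA (hh i)).1 hi
  · obtain ⟨i, hi⟩ := IsFiveCycle.exists_not_isCyclicTriple (D := D) (c := c) (a := f a) fun i => by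
      have := hh i
      simp only [fiveTrigger, Bool.and_eq_true, hB, decide_eq_true_eq] at this
      exact this.1.1
    exact absurd (tB (hh i)).1 hi
  · exact full ha fun i => by simpa [hA, hB] using hh i
  · have := full hb fun i => by rw [h.pairing.inv]; simpa [hA, hB] using hh i
    simp only [h.pairing.inv] at this
    simpa only [add_comm] using this

/-- If no triangle of unlinked pairs has a matched complement, then exactly eight missing arcs
force the two vertices of the pair to be unlinked to the neighbours of two consecutive cycle
vertices, as if they were copies of these. -/
theorem IsFiveCycle.exists_positions [Finite V] (hD : D.IsFactorCritical) (h : D.IsFiveCycle f c)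
    (hno : ∀ x y z, D.Unlinked x y → D.Unlinked y z → D.Unlinked x z → ¬ D.IsCoMatched {x, y, z})
    {a : V} (ha : f a ≠ a) (hsum : ∑ i, (D.defect (c i) a + D.defect (c i) (f a)) = 8) :
    ∃ j j', (j' = j + 1 ∨ j = j' + 1) ∧
      ∀ t, D.defect (c t) a = (if t = j - 1 ∨ t = j + 1 then 2 else 0) ∧
        D.defect (c t) (f a) = (if t = j' - 1 ∨ t = j' + 1 then 2 else 0) := by
  have hb : f (f a) ≠ f a := fun e => ha (f.injective e)
  have hpair := h.pair hD ha
  have hno' : ∀ {a i}, ¬ (D.Unlinked (c i) a ∧ D.Unlinked (c (i + 1)) a ∧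
      D.IsCoMatched {c i, c (i + 1), a}) := fun hh => hno _ _ _ (h.adj _) hh.2.1 hh.1 hh.2.2
  have hex : ∀ {a}, f a ≠ a → ∃ i, !(decide (D.Unlinked (c (i + 1)) a) &&
      decide (D.Unlinked (c (i + 2)) a)) && !(decide (D.Unlinked (c (i + 3)) a) &&
        decide (D.Unlinked (c (i + 4)) a)) := by
    intro a ha
    obtain ⟨i, hi⟩ := h.exists_replaces hD a
    refine ⟨i, ?_⟩
    have h1 := h.isCoMatched_of_replaces ha (i := i + 1) (Or.inl (by simpa using hi))
    have h2 := h.isCoMatched_of_replaces ha (i := i + 3) (Or.inr (by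
      rwa [(show ∀ i : Fin 5, i + 3 + 2 = i by decide) i]))
    have n1 := fun e1 e2 => hno' ⟨e1, e2, h1⟩
    have n2 := fun e1 e2 => hno' ⟨e1, e2, h2⟩
    rw [add_assoc i] at n1 n2
    simp only [Fin.isValue, Fin.reduceAdd] at n1 n2
    simp only [Bool.and_eq_true, Bool.not_eq_true', Bool.and_eq_false_iff, decide_eq_false_iff_not]
    tauto
  have hdisj : ∀ i, ¬ (D.Unlinked (c i) a ∧ D.Unlinked (c i) (f a)) := fun i hh =>
    hno _ _ _ hh.1 (h.pairing.adj a ha) hh.2 ((hpair i).2 hh.1 hh.2).1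
  -- at most one of the five sums is less than two
  have hdef : ∑ i, (2 - (D.defect (c i) a + D.defect (c i) (f a))) = 2 := by
    have e : ∑ i, (2 - (D.defect (c i) a + D.defect (c i) (f a))) +
        ∑ i, (D.defect (c i) a + D.defect (c i) (f a)) = ∑ _i : Fin 5, 2 := by
      rw [← Finset.sum_add_distrib]
      exact Finset.sum_congr rfl fun i _ => by have := (hpair i).1; omega
    simp at e
    omega
  have htwo : ∀ s t, s ≠ t → (2 - (D.defect (c s) a + D.defect (c s) (f a))) +
      (2 - (D.defect (c t) a + D.defect (c t) (f a))) ≤ 2 := fun s t hst => by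
    refine le_trans (le_of_eq ?_) (hdef ▸ Finset.sum_le_sum_of_subset
      (f := fun i => 2 - (D.defect (c i) a + D.defect (c i) (f a))) (Finset.subset_univ {s, t}))
    rw [Finset.sum_pair hst]
  obtain ⟨j, j', hj, hjj⟩ := five_alternating (a := fun i => decide (D.Unlinked (c i) a))
    (b := fun i => decide (D.Unlinked (c i) (f a))) (fun i => by
      have h1 := Bool.eq_false_iff.2 fun e => hno' (h.isCoMatched_of_fiveTrigger ha (i := i) e)
      have h2 := Bool.eq_false_iff.2 fun e => hno' (h.isCoMatched_of_fiveTrigger hb (i := i) e)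
      rw [h.pairing.inv] at h2
      have h3 := hdisj i
      rw [h1, h2]
      simpa [or_iff_not_imp_left] using h3) (hex ha) (hex hb) (by
      by_contra! hh
      obtain ⟨s, -, hs⟩ := hh 0
      obtain ⟨t, hts, ht⟩ := hh s
      have := htwo t s hts
      have e : ∀ u, (decide (D.Unlinked (c u) a) || decide (D.Unlinked (c u) (f a))) ≠ true →
          D.defect (c u) a = 0 ∧ D.defect (c u) (f a) = 0 := fun u hu => by
        rw [defect_eq_zero, defect_eq_zero]
        simpa using hu
      have := e s hs
      have := e t ht
      omega)
  simp only [decide_eq_true_eq] at hjj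
  obtain ⟨i', hi'⟩ : ∃ i, i ≠ j - 1 ∧ i ≠ j + 1 ∧ i ≠ j' - 1 ∧ i ≠ j' + 1 :=
    (show ∀ j j' : Fin 5, (j' = j + 1 ∨ j = j' + 1) →
      ∃ i, i ≠ j - 1 ∧ i ≠ j + 1 ∧ i ≠ j' - 1 ∧ i ≠ j' + 1 by decide) j j' hj
  refine ⟨j, j', hj, fun t => ?_⟩
  have hA := (hjj t).1
  have hB := (hjj t).2
  have hAi : D.defect (c i') a = 0 := defect_eq_zero.2 (fun e => ((hjj i').1.1 e).elim hi'.1 hi'.2.1)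
  have hBi : D.defect (c i') (f a) = 0 := defect_eq_zero.2 (fun e => ((hjj i').2.1 e).elim hi'.2.2.1 hi'.2.2.2)
  have hd := hdisj t
  have hle := (hpair t).1
  by_cases ht : t = i'
  · subst ht
    rw [hAi, hBi, if_neg (not_or.2 ⟨hi'.1, hi'.2.1⟩), if_neg (not_or.2 hi'.2.2)]
    exact ⟨rfl, rfl⟩
  have := htwo t i' ht
  rw [hAi, hBi] at this
  rw [← defect_pos] at hA hB
  rw [← defect_pos, ← defect_pos] at hd
  constructor
  · split_ifs with hc
    · have := hA.2 hc; omega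
    · have := mt hA.1 hc; omega
  · split_ifs with hc
    · have := hB.2 hc; omega
    · have := mt hB.1 hc; omega

end FiveCyclePair

/-! ### Counting missing arcs -/

section Counting

variable {V : Type u} [Fintype V]

/-- Counting weights over the pairs of an involution: if the weight inside `C` is at most `γ`, the weight
between `C` and a pair outside `C` is at most `β`, and the weight between any two pairs outside `C`
is at most `4`, then this bounds the total weight, and equality is inherited by all these bounds. -/
theorem sum_weight_le {w : V → V → ℕ} (hw : ∀ x y, w x y = w y x) {f : Equiv.Perm V} {C : Finset V}
    (hfC : ∀ x, x ∉ C → f x ∉ C) (hff : ∀ x, f (f x) = x) {γ β u : ℕ}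
    (hu : Fintype.card V = C.card + u)
    (hγ : ∑ x ∈ C, ∑ y ∈ C, w x y ≤ γ)
    (hβ : ∀ x, x ∉ C → ∑ c ∈ C, (w c x + w c (f x)) ≤ β)
    (h4 : ∀ x y, x ∉ C → y ∉ C → w x y + w x (f y) + w (f x) y + w (f x) (f y) ≤ 4) :
    ∑ x, ∑ y, w x y ≤ γ + u * β + u * u ∧
      (∑ x, ∑ y, w x y = γ + u * β + u * u → ∑ x ∈ C, ∑ y ∈ C, w x y = γ ∧
        (∀ x, x ∉ C → ∑ c ∈ C, (w c x + w c (f x)) = β) ∧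
        ∀ x y, x ∉ C → y ∉ C → w x y + w x (f y) + w (f x) y + w (f x) (f y) = 4) := by
  set U := Cᶜ with hU
  have hUc : U.card = u := by rw [hU, Finset.card_compl]; omega
  have hUm : ∀ {x}, x ∈ U ↔ x ∉ C := Finset.mem_compl
  have hsw : ∀ h : V → ℕ, ∑ x ∈ U, h (f x) = ∑ x ∈ U, h x := fun h =>
    Finset.sum_nbij' f f (fun x hx => hUm.2 (hfC x (hUm.1 hx))) (fun x hx => hUm.2 (hfC x (hUm.1 hx)))
      (fun x _ => hff x) (fun x _ => hff x) (fun x _ => rfl)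
  have hsplit : ∀ h : V → ℕ, ∑ x, h x = ∑ x ∈ C, h x + ∑ x ∈ U, h x := fun h =>
    (Finset.sum_add_sum_compl C h).symm
  have hB : ∑ x ∈ U, ∑ c ∈ C, (w c x + w c (f x)) = 2 * ∑ x ∈ U, ∑ c ∈ C, w c x := by
    simp only [Finset.sum_add_distrib]
    rw [hsw (fun x => ∑ c ∈ C, w c x)]; ring
  have hE : ∑ x ∈ U, ∑ y ∈ U, (w x y + w x (f y) + w (f x) y + w (f x) (f y)) =
      4 * ∑ x ∈ U, ∑ y ∈ U, w x y := by
    simp only [Finset.sum_add_distrib]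
    have e1 : ∀ x, ∑ y ∈ U, w x (f y) = ∑ y ∈ U, w x y := fun x => hsw _
    simp only [e1]
    rw [hsw (fun x => ∑ y ∈ U, w x y)]; ring
  have hT : ∑ x, ∑ y, w x y = ∑ x ∈ C, ∑ y ∈ C, w x y + 2 * (∑ x ∈ U, ∑ c ∈ C, w c x) +
      ∑ x ∈ U, ∑ y ∈ U, w x y := by
    simp only [hsplit, Finset.sum_add_distrib]
    have : ∑ x ∈ C, ∑ y ∈ U, w x y = ∑ x ∈ U, ∑ c ∈ C, w c x := Finset.sum_comm
    have : ∑ x ∈ U, ∑ y ∈ C, w x y = ∑ x ∈ U, ∑ c ∈ C, w c x := by simp only [hw]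
    omega
  have hβ' : ∀ x ∈ U, ∑ c ∈ C, (w c x + w c (f x)) ≤ β := fun x hx => hβ x (hUm.1 hx)
  have h4' : ∀ x ∈ U, ∀ y ∈ U, w x y + w x (f y) + w (f x) y + w (f x) (f y) ≤ 4 :=
    fun x hx y hy => h4 x y (hUm.1 hx) (hUm.1 hy)
  have cB : ∑ _x ∈ U, β = u * β := by simp [hUc]
  have cE : ∑ _x ∈ U, ∑ _y ∈ U, 4 = 4 * (u * u) := by simp [hUc]; ring
  have h5 : ∀ x ∈ U, ∑ y ∈ U, (w x y + w x (f y) + w (f x) y + w (f x) (f y)) ≤ ∑ _y ∈ U, 4 :=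
    fun x hx => Finset.sum_le_sum (h4' x hx)
  have lB := Finset.sum_le_sum hβ'
  have lE := Finset.sum_le_sum h5
  refine ⟨by omega, fun heq => ⟨by omega, fun x hx => ?_, fun x y hx hy => ?_⟩⟩
  · exact (Finset.sum_eq_sum_iff_of_le hβ').1 (by omega) x (hUm.2 hx)
  · exact (Finset.sum_eq_sum_iff_of_le (h4' x (hUm.2 hx))).1
      ((Finset.sum_eq_sum_iff_of_le h5).1 (by omega) x (hUm.2 hx)) y (hUm.2 hy)

/-- The number of missing arcs inside a set of vertices. -/
noncomputable def missing {V : Type u} (D : Digraph V) (S : Finset V) : ℕ :=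
  ∑ x ∈ S, ∑ y ∈ S, D.missingArc x y

theorem sum_defect {V : Type u} (D : Digraph V) (S : Finset V) :
    ∑ x ∈ S, ∑ y ∈ S, D.defect x y = 2 * D.missing S := by
  unfold missing defect
  simp only [Finset.sum_add_distrib]
  rw [two_mul, Finset.sum_comm (f := fun x y => D.missingArc y x)]

variable {D : Digraph V}

/-- The degree bound, and what equality means: the vertex `v` misses exactly two arcs to each pair of
every matching. -/
theorem IsFactorCritical.sum_defect_le (hD : D.IsFactorCritical) {p : ℕ}
    (hp : Fintype.card V = 2 * p + 1) (v : V) : ∑ x, D.defect v x ≤ 2 * p ∧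
      (∑ x, D.defect v x = 2 * p → ∀ f, IsPairing D.Unlinked f → (∀ x, f x = x ↔ x = v) →
        ∀ x, x ≠ v → D.defect v x + D.defect v (f x) = 2) := by
  have key : ∀ f, IsPairing D.Unlinked f → (∀ x, f x = x ↔ x = v) →
      ∑ x, D.defect v x ≤ 2 * p ∧ (∑ x, D.defect v x = 2 * p → ∀ x, x ≠ v →
        D.defect v x + D.defect v (f x) = 2) := by
    intro f hf hfv
    have e1 : ∑ x, (D.defect v x + D.defect v (f x)) = 2 * ∑ x, D.defect v x := by
      rw [Finset.sum_add_distrib, Equiv.sum_comp f (fun x => D.defect v x)]; ring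
    have e2 : ∑ x ∈ Finset.univ.erase v, (D.defect v x + D.defect v (f x)) =
        2 * ∑ x, D.defect v x := by
      rw [← e1]
      refine Finset.sum_erase _ ?_
      simp only [(hfv v).2 rfl, defect_self, add_zero]
    have e3 : ∑ _x ∈ Finset.univ.erase v, 2 = 4 * p := by
      rw [Finset.sum_const, Finset.card_erase_of_mem (Finset.mem_univ v), Finset.card_univ, hp]
      simp; ring
    have hle : ∀ x ∈ Finset.univ.erase v, D.defect v x + D.defect v (f x) ≤ 2 := fun x hx =>
      (hD.pair hf hfv (Finset.ne_of_mem_erase hx)).1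
    have := Finset.sum_le_sum hle
    refine ⟨by omega, fun heq x hx => ?_⟩
    exact (Finset.sum_eq_sum_iff_of_le hle).1 (by omega) x (by simpa using hx)
  obtain ⟨f, hf, hfv⟩ := hD.erase v
  exact ⟨(key f hf fun x => by rw [hfv]; rfl).1, fun heq f hf hfv => (key f hf hfv).2 heq⟩

/-- Without a vertex of extremal degree the bound is not attained. -/
theorem IsFactorCritical.missing_lt_of_forall_lt (hD : D.IsFactorCritical) {p : ℕ}
    (hp : Fintype.card V = 2 * p + 1) (h : ∀ v, ∑ x, D.defect v x ≠ 2 * p) :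
    D.missing Finset.univ + 1 ≤ 2 * p ^ 2 := by
  have h1 : ∀ v ∈ Finset.univ, ∑ x, D.defect v x ≤ 2 * p - 1 := fun v _ => by
    have := (hD.sum_defect_le hp v).1
    have := h v
    omega
  have h2 := Finset.sum_le_sum h1
  rw [D.sum_defect, Finset.sum_const, Finset.card_univ, hp, smul_eq_mul] at h2
  rcases Nat.eq_zero_or_pos p with rfl | hp0
  · obtain ⟨v⟩ : Nonempty V := Fintype.card_pos_iff.1 (by omega)
    have := (hD.sum_defect_le hp v).1
    have := h v
    omega
  obtain ⟨q, rfl⟩ : ∃ q, p = q + 1 := ⟨p - 1, by omega⟩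
  rw [show 2 * (q + 1) - 1 = 2 * q + 1 by omega] at h2
  nlinarith

/-- The bound obtained from a vertex of extremal degree that is unlinked to both vertices of a pair. -/
theorem IsFactorCritical.missing_le_of_triangle (hD : D.IsFactorCritical) {p : ℕ}
    (hp : Fintype.card V = 2 * p + 1) {v : V} (hv : ∑ x, D.defect v x = 2 * p) {f : Equiv.Perm V}
    (hf : IsPairing D.Unlinked f) (hfv : ∀ x, f x = x ↔ x = v) {a : V} (hva : D.Unlinked v a)
    (hvb : D.Unlinked v (f a)) : D.missing Finset.univ ≤ 2 * p ^ 2 + 1 := by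
  have hav : a ≠ v := hva.1.symm
  have hfa : f a ≠ a := fun h => hav ((hfv a).1 h)
  have hlow := (hD.sum_defect_le hp v).2 hv
  have hab := hf.adj a hfa
  obtain ⟨-, d1, d2, d3⟩ := (hD.pair hf hfv hav).2 hva hvb
  obtain ⟨g, hg, g1, g2, g3⟩ := hf.cut a
  have hgfix : ∀ w, g w = w ↔ w = v ∨ w = a ∨ w = f a := fun w => by
    by_cases x1 : w = a
    · subst x1; simp [g1]
    by_cases x2 : w = f a
    · subst x2; simp [g2]
    rw [g3 w x1 x2, hfv]; simp [x1, x2]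
  have hC : ∀ w, w ∈ ({v, a, f a} : Finset V) ↔ g w = w := fun w => by simp [hgfix]
  have hcard : ({v, a, f a} : Finset V).card = 3 :=
    Finset.card_eq_three.2 ⟨v, a, f a, hva.1, hvb.1, hab.1, rfl⟩
  have hsum : ∀ h : V → ℕ, ∑ x ∈ ({v, a, f a} : Finset V), h x = h v + h a + h (f a) := fun h => by
    rw [Finset.sum_insert (by simp [hva.1, hvb.1]), Finset.sum_pair hab.1]; ring
  have h3 : 3 ≤ Fintype.card V := hcard ▸ Finset.card_le_univ _
  have hgf : ∀ x, x ∉ ({v, a, f a} : Finset V) → g x = f x := fun x hx => by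
    simp only [Finset.mem_insert, Finset.mem_singleton, not_or] at hx
    exact g3 x hx.2.1 hx.2.2
  have := (sum_weight_le (w := D.defect) D.defect_comm (f := g) (C := {v, a, f a}) (γ := 6) (β := 4)
    (u := 2 * (p - 1)) (fun x hx => by rw [hC] at hx ⊢; exact fun h => hx (g.injective h)) hg.inv
    (by omega) (by
      simp only [hsum, defect_self]
      rw [D.defect_comm a v, D.defect_comm (f a) v, D.defect_comm (f a) a]; omega)
    (fun x hx => by
      rw [hsum]
      have := hD.triangle_pair hva hab hvb hg hgfix (a := x) (by rwa [hC] at hx)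
      omega)
    (fun x y hx hy => by
      rw [hgf x hx, hgf y hy]
      simp only [Finset.mem_insert, Finset.mem_singleton, not_or] at hx hy
      exact hD.pair_pair hlow hf hfv hx.1 hy.1)).1
  rw [D.sum_defect] at this
  obtain ⟨q, rfl⟩ : ∃ q, p = q + 1 := ⟨p - 1, by omega⟩
  simp only [Nat.add_sub_cancel] at this
  nlinarith

/-- If a vertex `v` of extremal degree is linked to one vertex of each pair, then two of these
vertices are unlinked, which gives a five-cycle. -/
theorem IsFactorCritical.exists_isFiveCycle (hD : D.IsFactorCritical) {p : ℕ}
    (hp : Fintype.card V = 2 * p + 1) (hp1 : 1 ≤ p) {v : V} (hv : ∑ x, D.defect v x = 2 * p)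
    {f : Equiv.Perm V} (hf : IsPairing D.Unlinked f) (hfv : ∀ x, f x = x ↔ x = v)
    (hI : ∀ x, ¬ (D.Unlinked v x ∧ D.Unlinked v (f x))) :
    ∃ g c, D.IsFiveCycle g c ∧ c 0 = v ∧ f (c 1) = c 2 ∧ f (c 3) = c 4 ∧
      ∀ x, g x ≠ x → g x = f x := by
  have hlow := (hD.sum_defect_le hp v).2 hv f hf hfv
  have hnv : ∀ {z}, z ≠ v → f z ≠ v := fun {z} h h' => h (by rw [← hf.inv z, h', (hfv v).2 rfl])
  have htwo : ∀ x, x ≠ v → (D.defect v x = 0 ∧ D.defect v (f x) = 2) ∨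
      (D.defect v x = 2 ∧ D.defect v (f x) = 0) := fun x hx => by
    have h1 := hlow x hx
    have h2 := hI x
    rw [← defect_pos, ← defect_pos] at h2
    omega
  obtain ⟨b₁, b₂, n1, n2, z1, z2, hb⟩ : ∃ b₁ b₂, b₁ ≠ v ∧ b₂ ≠ v ∧ D.defect v b₁ = 0 ∧
      D.defect v b₂ = 0 ∧ D.Unlinked b₁ b₂ := by
    by_contra! hno
    set B := Finset.univ.filter fun x => x ≠ v ∧ D.defect v x = 0 with hB
    set A := Finset.univ.filter fun x => x ≠ v ∧ D.defect v x = 2 with hA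
    have hBA : B.card = A.card := by
      refine Finset.card_nbij' f f ?_ ?_ (fun x _ => hf.inv x) (fun x _ => hf.inv x)
      · intro x hx
        simp only [hA, hB, Finset.mem_filter_univ, SetLike.mem_coe] at hx ⊢
        have := htwo x hx.1
        exact ⟨hnv hx.1, by omega⟩
      · intro x hx
        simp only [hA, hB, Finset.mem_filter_univ, SetLike.mem_coe] at hx ⊢
        have := htwo x hx.1
        exact ⟨hnv hx.1, by omega⟩
    obtain ⟨a, ha⟩ : A.Nonempty := by
      obtain ⟨x, hx⟩ : ∃ x, x ≠ v := Fintype.exists_ne_of_one_lt_card (by omega) v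
      rcases htwo x hx with h | h
      · exact ⟨f x, by simp only [hA, Finset.mem_filter_univ]; exact ⟨hnv hx, h.2⟩⟩
      · exact ⟨x, by simp only [hA, Finset.mem_filter_univ]; exact ⟨hx, h.1⟩⟩
    -- a matching that misses `a` sends the vertices linked to `v` to other vertices than `a`
    obtain ⟨g, hg, hga⟩ := hD.erase a
    have hcard : B.card ≤ (A.erase a).card := by
      refine Finset.card_le_card_of_injOn g (fun b hb => ?_) g.injective.injOn
      simp only [hB, Finset.mem_filter_univ, SetLike.mem_coe] at hb
      have haA : a ≠ v ∧ D.defect v a = 2 := by simpa [hA] using ha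
      have hba : b ≠ a := fun h => by rw [h] at hb; omega
      have hgb : g b ≠ b := fun h => hba ((hga b).1 h)
      have hU := hg.adj b hgb
      have hgv : g b ≠ v := fun h => by
        have := defect_pos.2 hU.symm
        rw [h] at this; omega
      have hgb0 : D.defect v (g b) ≠ 0 := fun h => hno b (g b) hb.1 hgv hb.2 h hU
      simp only [hA, Finset.coe_erase, Set.mem_sdiff, SetLike.mem_coe, Finset.mem_filter_univ,
        Set.mem_singleton_iff]
      refine ⟨⟨hgv, ?_⟩, fun h => hba (g.injective (h.trans ((hga a).2 rfl).symm))⟩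
      have := htwo _ hgv
      omega
    rw [Finset.card_erase_of_mem ha] at hcard
    have := Finset.card_pos.2 ⟨a, ha⟩
    omega
  have w1 : D.defect v (f b₁) = 2 := by have := htwo b₁ n1; omega
  have w2 : D.defect v (f b₂) = 2 := by have := htwo b₂ n2; omega
  have h21 : b₂ ≠ f b₁ := fun h => by rw [h] at z2; omega
  have h12 : b₁ ≠ f b₂ := fun h => by rw [h] at z1; omega
  obtain ⟨g, hg, hgS, hgf⟩ := hf.cut_two hfv hb.1.symm h21
  have hfb : ∀ {b}, b ≠ v → f b ≠ b := fun h h' => h ((hfv _).1 h')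
  have hff : f b₁ ≠ f b₂ := fun h => hb.1 (f.injective h)
  refine ⟨g, ![v, f b₁, b₁, b₂, f b₂], ⟨hg, ?_, ?_, fun w => ?_⟩, rfl, hf.inv b₁, rfl, fun x hx => ?_⟩
  · intro i j hij
    have := hb.1
    have := hnv n1
    have := hnv n2
    have := hfb n1
    have := hfb n2
    have hij' : ![v, f b₁, b₁, b₂, f b₂] i = ![v, f b₁, b₁, b₂, f b₂] j := hij
    clear hD hv hf hfv hI hlow htwo z1 z2 w1 w2 hgS hgf hg hfb hnv hij
    fin_cases i <;> fin_cases j <;> first | rfl | (exfalso; revert hij'; dsimp; tauto)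
  · intro i
    fin_cases i
    · exact defect_pos.1 (by simp [w1])
    · exact (hf.adj b₁ (hfb n1)).symm
    · exact hb
    · exact hf.adj b₂ (hfb n2)
    · exact (defect_pos.1 (by simp [w2]) : D.Unlinked v (f b₂)).symm
  · rw [hgS, mem_range_five]
    simp
    tauto
  · have : x ∉ ({v, b₁, f b₁, b₂, f b₂} : Set V) := fun h => hx ((hgS x).2 h)
    simp only [Set.mem_insert_iff, Set.mem_singleton_iff, not_or] at this
    exact hgf x this.2.1 this.2.2.1 this.2.2.2.1 this.2.2.2.2

/-- The bound for the number of missing arcs obtained from a five-cycle through a vertex of extremal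
degree, and what equality means. -/
theorem IsFiveCycle.missing_le {f : Equiv.Perm V} {c : Fin 5 → V} (hD : D.IsFactorCritical) {p : ℕ}
    (hp : Fintype.card V = 2 * p + 1) (h : D.IsFiveCycle f c)
    (hv : ∑ x, D.defect (c 0) x = 2 * p) :
    2 ≤ p ∧ D.missing Finset.univ ≤ 2 * p ^ 2 + 2 ∧ (D.missing Finset.univ = 2 * p ^ 2 + 2 →
      (∀ i, D.defect (c i) (c (i + 1)) + D.defect (c i) (c (i + 2)) = 2 ∧
        D.defect (c i) (c (i + 3)) + D.defect (c i) (c (i + 4)) = 2) ∧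
      (∀ x, f x ≠ x → ∑ i, (D.defect (c i) x + D.defect (c i) (f x)) = 8) ∧
      ∀ x y, f x ≠ x → f y ≠ y →
        D.defect x y + D.defect x (f y) + D.defect (f x) y + D.defect (f x) (f y) = 4) := by
  have hlow := (hD.sum_defect_le hp _).2 hv
  have hC : ∀ w, w ∈ Finset.univ.image c ↔ f w = w := fun w => by rw [h.fix]; simp
  have hcard : (Finset.univ.image c).card = 5 := by
    rw [Finset.card_image_of_injective _ h.inj]; simp
  have h5 : 5 ≤ Fintype.card V := hcard ▸ Finset.card_le_univ _
  have hsum : ∀ g : V → ℕ, ∑ x ∈ Finset.univ.image c, g x = ∑ i, g (c i) := fun g =>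
    Finset.sum_image fun _ _ _ _ e => h.inj e
  obtain ⟨k, hk, hkfix, -, -, hkf⟩ := h.exists_isPairing 0
  have hself := h.sum_defect_self_le hD
  have := sum_weight_le (w := D.defect) D.defect_comm (f := f) (C := Finset.univ.image c) (γ := 20)
    (β := 8) (u := 2 * (p - 2))
    (fun x hx => by rw [hC] at hx ⊢; exact fun h => hx (f.injective h)) h.pairing.inv
    (by omega) (by simp only [hsum]; exact hself.1)
    (fun x hx => by
      rw [hsum]
      exact h.sum_defect_le hD (by rwa [hC] at hx))
    (fun x y hx hy => by
      rw [hC] at hx hy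
      rw [← hkf x hx, ← hkf y hy]
      exact hD.pair_pair hlow hk hkfix (h.ne hx 0).symm (h.ne hy 0).symm)
  simp only [hsum, D.sum_defect, hC] at this
  obtain ⟨q, rfl⟩ : ∃ q, p = q + 2 := ⟨p - 2, by omega⟩
  simp only [Nat.add_sub_cancel] at this
  refine ⟨by omega, by nlinarith [this.1], fun heq => ?_⟩
  obtain ⟨h1, h2, h3⟩ := this.2 (by rw [heq]; ring)
  exact ⟨hself.2 h1, h2, h3⟩

end Counting

/-! ### The structure of the extremal digraphs -/

section FiveAdj

/-- Adjacency in the five-cycle. -/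
def fiveAdj (i j : Fin 5) : Bool := j == i + 1 || i == j + 1

theorem fiveAdj_comm : ∀ i j, fiveAdj i j = fiveAdj j i := by decide

theorem fiveAdj_self : ∀ i, fiveAdj i i = false := by decide

theorem fiveAdj_triangle : ∀ i j k, fiveAdj i j → fiveAdj i k → fiveAdj j k = false := by decide

theorem fiveAdj_iff : ∀ i j, fiveAdj i j ↔ (j = i - 1 ∨ j = i + 1) := by decide

/-- Two edges `p p'` and `q q'` of the five-cycle with `p` and `q` not adjacent: a common neighbour of
`p` and `q` can be chosen such that the remaining four vertices consist of a neighbour of `p'`, a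
neighbour of `q'` and an edge. -/
theorem fiveAdj_cover : ∀ p p' q q' : Fin 5, fiveAdj p p' → fiveAdj q q' → fiveAdj p q = false →
    ∃ s s₁ s₂ s₃ : Fin 5, (fiveAdj s p && fiveAdj s q && fiveAdj s₁ p' && fiveAdj s₂ q') ∧
      [s, s₁, s₂, s₃, s₃ + 1].Nodup := by decide

/-- The edges of the five-cycle with exactly one end adjacent to `0`. -/
def fiveLow (p p' : Fin 5) : Bool := fiveAdj p p' && (fiveAdj 0 p != fiveAdj 0 p')

/-- Two edges of the five-cycle that are equal or share an end. -/
def fiveMeet (p p' q q' : Fin 5) : Bool :=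
  (fiveAdj p q && fiveAdj p' q') || (fiveAdj p q' && fiveAdj p' q)

/-- The edges of the five-cycle at the vertex `i + 3`. -/
def fiveAt (i p p' : Fin 5) : Bool :=
  (p == i + 3 && (p' == i + 2 || p' == i + 4)) || (p' == i + 3 && (p == i + 2 || p == i + 4))

theorem fiveAt_of_fiveMeet : ∀ p p' q q', fiveLow p p' → fiveLow q q' → fiveMeet p p' q q' →
    fiveAt 2 p p' = false →
      (fiveAt 1 p p' && fiveAt 1 q q') || (fiveAt 3 p p' && fiveAt 3 q q') := by decide

theorem fiveAt_of_fiveLow : ∀ p p', fiveLow p p' → (fiveAt 1 p p' && fiveAt 3 p p') = false := by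
  decide

end FiveAdj

section Positions

variable {V : Type u} {D : Digraph V} {f : Equiv.Perm V} {c : Fin 5 → V}

/-- Two vertices whose positions on the five-cycle are not adjacent are linked. -/
theorem IsFiveCycle.not_unlinked_of_positions (h : D.IsFiveCycle f c)
    (hno : ∀ x y z, D.Unlinked x y → D.Unlinked y z → D.Unlinked x z → ¬ D.IsCoMatched {x, y, z})
    {φ : V → Fin 5} (h1 : ∀ x t, D.Unlinked (c t) x ↔ fiveAdj t (φ x))
    (h3 : ∀ x, f x ≠ x → fiveAdj (φ x) (φ (f x))) {x y : V} (hx : f x ≠ x) (hy : f y ≠ y)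
    (hxy : fiveAdj (φ x) (φ y) = false) : ¬ D.Unlinked x y := by
  intro hU
  have hyfx : y ≠ f x := fun e => by rw [e, h3 x hx] at hxy; exact absurd hxy (by simp)
  have hyx : y ≠ x := hU.1.symm
  have hfyx : f y ≠ x := fun e => hyfx (by rw [← e, h.pairing.inv])
  have hff : f y ≠ f x := fun e => hyx (f.injective e)
  obtain ⟨s, s₁, s₂, s₃, hs, hnd⟩ := fiveAdj_cover _ _ _ _ (h3 x hx) (h3 y hy) hxy
  simp only [Bool.and_eq_true, ← h1] at hs
  obtain ⟨⟨⟨a1, a2⟩, a3⟩, a4⟩ := hs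
  have hnd' : (s ≠ s₁ ∧ s ≠ s₂ ∧ s ≠ s₃ ∧ s ≠ s₃ + 1) ∧ (s₁ ≠ s₂ ∧ s₁ ≠ s₃ ∧ s₁ ≠ s₃ + 1) ∧
      s₂ ≠ s₃ ∧ s₂ ≠ s₃ + 1 := by
    simp only [List.nodup_cons, List.mem_cons, not_or, List.not_mem_nil] at hnd
    tauto
  obtain ⟨⟨m1, m2, m3, m4⟩, ⟨m5, m6, m7⟩, m8, m9⟩ := hnd'
  have hall : ∀ t, t = s ∨ t = s₁ ∨ t = s₂ ∨ t = s₃ ∨ t = s₃ + 1 := by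
    intro t
    have e : ({s, s₁, s₂, s₃, s₃ + 1} : Finset (Fin 5)) = Finset.univ := by
      apply Finset.eq_univ_of_card
      have := List.toFinset_card_of_nodup hnd
      simpa using this
    have := Finset.mem_univ t
    rw [← e] at this
    simpa using this
  have hcx := h.ne hx
  have hcy := h.ne hy
  have hcx' := h.ne (a := f x) fun e => hx (f.injective e)
  have hcy' := h.ne (a := f y) fun e => hy (f.injective e)
  obtain ⟨g, hg, g1, g2, g3⟩ := h.pairing.cut x
  have hcm : D.IsCoMatched {w | w ∈ Set.range c ∨ w = x ∨ w = f x ∨ w = y ∨ w = f y} := by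
    refine IsCoMatched.cut (S := {w | w ∈ Set.range c ∨ w = x ∨ w = f x}) hg (fun w => ?_) y
      fun w => ?_
    · by_cases wx : w = x
      · subst wx; simp [g1]
      by_cases wy : w = f x
      · subst wy; simp [g2]
      rw [g3 w wx wy, h.fix]; simp [wx, wy]
    · rw [g3 y hyx hyfx]
      simp only [Set.mem_ofPred_eq]
      tauto
  have n : ∀ {i j : Fin 5}, i ≠ j → c i ≠ c j := fun e => h.inj.ne e
  have j1 : D.IsCoMatched {w | w = c s ∨ w = c s₂ ∨ w = c s₃ ∨ w = c (s₃ + 1) ∨ w = x ∨ w = y ∨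
      w = f y} := by
    refine hcm.join a3 (by simp) (by simp) fun w => ?_
    constructor
    · rintro (rfl | rfl | rfl | rfl | rfl | rfl | rfl)
      · exact ⟨Or.inl ⟨_, rfl⟩, n m1, hcx' _⟩
      · exact ⟨Or.inl ⟨_, rfl⟩, n m5.symm, hcx' _⟩
      · exact ⟨Or.inl ⟨_, rfl⟩, n m6.symm, hcx' _⟩
      · exact ⟨Or.inl ⟨_, rfl⟩, n m7.symm, hcx' _⟩
      · exact ⟨by simp, (hcx _).symm, hx.symm⟩
      · exact ⟨by simp, (hcy _).symm, hyfx⟩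
      · exact ⟨by simp, (hcy' _).symm, hff⟩
    · rintro ⟨⟨t, rfl⟩ | rfl | rfl | rfl | rfl, e1, e2⟩
      · rcases hall t with rfl | rfl | rfl | rfl | rfl <;> simp at e1 ⊢
      all_goals simp at e2 ⊢
  have j2 : D.IsCoMatched {w | w = c s ∨ w = c s₃ ∨ w = c (s₃ + 1) ∨ w = x ∨ w = y} := by
    refine j1.join a4 (by simp) (by simp) fun w => ?_
    constructor
    · rintro (rfl | rfl | rfl | rfl | rfl)
      · exact ⟨by simp, n m2, hcy' _⟩
      · exact ⟨by simp, n m8.symm, hcy' _⟩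
      · exact ⟨by simp, n m9.symm, hcy' _⟩
      · exact ⟨by simp, (hcx _).symm, hfyx.symm⟩
      · exact ⟨by simp, (hcy _).symm, hy.symm⟩
    · rintro ⟨rfl | rfl | rfl | rfl | rfl | rfl | rfl, e1, e2⟩ <;> simp at e1 e2 ⊢
  refine hno (c s) x y a1 hU a2 (j2.join (h.adj s₃) (by simp) (by simp) fun w => ?_)
  constructor
  · rintro (rfl | rfl | rfl)
    · exact ⟨by simp, n m3, n m4⟩
    · exact ⟨by simp, (hcx _).symm, (hcx _).symm⟩
    · exact ⟨by simp, (hcy _).symm, (hcy _).symm⟩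
  · rintro ⟨rfl | rfl | rfl | rfl | rfl, e1, e2⟩ <;> simp at e1 e2 ⊢

end Positions

section Structure

variable {V : Type u} [Fintype V] {D : Digraph V} {f : Equiv.Perm V} {c : Fin 5 → V}

/-- In the extremal case no triangle of unlinked pairs has a perfectly matched complement. -/
theorem IsFactorCritical.not_isCoMatched_triangle (hD : D.IsFactorCritical) {p : ℕ}
    (hp : Fintype.card V = 2 * p + 1) (hp1 : 1 ≤ p) (hM : D.missing Finset.univ = 2 * p ^ 2 + 2)
    {v : V} (hv : ∑ x, D.defect v x = 2 * p) {x y z : V} (hxy : D.Unlinked x y)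
    (hyz : D.Unlinked y z) (hxz : D.Unlinked x z) : ¬ D.IsCoMatched {x, y, z} := by
  intro hC
  have hdef := (hD.cyclic x y z hxy hyz hxz hC).defect_eq hxy hyz hxz
  have hI : ∀ f, IsPairing D.Unlinked f → (∀ x, f x = x ↔ x = v) →
      ∀ x, ¬ (D.Unlinked v x ∧ D.Unlinked v (f x)) := fun f hf hfv x hx => by
    have := hD.missing_le_of_triangle hp hv hf hfv hx.1 hx.2
    omega
  -- a matched pair with one missing arc contradicts the equality case of the count
  have key : ∀ f, IsPairing D.Unlinked f → (∀ x, f x = x ↔ x = v) → ∀ x, x ≠ v →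
      D.defect x (f x) = 2 := by
    intro f hf hfv x hx
    obtain ⟨g, c, h, hc0, h12, h34, hgf⟩ := hD.exists_isFiveCycle hp hp1 hv hf hfv (hI f hf hfv)
    obtain ⟨-, -, heq⟩ := h.missing_le hD hp (by rwa [hc0])
    obtain ⟨h1, -, h3⟩ := heq hM
    have hv1 : D.defect (c 0) (c 1) > 0 := defect_pos.2 (h.adj 0)
    have hv4 : D.defect (c 4) (c 0) > 0 := defect_pos.2 (h.adj 4)
    rw [D.defect_comm] at hv4
    have i1 := hI f hf hfv (c 1)
    have i3 := hI f hf hfv (c 3)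
    rw [h12, ← defect_pos, ← defect_pos, ← hc0] at i1
    rw [h34, ← defect_pos, ← defect_pos, ← hc0] at i3
    have d2 := (h1 2).2
    have d3 := (h1 3).1
    simp only [Fin.isValue, Fin.reduceAdd] at d2 d3
    have e12 : D.defect (c 1) (c 2) = 2 := by
      rw [D.defect_comm (c 2) (c 0), D.defect_comm (c 2) (c 1)] at d2; omega
    have e34 : D.defect (c 3) (c 4) = 2 := by
      rw [D.defect_comm (c 3) (c 0)] at d3; omega
    by_cases hxg : g x = x
    · obtain h | h | h | h | h := mem_range_five.1 ((h.fix x).1 hxg)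
      · exact absurd (h.trans hc0) hx
      · rw [h, h12, e12]
      · rw [h, ← h12, hf.inv, h12, D.defect_comm, e12]
      · rw [h, h34, e34]
      · rw [h, ← h34, hf.inv, h34, D.defect_comm, e34]
    · have := h3 x x hxg hxg
      rw [hgf x hxg, defect_self, defect_self, D.defect_comm (f x) x] at this
      omega
  -- a triangle through `v`
  have tri : ∀ y z, D.Unlinked v y → D.Unlinked y z → D.Unlinked v z → D.IsCoMatched {v, y, z} →
      False := by
    rintro y z hvy hyz hvz ⟨g, hg, hgS⟩
    obtain ⟨k, hk, k1, k2, k3⟩ := hg.join (unlinked_symm D) ((hgS y).2 (by simp))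
      ((hgS z).2 (by simp)) hyz
    refine hI k hk (fun w => ?_) y ⟨hvy, by rwa [k1]⟩
    by_cases wy : w = y
    · subst wy; rw [k1]; exact ⟨fun h => absurd h hyz.1.symm, fun h => absurd h hvy.1.symm⟩
    by_cases wz : w = z
    · subst wz; rw [k2]; exact ⟨fun h => absurd h hyz.1, fun h => absurd h hvz.1.symm⟩
    rw [k3 w wy wz, hgS]; simp [wy, wz]
  -- a triangle one of whose vertices can be replaced by `v`
  have rep : ∀ y z, y ≠ v → z ≠ v → D.Unlinked y z → D.IsCoMatched {v, y, z} →
      D.defect y z = 1 → False := by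
    rintro y z hvy hvz hyz ⟨g, hg, hgS⟩ h1
    obtain ⟨k, hk, k1, k2, k3⟩ := hg.join (unlinked_symm D) ((hgS y).2 (by simp))
      ((hgS z).2 (by simp)) hyz
    have := key k hk (fun w => by
      by_cases wy : w = y
      · subst wy; rw [k1]; exact ⟨fun h => absurd h hyz.1.symm, fun h => absurd h hvy⟩
      by_cases wz : w = z
      · subst wz; rw [k2]; exact ⟨fun h => absurd h hyz.1, fun h => absurd h hvz⟩
      rw [k3 w wy wz, hgS]; simp [wy, wz]) y hvy
    rw [k1] at this; omega
  by_cases hvx : x = v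
  · subst hvx; exact tri y z hxy hyz hxz hC
  by_cases hvy : y = v
  · subst hvy
    exact tri x z hxy.symm hxz hyz (hC.congr fun w => by
      simp only [Set.mem_insert_iff, Set.mem_singleton_iff]; tauto)
  by_cases hvz : z = v
  · subst hvz
    exact tri x y hxz.symm hxy hyz.symm (hC.congr fun w => by
      simp only [Set.mem_insert_iff, Set.mem_singleton_iff]; tauto)
  obtain ⟨u, hu, hr⟩ := hD.replace hC (a := v)
  have n1 := hxy.1
  have n2 := hyz.1
  have n3 := hxz.1
  simp only [Set.mem_insert_iff, Set.mem_singleton_iff] at hu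
  rcases hu with rfl | rfl | rfl
  · refine rep y z hvy hvz hyz (hr.congr fun w => ?_) hdef.2.1
    simp only [Set.mem_insert_iff, Set.mem_sdiff, Set.mem_singleton_iff]
    constructor
    · tauto
    · rintro (rfl | rfl | rfl) <;> simp [*, n1.symm, n3.symm]
  · refine rep x z hvx hvz hxz (hr.congr fun w => ?_) hdef.2.2
    simp only [Set.mem_insert_iff, Set.mem_sdiff, Set.mem_singleton_iff]
    constructor
    · tauto
    · rintro (rfl | rfl | rfl) <;> simp [*, n2.symm]
  · refine rep x y hvx hvy hxy (hr.congr fun w => ?_) hdef.1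
    simp only [Set.mem_insert_iff, Set.mem_sdiff, Set.mem_singleton_iff]
    constructor
    · tauto
    · rintro (rfl | rfl | rfl) <;> simp [*]

/-- In the extremal case the unlinked pairs form a blow-up of the five-cycle, and both arcs are missing
for each of them. -/
theorem IsFiveCycle.exists_position (hD : D.IsFactorCritical) (h : D.IsFiveCycle f c)
    (hno : ∀ x y z, D.Unlinked x y → D.Unlinked y z → D.Unlinked x z → ¬ D.IsCoMatched {x, y, z})
    (h1 : ∀ i, D.defect (c i) (c (i + 1)) + D.defect (c i) (c (i + 2)) = 2)
    (h2 : ∀ x, f x ≠ x → ∑ i, (D.defect (c i) x + D.defect (c i) (f x)) = 8)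
    (h3 : ∀ x y, f x ≠ x → f y ≠ y →
      D.defect x y + D.defect x (f y) + D.defect (f x) y + D.defect (f x) (f y) = 4) :
    ∃ φ : V → Fin 5, (∀ i, φ (c i) = i) ∧ (∀ x, f x ≠ x → fiveAdj (φ x) (φ (f x))) ∧
      (∀ x y, D.defect x y = if fiveAdj (φ x) (φ y) then 2 else 0) ∧
      ∀ x y, f x ≠ x → f y ≠ y → fiveMeet (φ x) (φ (f x)) (φ y) (φ (f y)) := by
  have n : ∀ {i j : Fin 5}, i ≠ j → c i ≠ c j := fun e => h.inj.ne e
  -- the cycle has no chords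
  have hchord : ∀ i, D.defect (c i) (c (i + 2)) = 0 := by
    intro i
    rw [defect_eq_zero]
    intro hu
    have hadj := h.adj (i + 1)
    rw [add_assoc, show (1 : Fin 5) + 1 = 2 from rfl] at hadj
    refine hno _ _ _ (h.adj i) hadj hu (h.isCoMatched.join (h.adj (i + 3)) ⟨_, rfl⟩ ⟨_, rfl⟩ ?_)
    intro w
    rw [add_assoc i, show (3 : Fin 5) + 1 = 4 from rfl]
    simp only [Set.mem_insert_iff, Set.mem_singleton_iff]
    constructor
    · rintro (rfl | rfl | rfl)
      · exact ⟨⟨_, rfl⟩, n (by simp), n (by simp)⟩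
      · exact ⟨⟨_, rfl⟩, n (by simp), n (by simp)⟩
      · exact ⟨⟨_, rfl⟩, n (by simp), n (by simp)⟩
    · rintro ⟨⟨t, rfl⟩, e1, e2⟩
      have e1' : t ≠ i + 3 := fun e => e1 (by rw [e])
      have e2' : t ≠ i + 4 := fun e => e2 (by rw [e])
      have := (show ∀ i t : Fin 5, t ≠ i + 3 → t ≠ i + 4 → t = i ∨ t = i + 1 ∨ t = i + 2 by decide)
        i t e1' e2'
      rcases this with rfl | rfl | rfl <;> simp
  have hcc : ∀ i t, D.defect (c t) (c i) = if fiveAdj t i then 2 else 0 := by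
    intro i t
    have hedge : ∀ i, D.defect (c i) (c (i + 1)) = 2 := fun i => by
      have := h1 i
      have := hchord i
      omega
    rcases (show ∀ i t : Fin 5, t = i ∨ t = i + 1 ∨ i = t + 1 ∨ t = i + 2 ∨ i = t + 2 by decide) i t
      with rfl | rfl | rfl | rfl | rfl
    · rw [defect_self, fiveAdj_self]; rfl
    · rw [D.defect_comm, hedge, if_pos (by simp [fiveAdj])]
    · rw [hedge, if_pos (by simp [fiveAdj])]
    · rw [D.defect_comm, hchord, if_neg]
      rw [(show ∀ i, fiveAdj (i + 2) i = false by decide) i]; simp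
    · rw [hchord, if_neg]
      rw [(show ∀ i, fiveAdj i (i + 2) = false by decide) t]; simp
  have hex : ∀ x, ∃ j, (∀ i, x = c i → j = i) ∧
      (∀ t, D.defect (c t) x = if fiveAdj t j then 2 else 0) := by
    intro x
    by_cases hx : f x = x
    · obtain ⟨i, rfl⟩ := (h.fix x).1 hx
      exact ⟨i, fun j e => h.inj e, hcc i⟩
    · obtain ⟨j, j', -, hh⟩ := h.exists_positions hD hno hx (h2 x hx)
      refine ⟨j, fun i e => absurd e.symm (h.ne hx i), fun t => ?_⟩
      rw [(hh t).1, fiveAdj_comm]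
      simp only [fiveAdj_iff]
  choose φ hφc hφ using hex
  have hinj : ∀ j j' : Fin 5, (∀ t, fiveAdj t j = fiveAdj t j') → j = j' := by decide
  have hfx : ∀ x, f x ≠ x → fiveAdj (φ x) (φ (f x)) := by
    intro x hx
    obtain ⟨j, j', hj, hh⟩ := h.exists_positions hD hno hx (h2 x hx)
    have aux : ∀ {y j}, (∀ t, D.defect (c t) y = if t = j - 1 ∨ t = j + 1 then 2 else 0) →
        φ y = j := by
      intro y j hy
      refine hinj _ _ fun t => ?_
      have := hφ y t
      rw [hy t, fiveAdj_comm] at this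
      rw [fiveAdj_comm t, fiveAdj_comm t, Bool.eq_iff_iff, fiveAdj_iff, fiveAdj_iff]
      simp only [fiveAdj_iff] at this
      by_cases e1 : t = j - 1 ∨ t = j + 1 <;> by_cases e2 : t = φ y - 1 ∨ t = φ y + 1
      · exact iff_of_true e2 e1
      · rw [if_pos e1, if_neg e2] at this; omega
      · rw [if_neg e1, if_pos e2] at this; omega
      · exact iff_of_false e2 e1
    rw [aux fun t => (hh t).1, aux fun t => (hh t).2]
    simpa [fiveAdj] using hj
  have hφU : ∀ x t, D.Unlinked (c t) x ↔ fiveAdj t (φ x) := fun x t => by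
    rw [← defect_pos, hφ]; split_ifs with e <;> simp [e]
  have hpos : ∀ {x y}, f x ≠ x → f y ≠ y → 0 < D.defect x y → fiveAdj (φ x) (φ y) := by
    intro x y hx hy hxy
    by_contra hc
    exact h.not_unlinked_of_positions hno hφU hfx hx hy (by simpa using hc) (defect_pos.1 hxy)
  have hf2 : ∀ {x}, f x ≠ x → f (f x) ≠ f x := fun hx e => hx (f.injective e)
  -- as the five-cycle has no triangles, two of the four summands vanish
  have hboth : ∀ {x y}, f x ≠ x → f y ≠ y → fiveAdj (φ x) (φ y) →
      D.defect x y = 2 ∧ D.defect (f x) (f y) = 2 := by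
    intro x y hx hy hxy
    have e := h3 x y hx hy
    have z1 : D.defect x (f y) = 0 := by
      by_contra hc
      have a1 := hpos hx (hf2 hy) (Nat.pos_of_ne_zero hc)
      have := fiveAdj_triangle _ _ _ hxy a1
      rw [hfx y hy] at this; simp at this
    have z2 : D.defect (f x) y = 0 := by
      by_contra hc
      have a1 := hpos (hf2 hx) hy (Nat.pos_of_ne_zero hc)
      have := fiveAdj_triangle _ _ _ hxy (hfx x hx)
      rw [fiveAdj_comm, a1] at this; simp at this
    have := D.defect_le_two x y
    have := D.defect_le_two (f x) (f y)
    omega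
  refine ⟨φ, fun i => hφc _ i rfl, hfx, fun x y => ?_, fun x y hx hy => ?_⟩
  · by_cases hx : f x = x
    · obtain ⟨i, rfl⟩ := (h.fix x).1 hx
      rw [hφ, hφc _ i rfl]
    by_cases hy : f y = y
    · obtain ⟨i, rfl⟩ := (h.fix y).1 hy
      rw [D.defect_comm, hφ, hφc _ i rfl, fiveAdj_comm]
    split_ifs with e
    · exact (hboth hx hy e).1
    · by_contra hc
      exact e (hpos hx hy (Nat.pos_of_ne_zero hc))
  · have e := h3 x y hx hy
    have key : ∀ {x y}, f x ≠ x → f y ≠ y → 0 < D.defect x y →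
        fiveAdj (φ x) (φ y) ∧ fiveAdj (φ (f x)) (φ (f y)) := fun hx hy hxy => by
      have a := hpos hx hy hxy
      exact ⟨a, hpos (hf2 hx) (hf2 hy) (by rw [(hboth hx hy a).2]; simp)⟩
    have k1 := key hx hy
    have k2 := key hx (hf2 hy)
    have k3 := key (hf2 hx) hy
    have k4 := key (hf2 hx) (hf2 hy)
    simp only [h.pairing.inv] at k2 k3 k4
    simp only [fiveMeet, Bool.or_eq_true, Bool.and_eq_true]
    by_cases c1 : 0 < D.defect x y
    · exact Or.inl (k1 c1)
    by_cases c2 : 0 < D.defect x (f y)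
    · exact Or.inr (k2 c2)
    by_cases c3 : 0 < D.defect (f x) y
    · exact Or.inr (k3 c3).symm
    · exact Or.inl (k4 (by omega)).symm

/-- A digraph whose unlinked pairs form a blow-up of the five-cycle, with all vertices off the five-cycle at or next to
one position, comes from a Dirac–Gallai graph. -/
theorem IsFiveCycle.isDiracGallaiDigraph (h : D.IsFiveCycle f c) (hloop : D.IsLoopless) {p : ℕ}
    (hp : Fintype.card V = 2 * p + 1) (hp2 : 2 ≤ p) {φ : V → Fin 5} (hφc : ∀ i, φ (c i) = i)
    (hφ : ∀ x y, D.defect x y = if fiveAdj (φ x) (φ y) then 2 else 0) {i : Fin 5}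
    (hat : ∀ x, f x ≠ x → fiveAt i (φ x) (φ (f x))) : D.IsDiracGallaiDigraph (p + 1) := by
  have hU : ∀ x y, D.Unlinked x y ↔ fiveAdj (φ x) (φ y) := fun x y => by
    rw [← defect_pos, hφ]; split_ifs with e <;> simp [e]
  have hout : ∀ x, f x ≠ x → φ x = i + 2 ∨ φ x = i + 3 ∨ φ x = i + 4 := fun x hx => by
    have := hat x hx
    simp only [fiveAt, Bool.or_eq_true, Bool.and_eq_true, beq_iff_eq] at this
    tauto
  have huniq : ∀ x j, (j = i ∨ j = i + 1) → φ x = j → x = c j := by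
    intro x j hj hx
    by_cases hfx : f x = x
    · obtain ⟨t, rfl⟩ := (h.fix x).1 hfx
      rw [hφc] at hx; rw [hx]
    · exfalso
      have h1 := hout x hfx
      rw [hx] at h1
      exact (show ∀ i j : Fin 5, (j = i ∨ j = i + 1) → ¬ (j = i + 2 ∨ j = i + 3 ∨ j = i + 4) by decide)
        i j hj h1
  have hcase : ∀ x, φ x = i ∨ φ x = i + 1 ∨ φ x = i + 2 ∨ φ x = i + 3 ∨ φ x = i + 4 := fun x =>
    (show ∀ i j : Fin 5, j = i ∨ j = i + 1 ∨ j = i + 2 ∨ j = i + 3 ∨ j = i + 4 by decide) i (φ x)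
  have hne : ∀ a b : Fin 5, a ≠ b → i + a ≠ i + b := fun a b hab e => hab (add_left_cancel e)
  have hadjt : ∀ a b, fiveAdj (i + a) (i + b) = fiveAdj a b :=
    fun a b => (show ∀ i a b, fiveAdj (i + a) (i + b) = fiveAdj a b by decide) i a b
  -- adjacency in the underlying graph
  let G : SimpleGraph V :=
    { Adj := fun x y => x ≠ y ∧ ¬ D.Unlinked x y
      symm := ⟨fun x y hxy => ⟨hxy.1.symm, fun hu => hxy.2 hu.symm⟩⟩
      loopless := ⟨fun x hx => hx.1 rfl⟩ }
  have hG : ∀ x y, G.Adj x y ↔ x ≠ y ∧ fiveAdj (φ x) (φ y) = false := fun x y => by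
    change (x ≠ y ∧ ¬ D.Unlinked x y) ↔ _
    rw [hU, Bool.not_eq_true]
  refine Or.inr ⟨by omega, G, ?_, ?_⟩
  swap
  · apply Digraph.ext
    funext x y
    apply propext
    change D.Adj x y ↔ x ≠ y ∧ ¬ D.Unlinked x y
    have hd := hφ x y
    have hd' := hU x y
    constructor
    · intro hxy
      have hne : x ≠ y := fun e => hloop x (by rw [e] at hxy ⊢; exact hxy)
      refine ⟨hne, fun hu => ?_⟩
      rw [if_pos (hd'.1 hu)] at hd
      have h0 : D.missingArc x y = 0 := by unfold missingArc; rw [if_neg (by tauto)]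
      have h1 : D.missingArc y x ≤ 1 := by unfold missingArc; split_ifs <;> simp
      unfold defect at hd
      omega
    · rintro ⟨hne, hu⟩
      by_contra hxy
      exact hu ⟨hne, fun e => hxy e.1⟩
  obtain ⟨k, hk, hkfix, k1, k2, hkf⟩ := h.exists_isPairing (i + 4)
  rw [add_assoc, add_assoc] at k1 k2
  simp only [show (4 : Fin 5) + 1 = 0 from rfl, show (4 : Fin 5) + 2 = 1 from rfl,
    show (4 : Fin 5) + 3 = 2 from rfl, show (4 : Fin 5) + 4 = 3 from rfl, add_zero] at k1 k2
  set X := {x | φ x = i + 3} with hX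
  set Y₁ := {x | φ x = i + 2} with hY₁
  set Y₂ := {x | φ x = i + 4} with hY₂
  have hYY : Disjoint Y₁ Y₂ := Set.disjoint_left.2 fun x h1 h2 =>
    hne 2 4 (by decide) (h1.symm.trans h2)
  -- the matching missing `c (i + 4)` exchanges the two sides
  have hYcard : (Y₁ ∪ Y₂).ncard = X.ncard + 1 := by
    have hmem : c (i + 4) ∈ Y₁ ∪ Y₂ := Or.inr (hφc _)
    have himg : (Y₁ ∪ Y₂) \ {c (i + 4)} = k '' X := by
      have kin : ∀ x, f x = x → x ≠ c (i + 4) → φ x = i + 2 ∨ φ x = i + 3 ∨ φ x = i + 4 →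
          x = c (i + 2) ∨ x = c (i + 3) := by
        intro x hx hx4 hx'
        obtain ⟨t, rfl⟩ := (h.fix x).1 hx
        rw [hφc] at hx'
        rcases hx' with rfl | rfl | rfl
        · simp
        · simp
        · exact absurd rfl hx4
      have k2' : k (c (i + 3)) = c (i + 2) := by rw [← k2, hk.inv]
      ext y
      simp only [Set.mem_sdiff, Set.mem_singleton_iff, Set.mem_image]
      constructor
      · rintro ⟨hy, hy4⟩
        refine ⟨k y, ?_, hk.inv y⟩
        by_cases hfy : f y = y
        · rcases kin y hfy hy4 (by rcases hy with hy | hy; exacts [Or.inl hy, Or.inr (Or.inr hy)])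
            with rfl | rfl
          · rw [k2]; exact hφc _
          · rcases hy with hy | hy
            · exact absurd ((hφc _).symm.trans hy) (hne 3 2 (by decide))
            · exact absurd ((hφc _).symm.trans hy) (hne 3 4 (by decide))
        · rw [hkf y hfy]
          have := hat y hfy
          simp only [fiveAt, Bool.or_eq_true, Bool.and_eq_true, beq_iff_eq] at this
          rcases this with ⟨h1, -⟩ | ⟨h1, -⟩
          · rcases hy with hy | hy
            · exact absurd (h1.symm.trans hy) (hne 3 2 (by decide))
            · exact absurd (h1.symm.trans hy) (hne 3 4 (by decide))
          · exact h1
      · rintro ⟨x, hx, rfl⟩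
        have hx4 : x ≠ c (i + 4) := fun e => by
          rw [e] at hx
          exact hne 4 3 (by decide) ((hφc _).symm.trans hx)
        refine ⟨?_, fun e => hx4 ?_⟩
        · by_cases hfx : f x = x
          · rcases kin x hfx hx4 (Or.inr (Or.inl hx)) with rfl | rfl
            · exact absurd ((hφc _).symm.trans hx) (hne 2 3 (by decide))
            · rw [k2']; exact Or.inl (hφc _)
          · rw [hkf x hfx]
            have := hat x hfx
            simp only [fiveAt, Bool.or_eq_true, Bool.and_eq_true, beq_iff_eq] at this
            rcases this with ⟨-, h1⟩ | ⟨-, h1⟩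
            · exact h1
            · rcases h1 with h1 | h1
              · exact absurd (h1.symm.trans hx) (hne 2 3 (by decide))
              · exact absurd (h1.symm.trans hx) (hne 4 3 (by decide))
        · exact (k.injective (e.trans ((hkfix _).2 rfl).symm))
    have := Set.ncard_image_of_injective X k.injective
    rw [← himg, Set.ncard_sdiff_singleton_of_mem hmem] at this
    have h0 : 0 < (Y₁ ∪ Y₂).ncard := (Set.ncard_pos).2 ⟨_, hmem⟩
    omega
  have hcover : X ∪ Y₁ ∪ Y₂ ∪ {c i, c (i + 1)} = Set.univ := by
    rw [Set.eq_univ_iff_forall]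
    intro x
    simp only [Set.mem_union, Set.mem_insert_iff, Set.mem_singleton_iff, hX, hY₁, hY₂,
      Set.mem_ofPred_eq]
    rcases hcase x with e | e | e | e | e
    · exact Or.inr (Or.inl (huniq x _ (Or.inl rfl) e))
    · exact Or.inr (Or.inr (huniq x _ (Or.inr rfl) e))
    all_goals simp [e]
  have hv1 : c i ∉ X ∪ Y₁ ∪ Y₂ := by
    rintro ((e | e) | e) <;> have e := (hφc i).symm.trans e <;> simp at e
  have hv2 : c (i + 1) ∉ X ∪ Y₁ ∪ Y₂ := by
    rintro ((e | e) | e) <;> have e := (hφc (i + 1)).symm.trans e <;> simp at e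
  have hXY : Disjoint X (Y₁ ∪ Y₂) := Set.disjoint_left.2 fun x h1 h2 => by
    rcases h2 with h2 | h2
    · exact hne 3 2 (by decide) (h1.symm.trans h2)
    · exact hne 3 4 (by decide) (h1.symm.trans h2)
  have hvv : c i ≠ c (i + 1) := (h.adj i).1
  have hsum : Y₁.ncard + Y₂.ncard = X.ncard + 1 := by rw [← hYcard, Set.ncard_union_eq hYY]
  refine ⟨X, Y₁, Y₂, c i, c (i + 1), ⟨c (i + 3), hφc _⟩, ⟨c (i + 2), hφc _⟩, ⟨c (i + 4), hφc _⟩,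
    hXY.mono_right Set.subset_union_left, hXY.mono_right Set.subset_union_right, hYY,
    hvv, hv1, hv2, hcover, hsum, ?_, ?_, ?_, ?_, ?_, ?_⟩
  · have e1 : (X ∪ (Y₁ ∪ Y₂) ∪ {c i, c (i + 1)}).ncard = 2 * p + 1 := by
      rw [← Set.union_assoc, hcover, Set.ncard_univ, Nat.card_eq_fintype_card, hp]
    rw [Set.ncard_union_eq, Set.ncard_union_eq hXY, hYcard, Set.ncard_pair hvv] at e1
    · omega
    · rw [← Set.union_assoc, Set.disjoint_left]
      rintro x hx (rfl | rfl)
      exacts [hv1 hx, hv2 hx]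
  · intro x hx y hy hxy
    have e1 : φ x = i + 3 := hx
    have e2 : φ y = i + 3 := hy
    rw [hG, e1, e2]
    exact ⟨hxy, fiveAdj_self _⟩
  · intro x hx y hy hxy
    rw [hG]
    refine ⟨hxy, ?_⟩
    have e1 : φ x = i + 2 ∨ φ x = i + 4 := hx
    have e2 : φ y = i + 2 ∨ φ y = i + 4 := hy
    rcases e1 with e1 | e1 <;> rcases e2 with e2 | e2 <;> rw [e1, e2, hadjt] <;> rfl
  · intro x hx y hy hxy
    rw [hG] at hxy
    have e1 : φ x = i + 3 := hx
    have e2 : φ y = i + 2 ∨ φ y = i + 4 := hy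
    have := hxy.2
    rcases e2 with e2 | e2 <;> rw [e1, e2, hadjt] at this <;> exact absurd this (by decide)
  · ext y
    rw [SimpleGraph.mem_neighborSet, hG, hφc]
    have e1 : y ∈ X ∪ Y₁ ↔ φ y = i + 3 ∨ φ y = i + 2 := Iff.rfl
    rw [e1]
    constructor
    · rintro ⟨h1, h2⟩
      rcases hcase y with e | e | e | e | e
      · exact absurd (huniq y _ (Or.inl rfl) e).symm h1
      · have := hadjt 0 1
        rw [add_zero] at this
        rw [e, this] at h2; exact absurd h2 (by decide)
      · exact Or.inr e
      · exact Or.inl e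
      · have := hadjt 0 4
        rw [add_zero] at this
        rw [e, this] at h2; exact absurd h2 (by decide)
    · intro e
      refine ⟨fun e' => ?_, ?_⟩
      · rw [← e', hφc] at e; simp at e
      · have h3 := hadjt 0 3
        have h2 := hadjt 0 2
        rw [add_zero] at h2 h3
        rcases e with e | e <;> rw [e]
        exacts [h3, h2]
  · ext y
    rw [SimpleGraph.mem_neighborSet, hG, hφc]
    have e1 : y ∈ X ∪ Y₂ ↔ φ y = i + 3 ∨ φ y = i + 4 := Iff.rfl
    rw [e1]
    constructor
    · rintro ⟨h1, h2⟩
      rcases hcase y with e | e | e | e | e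
      · have := hadjt 1 0
        rw [add_zero] at this
        rw [e, this] at h2; exact absurd h2 (by decide)
      · exact absurd (huniq y _ (Or.inr rfl) e).symm h1
      · rw [e, hadjt] at h2; exact absurd h2 (by decide)
      · exact Or.inl e
      · exact Or.inr e
    · intro e
      refine ⟨fun e' => ?_, ?_⟩
      · rw [← e', hφc] at e; simp at e
      · rcases e with e | e <;> rw [e, hadjt] <;> rfl

/-- The largest number of missing arcs in a `k`-critical digraph of order `k + p`, where `p ≤ k - 1`. -/
def maxMissing (p : ℕ) : ℕ := if p = 0 then 0 else if p = 1 then 3 else 2 * p ^ 2 + 2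

theorem maxMissing_zero : maxMissing 0 = 0 := rfl

theorem maxMissing_one : maxMissing 1 = 3 := rfl

theorem maxMissing_of_two_le {p : ℕ} (hp : 2 ≤ p) : maxMissing p = 2 * p ^ 2 + 2 := by
  unfold maxMissing; rw [if_neg (by omega), if_neg (by omega)]

/-- The extremal digraph for `p = 1` is the directed triangle. -/
theorem isDiracGallaiDigraph_two (hloop : D.IsLoopless) (hcard : Fintype.card V = 3) {x y z : V}
    (hxy : D.Unlinked x y) (hyz : D.Unlinked y z) (hxz : D.Unlinked x z)
    (hc : D.IsCyclicTriple x y z) : D.IsDiracGallaiDigraph 2 := by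
  have aux : ∀ x y z, D.Unlinked x y → D.Unlinked y z → D.Unlinked x z →
      (D.Adj x y ∧ D.Adj y z ∧ D.Adj z x) → D.IsDiracGallaiDigraph 2 := by
    intro x y z hxy hyz hxz hc
    have hinj : Function.Injective (![x, y, z] : ZMod 3 → V) := by
      have := hxy.1
      have := hyz.1
      have := hxz.1
      intro i j hij
      change Fin 3 at i j
      fin_cases i <;> fin_cases j <;> first | rfl | (exfalso; revert hij; dsimp; tauto)
    have hbij : Function.Bijective (![x, y, z] : ZMod 3 → V) :=
      (Fintype.bijective_iff_injective_and_card _).2 ⟨hinj, by rw [hcard]; rfl⟩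
    refine Or.inl ⟨rfl, ⟨(⟨Equiv.ofBijective _ hbij, ?_⟩ : (dirCycle 3).Adj ≃r D.Adj).symm⟩⟩
    have l1 := hloop x
    have l2 := hloop y
    have l3 := hloop z
    have n1 := hxy.2
    have n2 := hyz.2
    have n3 := hxz.2
    intro i j
    change Fin 3 at i j
    change D.Adj (![x, y, z] i) (![x, y, z] j) ↔ j = i + 1
    fin_cases i <;> fin_cases j <;> simp <;> tauto
  rcases hc with hc | hc
  · exact aux x y z hxy hyz hxz hc
  · exact aux z y x hyz.symm hxy.symm hxz.symm ⟨hc.2.1, hc.1, hc.2.2⟩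

/-- The bound for factor-critical digraphs, with the extremal ones. -/
theorem IsFactorCritical.missing_le_maxMissing (hD : D.IsFactorCritical) {p : ℕ}
    (hp : Fintype.card V = 2 * p + 1) (hp1 : 1 ≤ p) : D.missing Finset.univ ≤ maxMissing p ∧
      (D.IsLoopless → D.missing Finset.univ = maxMissing p → D.IsDiracGallaiDigraph (p + 1)) := by
  have hmax : 2 * p ^ 2 + 1 ≤ maxMissing p := by
    rcases (show p = 1 ∨ 2 ≤ p by omega) with rfl | h
    · simp [maxMissing_one]
    · rw [maxMissing_of_two_le h]; omega
  by_cases hlow : ∀ v, ∑ x, D.defect v x ≠ 2 * p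
  · have := hD.missing_lt_of_forall_lt hp hlow
    exact ⟨by omega, fun _ h => by omega⟩
  push Not at hlow
  obtain ⟨v, hv⟩ := hlow
  obtain ⟨f, hf, hfv⟩ := hD.erase v
  simp only [Set.mem_singleton_iff] at hfv
  by_cases hI : ∀ x, ¬ (D.Unlinked v x ∧ D.Unlinked v (f x))
  · obtain ⟨g, c, h, hc0, -, -, -⟩ := hD.exists_isFiveCycle hp hp1 hv hf hfv hI
    obtain ⟨hp2, hle, heq⟩ := h.missing_le hD hp (by rwa [hc0])
    rw [maxMissing_of_two_le hp2]
    refine ⟨hle, fun hloop hM => ?_⟩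
    have hno := fun x y z h1 h2 h3 =>
      hD.not_isCoMatched_triangle hp hp1 hM hv (x := x) (y := y) (z := z) h1 h2 h3
    obtain ⟨h1, h2, h3⟩ := heq hM
    obtain ⟨φ, p1, p2, p3, p4⟩ := h.exists_position hD hno (fun i => (h1 i).1) h2 h3
    obtain ⟨k, hk, hkfix, -, -, hkf⟩ := h.exists_isPairing 0
    have hlow : ∀ x, g x ≠ x → fiveLow (φ x) (φ (g x)) := by
      intro x hx
      have := (hD.sum_defect_le hp v).2 hv k hk (fun w => by rw [hkfix, hc0]) x
        (fun e => h.ne hx 0 (hc0.trans e.symm))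
      rw [hkf x hx, ← hc0, p3, p3, p1] at this
      have h2 := p2 x hx
      unfold fiveLow
      revert this h2
      generalize φ x = a
      generalize φ (g x) = b
      revert a b
      decide
    obtain ⟨i, hi⟩ : ∃ i, ∀ x, g x ≠ x → fiveAt i (φ x) (φ (g x)) := by
      by_cases h2 : ∀ x, g x ≠ x → fiveAt 2 (φ x) (φ (g x))
      · exact ⟨2, h2⟩
      push Not at h2
      obtain ⟨x, hx, hx2⟩ := h2
      have key := fun y hy => fiveAt_of_fiveMeet _ _ _ _ (hlow x hx) (hlow y hy) (p4 x y hx hy)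
        (by simpa using hx2)
      have hex := fiveAt_of_fiveLow _ _ (hlow x hx)
      simp only [Bool.or_eq_true, Bool.and_eq_true] at key
      by_cases h1 : fiveAt 1 (φ x) (φ (g x))
      · refine ⟨1, fun y hy => ?_⟩
        rcases key y hy with hh | hh
        · exact hh.2
        · rw [h1, hh.1] at hex; simp at hex
      · refine ⟨3, fun y hy => ?_⟩
        rcases key y hy with hh | hh
        · exact absurd hh.1 h1
        · exact hh.2
    exact h.isDiracGallaiDigraph hloop hp hp2 p1 p3 hi
  · push Not at hI
    obtain ⟨a, hva, hvb⟩ := hI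
    have hle := hD.missing_le_of_triangle hp hv hf hfv hva hvb
    refine ⟨by omega, fun hloop hM => ?_⟩
    rcases (show p = 1 ∨ 2 ≤ p by omega) with rfl | h
    · exact isDiracGallaiDigraph_two hloop hp hva
        (hf.adj a fun e => hva.1 ((hfv a).1 e).symm) hvb
        ((hD.pair hf hfv hva.1.symm).2 hva hvb).1
    · rw [maxMissing_of_two_le h] at hM; omega

end Structure

/-! ### Acyclic sets of vertices -/

section AcyclicOn

variable {V : Type u} {W : Type v} {D : Digraph V}

/-- No directed cycle has all its vertices in `Q`. -/
def IsAcyclicOn (D : Digraph V) (Q : Set V) : Prop :=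
  ¬ ∃ n : ℕ, 2 ≤ n ∧ ∃ f : ZMod n → V, Function.Injective f ∧ (∀ i, f i ∈ Q) ∧
    ∀ i, D.Adj (f i) (f (i + 1))

theorem isAcyclic_induced {Q : Set V} : (D.induced Q).IsAcyclic ↔ D.IsAcyclicOn Q := by
  refine not_congr ⟨?_, ?_⟩
  · rintro ⟨n, hn, f, hf, h⟩
    exact ⟨n, hn, fun i => f i, fun i j e => hf (Subtype.ext e), fun i => (f i).2,
      fun i => h i (i + 1) rfl⟩
  · rintro ⟨n, hn, f, hf, hQ, h⟩
    refine ⟨n, hn, fun i => ⟨f i, hQ i⟩, fun i j e => hf (congrArg Subtype.val e), ?_⟩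
    rintro i j hj
    obtain rfl : j = i + 1 := hj
    exact h i

theorem IsAcyclicOn.mono {Q Q' : Set V} (h : D.IsAcyclicOn Q) (hQ : Q' ⊆ Q) : D.IsAcyclicOn Q' := by
  rintro ⟨n, hn, f, hf, h1, h2⟩
  exact h ⟨n, hn, f, hf, fun i => hQ (h1 i), h2⟩

theorem zmod_add_one_ne {n : ℕ} (hn : 2 ≤ n) (i : ZMod n) : i + 1 ≠ i := by
  have : Fact (1 < n) := ⟨hn⟩
  simp

/-- A vertex without out-neighbours in an acyclic set can be added to it. -/
theorem IsAcyclicOn.insert {Q : Set V} (h : D.IsAcyclicOn Q) {x : V}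
    (hx : ∀ y ∈ Q, ¬ D.Adj x y) : D.IsAcyclicOn (insert x Q) := by
  rintro ⟨n, hn, f, hf, h1, h2⟩
  by_cases hxf : ∃ i, f i = x
  · obtain ⟨i, rfl⟩ := hxf
    rcases h1 (i + 1) with hi | hi
    · exact zmod_add_one_ne hn i (hf hi)
    · exact hx _ hi (h2 i)
  · push Not at hxf
    exact h ⟨n, hn, f, hf, fun i => (h1 i).resolve_left (hxf i), h2⟩

theorem isAcyclicOn_empty : D.IsAcyclicOn ∅ := by
  rintro ⟨n, -, f, -, h1, -⟩
  exact h1 0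

theorem isAcyclicOn_singleton (x : V) : D.IsAcyclicOn {x} := by
  have := (isAcyclicOn_empty (D := D)).insert (x := x) (by simp)
  simpa using this

theorem Unlinked.isAcyclicOn {x y : V} (h : D.Unlinked x y) : D.IsAcyclicOn {x, y} := by
  by_cases hxy : D.Adj x y
  · rw [Set.pair_comm]
    exact (isAcyclicOn_singleton x).insert (by rintro _ rfl h'; exact h.2 ⟨hxy, h'⟩)
  · exact (isAcyclicOn_singleton y).insert (by rintro _ rfl; exact hxy)

theorem IsAcyclicOn.unlinked {Q : Set V} (h : D.IsAcyclicOn Q) {x y : V} (hx : x ∈ Q) (hy : y ∈ Q)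
    (hxy : x ≠ y) : D.Unlinked x y := by
  refine ⟨hxy, fun ha => h ⟨2, le_rfl, (![x, y] : Fin 2 → V), ?_, ?_, ?_⟩⟩
  · intro i j hij
    change Fin 2 at i j
    fin_cases i <;> fin_cases j <;> first | rfl | exact absurd hij hxy | exact absurd hij hxy.symm
  · intro i
    change Fin 2 at i
    fin_cases i
    exacts [hx, hy]
  · intro i
    change Fin 2 at i
    fin_cases i
    exacts [ha.1, ha.2]

theorem isCyclicTriple_of_not_isAcyclicOn {x y z : V} (hxy : D.Unlinked x y) (hyz : D.Unlinked y z)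
    (hxz : D.Unlinked x z) (h : ¬ D.IsAcyclicOn {x, y, z}) : D.IsCyclicTriple x y z := by
  have h1 : D.Adj x y ∨ D.Adj x z := by
    by_contra hc
    push Not at hc
    exact h (hyz.isAcyclicOn.insert (by rintro _ (rfl | rfl); exacts [hc.1, hc.2]))
  have h2 : D.Adj y x ∨ D.Adj y z := by
    by_contra hc
    push Not at hc
    refine h ((hxz.isAcyclicOn.insert (x := y) (by rintro _ (rfl | rfl); exacts [hc.1, hc.2])).mono ?_)
    rintro _ (rfl | rfl | rfl) <;> simp
  have h3 : D.Adj z x ∨ D.Adj z y := by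
    by_contra hc
    push Not at hc
    refine h ((hxy.isAcyclicOn.insert (x := z) (by rintro _ (rfl | rfl); exacts [hc.1, hc.2])).mono ?_)
    rintro _ (rfl | rfl | rfl) <;> simp
  have n1 := hxy.2
  have n2 := hyz.2
  have n3 := hxz.2
  unfold IsCyclicTriple
  tauto

/-- A vertex set can be covered by at most `m` acyclic sets. -/
abbrev AcyclicCover (D : Digraph V) (S : Finset V) (m : ℕ) : Prop :=
  IsCoverable (fun Q : Finset V => D.IsAcyclicOn (Q : Set V)) S m

theorem acyclic_mono (D : Digraph V) : ∀ Q Q' : Finset V, Q' ⊆ Q → D.IsAcyclicOn (Q : Set V) →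
    D.IsAcyclicOn (Q' : Set V) := fun _ _ h hQ => hQ.mono (by exact_mod_cast h)

theorem acyclic_singleton (D : Digraph V) : ∀ x, D.IsAcyclicOn (({x} : Finset V) : Set V) :=
  fun x => by simpa using isAcyclicOn_singleton x

theorem acyclic_pair (D : Digraph V) : ∀ x y, D.Unlinked x y →
    D.IsAcyclicOn (({x, y} : Finset V) : Set V) :=
  fun x y h => by simpa using h.isAcyclicOn

theorem acyclicCover_card (D : Digraph V) (S : Finset V) : D.AcyclicCover S S.card := by
  refine ⟨S.image fun x => {x}, Finset.card_image_le, fun Q hQ => ?_, fun x hx =>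
    ⟨{x}, Finset.mem_image_of_mem _ hx, by simp⟩⟩
  obtain ⟨x, -, rfl⟩ := Finset.mem_image.1 hQ
  exact acyclic_singleton D x

/-- An induced subdigraph that needs `k` acyclic sets, but not after the deletion of a vertex. -/
structure IsVertexCritical (D : Digraph V) (S : Finset V) (k : ℕ) : Prop where
  cover : D.AcyclicCover S k
  minimal : ∀ m, D.AcyclicCover S m → k ≤ m
  erase : ∀ x ∈ S, ∃ m, m < k ∧ D.AcyclicCover (S.erase x) m

theorem IsVertexCritical.le_card {S : Finset V} {k : ℕ} (h : D.IsVertexCritical S k) : k ≤ S.card :=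
  h.minimal _ (acyclicCover_card D S)

/-- In a vertex-critical digraph each vertex has at least `k - 1` out-neighbours. -/
theorem IsVertexCritical.sum_missingArc_le {S : Finset V} {k : ℕ} (h : D.IsVertexCritical S k) {x : V}
    (hx : x ∈ S) : ∑ y ∈ S, D.missingArc x y + k ≤ S.card := by
  obtain ⟨m, hm, hc⟩ := h.erase x hx
  obtain ⟨φ, h1, h2⟩ := hc.exists_partition (acyclic_mono D)
  set T := S.erase x with hT
  set O := T.filter fun y => D.Adj x y with hO
  -- the classes of the partition
  have hcl : D.AcyclicCover T (T.image φ).card := by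
    refine ⟨(T.image φ).image fun Q => T.filter fun y => φ y = Q, Finset.card_image_le,
      fun Q hQ => ?_, fun y hy => ⟨T.filter fun z => φ z = φ y, ?_, by simpa using hy⟩⟩
    · obtain ⟨R, hR, rfl⟩ := Finset.mem_image.1 hQ
      exact h2 R hR
    · exact Finset.mem_image_of_mem _ (Finset.mem_image_of_mem _ hy)
  have hk : k ≤ (T.image φ).card + 1 := by
    refine h.minimal _ ((hcl.union (isCoverable_one (acyclic_singleton D x))).mono ?_ le_rfl)
    rw [hT]
    intro y hy
    by_cases hyx : y = x <;> simp [hyx, hy]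
  have hsub : T.image φ ⊆ O.image φ := by
    intro Q hQ
    by_contra hno
    refine absurd (h.minimal m ?_) (by omega)
    refine ⟨(T.image φ).image fun R => if R = Q then insert x (T.filter fun y => φ y = R) else
      T.filter fun y => φ y = R, Finset.card_image_le.trans h1, fun R hR => ?_, fun y hy => ?_⟩
    · obtain ⟨R, hR', rfl⟩ := Finset.mem_image.1 hR
      split_ifs with e
      · subst e
        rw [Finset.coe_insert]
        refine (h2 R hR').insert fun y hy hxy => hno ?_
        have hy' := Finset.mem_filter.1 (Finset.mem_coe.1 hy)
        exact Finset.mem_image.2 ⟨y, Finset.mem_filter.2 ⟨hy'.1, hxy⟩, hy'.2⟩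
      · exact h2 R hR'
    · by_cases hyx : y = x
      · refine ⟨_, Finset.mem_image_of_mem _ hQ, ?_⟩
        rw [if_pos rfl, hyx]; exact Finset.mem_insert_self _ _
      · have hyT : y ∈ T := Finset.mem_erase.2 ⟨hyx, hy⟩
        refine ⟨_, Finset.mem_image_of_mem _ (Finset.mem_image_of_mem φ hyT), ?_⟩
        have : y ∈ T.filter fun z => φ z = φ y := Finset.mem_filter.2 ⟨hyT, rfl⟩
        split_ifs
        exacts [Finset.mem_insert_of_mem this, this]
  have hO1 : (T.image φ).card ≤ O.card := (Finset.card_le_card hsub).trans Finset.card_image_le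
  have e1 : ∑ y ∈ S, D.missingArc x y = (T.filter fun y => ¬ D.Adj x y).card := by
    rw [Finset.card_filter, hT, ← Finset.sum_erase S (a := x) (by simp [missingArc])]
    refine Finset.sum_congr rfl fun y hy => ?_
    have := (Finset.ne_of_mem_erase hy).symm
    simp [missingArc, this]
  have e2 : O.card + (T.filter fun y => ¬ D.Adj x y).card = T.card :=
    Finset.card_filter_add_card_filter_not (s := T) (fun y => D.Adj x y)
  have e3 : T.card + 1 = S.card := Finset.card_erase_add_one hx
  omega

theorem IsVertexCritical.missing_le {S : Finset V} {k p : ℕ} (h : D.IsVertexCritical S k)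
    (hS : S.card = k + p) : D.missing S ≤ S.card * p := by
  unfold missing
  rw [← smul_eq_mul]
  refine Finset.sum_le_card_nsmul _ _ _ fun x hx => ?_
  have := h.sum_missingArc_le hx
  omega

/-- If all vertices of `S` are linked to all vertices of `T`, then a cover of the union splits. -/
theorem AcyclicCover.split {S T : Finset V} {m : ℕ} (h : D.AcyclicCover (S ∪ T) m)
    (hST : ∀ x ∈ S, ∀ y ∈ T, x ≠ y ∧ ¬ D.Unlinked x y) :
    ∃ a b, a + b ≤ m ∧ D.AcyclicCover S a ∧ D.AcyclicCover T b := by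
  obtain ⟨𝒬, h1, h2, h3⟩ := h
  refine ⟨(𝒬.filter fun Q => ∃ x ∈ S, x ∈ Q).card, (𝒬.filter fun Q => ¬ ∃ x ∈ S, x ∈ Q).card, ?_,
    ⟨_, le_rfl, fun Q hQ => h2 Q (Finset.mem_filter.1 hQ).1, fun x hx => ?_⟩,
    ⟨_, le_rfl, fun Q hQ => h2 Q (Finset.mem_filter.1 hQ).1, fun y hy => ?_⟩⟩
  · rw [Finset.card_filter_add_card_filter_not]; exact h1
  · obtain ⟨Q, hQ, hxQ⟩ := h3 x (Finset.mem_union_left _ hx)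
    exact ⟨Q, Finset.mem_filter.2 ⟨hQ, x, hx, hxQ⟩, hxQ⟩
  · obtain ⟨Q, hQ, hyQ⟩ := h3 y (Finset.mem_union_right _ hy)
    refine ⟨Q, Finset.mem_filter.2 ⟨hQ, ?_⟩, hyQ⟩
    rintro ⟨x, hx, hxQ⟩
    obtain ⟨hne, hl⟩ := hST x hx y hy
    exact hl ((h2 Q hQ).unlinked (Finset.mem_coe.2 hxQ) (Finset.mem_coe.2 hyQ) hne)

theorem exists_min_acyclicCover (D : Digraph V) (S : Finset V) :
    ∃ k, D.AcyclicCover S k ∧ ∀ m, D.AcyclicCover S m → k ≤ m := by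
  have h : ∃ m, D.AcyclicCover S m := ⟨_, acyclicCover_card D S⟩
  exact ⟨Nat.find h, Nat.find_spec h, fun m hm => Nat.find_min' h hm⟩

/-- The two sides of a complete two-way join are vertex-critical. -/
theorem IsVertexCritical.split {S T : Finset V} {k : ℕ} (h : D.IsVertexCritical (S ∪ T) k)
    (hST : ∀ x ∈ S, ∀ y ∈ T, x ≠ y ∧ ¬ D.Unlinked x y) :
    ∃ a b, a + b = k ∧ D.IsVertexCritical S a ∧ D.IsVertexCritical T b := by
  obtain ⟨a, ha, ha'⟩ := exists_min_acyclicCover D S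
  obtain ⟨b, hb, hb'⟩ := exists_min_acyclicCover D T
  have h1 := h.minimal _ (ha.union hb)
  obtain ⟨a', b', hab, h2, h3⟩ := AcyclicCover.split h.cover hST
  have := ha' _ h2
  have := hb' _ h3
  refine ⟨a, b, by omega, ⟨ha, ha', fun x hx => ?_⟩, ⟨hb, hb', fun x hx => ?_⟩⟩
  · obtain ⟨m, hm, hc⟩ := h.erase x (Finset.mem_union_left _ hx)
    have hxT : x ∉ T := fun hx' => (hST x hx x hx').1 rfl
    rw [Finset.erase_union_distrib, Finset.erase_eq_of_notMem hxT] at hc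
    obtain ⟨c, d, hcd, k1, k2⟩ := AcyclicCover.split hc
      fun y hy => hST y (Finset.mem_of_mem_erase hy)
    have := hb' _ k2
    exact ⟨c, by omega, k1⟩
  · obtain ⟨m, hm, hc⟩ := h.erase x (Finset.mem_union_right _ hx)
    have hxS : x ∉ S := fun hx' => (hST x hx' x hx).1 rfl
    rw [Finset.erase_union_distrib, Finset.erase_eq_of_notMem hxS] at hc
    obtain ⟨c, d, hcd, k1, k2⟩ := AcyclicCover.split hc
      fun y hy z hz => hST y hy z (Finset.mem_of_mem_erase hz)
    have := ha' _ k1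
    exact ⟨d, by omega, k2⟩

theorem missingArc_eq_zero_of_not_unlinked {x y : V} (h : ¬ D.Unlinked x y) : D.missingArc x y = 0 := by
  have := defect_eq_zero.2 h
  unfold defect at this; omega

theorem missing_union {S T : Finset V} (hST : ∀ x ∈ S, ∀ y ∈ T, x ≠ y ∧ ¬ D.Unlinked x y) :
    D.missing (S ∪ T) = D.missing S + D.missing T := by
  have hd : Disjoint S T := Finset.disjoint_left.2 fun x h1 h2 => (hST x h1 x h2).1 rfl
  unfold missing
  rw [Finset.sum_union hd]
  congr 1
  · refine Finset.sum_congr rfl fun x hx => ?_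
    rw [Finset.sum_union hd, Nat.add_eq_left]
    exact Finset.sum_eq_zero fun y hy => missingArc_eq_zero_of_not_unlinked (hST x hx y hy).2
  · refine Finset.sum_congr rfl fun x hx => ?_
    rw [Finset.sum_union hd, Nat.add_eq_right]
    exact Finset.sum_eq_zero fun y hy =>
      missingArc_eq_zero_of_not_unlinked fun h => (hST y hy x hx).2 h.symm

theorem not_unlinked_of_missing_eq_zero {S : Finset V} (h : D.missing S = 0) {x y : V} (hx : x ∈ S)
    (hy : y ∈ S) : ¬ D.Unlinked x y := by
  unfold missing at h
  rw [Finset.sum_eq_zero_iff] at h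
  have h1 := Finset.sum_eq_zero_iff.1 (h x hx) y hy
  have h2 := Finset.sum_eq_zero_iff.1 (h y hy) x hx
  rw [← defect_eq_zero, defect, h1, h2, add_zero]

end AcyclicOn

/-! ### Transfer along embeddings -/

section Transfer

variable {V : Type u} {W : Type v} {D : Digraph V} {E : Digraph W} {e : W ↪ V}

theorem isAcyclicOn_image (he : ∀ x y, E.Adj x y ↔ D.Adj (e x) (e y)) {Q : Set W} :
    D.IsAcyclicOn (e '' Q) ↔ E.IsAcyclicOn Q := by
  refine not_congr ⟨?_, ?_⟩
  · rintro ⟨n, hn, f, hf, h1, h2⟩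
    choose g hg hg' using h1
    refine ⟨n, hn, g, fun i j hij => hf (by rw [← hg' i, ← hg' j, hij]), hg, fun i => ?_⟩
    rw [he, hg', hg']; exact h2 i
  · rintro ⟨n, hn, f, hf, h1, h2⟩
    exact ⟨n, hn, fun i => e (f i), fun i j hij => hf (e.injective hij), fun i => ⟨_, h1 i, rfl⟩,
      fun i => (he _ _).1 (h2 i)⟩

theorem acyclicCover_map [Finite W] (he : ∀ x y, E.Adj x y ↔ D.Adj (e x) (e y)) {S : Finset W}
    {m : ℕ} : D.AcyclicCover (S.map e) m ↔ E.AcyclicCover S m := by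
  have := Fintype.ofFinite W
  constructor
  · rintro ⟨𝒬, h1, h2, h3⟩
    refine ⟨𝒬.image fun Q => Finset.univ.filter fun w => e w ∈ Q, Finset.card_image_le.trans h1,
      fun Q hQ => ?_, fun x hx => ?_⟩
    · obtain ⟨R, hR, rfl⟩ := Finset.mem_image.1 hQ
      rw [← isAcyclicOn_image he]
      refine (h2 R hR).mono ?_
      rintro _ ⟨w, hw, rfl⟩
      simpa using hw
    · obtain ⟨Q, hQ, hxQ⟩ := h3 (e x) (Finset.mem_map_of_mem _ hx)
      exact ⟨_, Finset.mem_image_of_mem _ hQ, by simpa using hxQ⟩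
  · rintro ⟨𝒬, h1, h2, h3⟩
    refine ⟨𝒬.image fun Q => Q.map e, Finset.card_image_le.trans h1, fun Q hQ => ?_, fun x hx => ?_⟩
    · obtain ⟨R, hR, rfl⟩ := Finset.mem_image.1 hQ
      rw [Finset.coe_map, isAcyclicOn_image he]
      exact h2 R hR
    · obtain ⟨y, hy, rfl⟩ := Finset.mem_map.1 hx
      obtain ⟨Q, hQ, hyQ⟩ := h3 y hy
      exact ⟨_, Finset.mem_image_of_mem _ hQ, Finset.mem_map_of_mem _ hyQ⟩

theorem isVertexCritical_map [Finite W] (he : ∀ x y, E.Adj x y ↔ D.Adj (e x) (e y)) {S : Finset W}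
    {k : ℕ} : D.IsVertexCritical (S.map e) k ↔ E.IsVertexCritical S k := by
  have h : ∀ {S m}, D.AcyclicCover (S.map e) m ↔ E.AcyclicCover S m := acyclicCover_map he
  constructor
  · rintro ⟨h1, h2, h3⟩
    refine ⟨h.1 h1, fun m hm => h2 m (h.2 hm), fun x hx => ?_⟩
    obtain ⟨m, hm, hc⟩ := h3 (e x) (Finset.mem_map_of_mem _ hx)
    rw [← Finset.map_erase, h] at hc
    exact ⟨m, hm, hc⟩
  · rintro ⟨h1, h2, h3⟩
    refine ⟨h.2 h1, fun m hm => h2 m (h.1 hm), fun x hx => ?_⟩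
    obtain ⟨y, hy, rfl⟩ := Finset.mem_map.1 hx
    obtain ⟨m, hm, hc⟩ := h3 y hy
    rw [← Finset.map_erase]
    exact ⟨m, hm, h.2 hc⟩

theorem missing_map (he : ∀ x y, E.Adj x y ↔ D.Adj (e x) (e y)) (S : Finset W) :
    D.missing (S.map e) = E.missing S := by
  unfold missing missingArc
  simp only [Finset.sum_map, he, ne_eq, e.injective.eq_iff]

theorem unlinked_map (he : ∀ x y, E.Adj x y ↔ D.Adj (e x) (e y)) {x y : W} :
    D.Unlinked (e x) (e y) ↔ E.Unlinked x y := by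
  unfold Unlinked
  simp only [he, ne_eq, e.injective.eq_iff]

end Transfer

/-! ### The bound for vertex-critical digraphs -/

theorem maxMissing_superadditive {p q : ℕ} (hp : 1 ≤ p) (hq : 1 ≤ q) :
    maxMissing p + maxMissing q < maxMissing (p + q) := by
  rw [maxMissing_of_two_le (p := p + q) (by omega)]
  rcases (show p = 1 ∨ 2 ≤ p by omega) with rfl | h <;>
  rcases (show q = 1 ∨ 2 ≤ q by omega) with rfl | h'
  · simp [maxMissing_one]
  · rw [maxMissing_one, maxMissing_of_two_le h']; nlinarith
  · rw [maxMissing_one, maxMissing_of_two_le h]; nlinarith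
  · rw [maxMissing_of_two_le h, maxMissing_of_two_le h']; nlinarith

theorem two_mul_sq_lt_maxMissing {p : ℕ} (hp : 1 ≤ p) : 2 * p ^ 2 < maxMissing p := by
  rcases (show p = 1 ∨ 2 ≤ p by omega) with rfl | h
  · simp [maxMissing_one]
  · rw [maxMissing_of_two_le h]; omega

section FactorCritical

variable {V : Type u} [Fintype V] {D : Digraph V}

/-- A vertex-critical digraph whose unlinked pairs form a connected graph is large, and factor-critical
in the smallest case. -/
theorem IsVertexCritical.card_ge_and_isFactorCritical {k : ℕ} (h : D.IsVertexCritical Finset.univ k)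
    (hconn : ∀ S : Finset V, S.Nonempty → (∀ x ∈ S, ∀ y, D.Unlinked x y → y ∈ S) → S = Finset.univ)
    {j : ℕ} (hj : k = j + 1) :
    2 * j + 1 ≤ Fintype.card V ∧ (Fintype.card V = 2 * j + 1 → D.IsFactorCritical) := by
  have hnot : ¬ D.AcyclicCover Finset.univ j := fun hc => by have := h.minimal _ hc; omega
  have key := card_ge_and_factorCritical (unlinked_symm D) (acyclic_singleton D) (acyclic_mono D)
    (acyclic_pair D) (fun Q hQ x hx y hy hxy => hQ.unlinked (by exact_mod_cast hx)
      (by exact_mod_cast hy) hxy) hnot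
    (fun a => by
      obtain ⟨m, hm, hc⟩ := h.erase a (Finset.mem_univ a)
      exact hc.mono subset_rfl (by omega)) hconn
  refine ⟨key.1, fun hcard => ⟨fun v => ?_, fun x y z hxy hyz hxz hC => ?_⟩⟩
  · obtain ⟨f, hf, hfv⟩ := key.2 hcard v
    exact ⟨f, hf, fun x => by rw [hfv]; rfl⟩
  · by_contra hno
    have hac : D.IsAcyclicOn (({x, y, z} : Finset V) : Set V) := by
      by_contra hc
      exact hno (isCyclicTriple_of_not_isAcyclicOn hxy hyz hxz (by simpa using hc))
    obtain ⟨f, hf, hfC⟩ := hC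
    have hmem : ∀ w, w ∈ (Finset.univ \ {x, y, z} : Finset V) ↔ f w ≠ w := fun w => by
      rw [Ne, hfC]; simp
    obtain ⟨m, hm, hc⟩ := isCoverable_of_pairing
      (F := fun Q : Finset V => D.IsAcyclicOn (Q : Set V)) (acyclic_singleton D) (acyclic_pair D) hf
      (T := Finset.univ \ {x, y, z}) (fun w hw => by
        rw [hmem] at hw ⊢; exact fun e => hw (f.injective e))
    have h0 : (unmatched (Finset.univ \ {x, y, z}) f).card = 0 := by
      rw [Finset.card_eq_zero, Finset.eq_empty_iff_forall_notMem]
      intro w hw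
      rw [mem_unmatched, hmem] at hw
      exact hw.1 hw.2
    have h3 : ({x, y, z} : Finset V).card = 3 :=
      Finset.card_eq_three.2 ⟨x, y, z, hxy.1, hxz.1, hyz.1, rfl⟩
    have h4 : (Finset.univ \ {x, y, z} : Finset V).card + 3 = 2 * j + 1 := by
      have := Finset.card_sdiff_add_card_eq_card (Finset.subset_univ ({x, y, z} : Finset V))
      rw [h3, Finset.card_univ, hcard] at this
      exact this
    refine hnot ((hc.union (isCoverable_one hac)).mono ?_ (by omega))
    rw [Finset.sdiff_union_of_subset (Finset.subset_univ _)]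

end FactorCritical

section Bound

variable {V : Type u} {D : Digraph V}

/-- The induced subdigraph on `S` is the join of a Dirac–Gallai digraph and a complete digraph. -/
def HasDiracGallaiCore (D : Digraph V) (S : Finset V) (p : ℕ) : Prop :=
  ∃ T ⊆ S, T.card = 2 * p + 1 ∧ (D.induced (T : Set V)).IsDiracGallaiDigraph (p + 1) ∧
    ∀ x ∈ S, x ∉ T → ∀ y ∈ S, ¬ D.Unlinked x y

/-- The case of a complete two-way join, by induction. -/
theorem IsVertexCritical.bound_of_split {S T : Finset V} {k p : ℕ}
    (h : D.IsVertexCritical (S ∪ T) k)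
    (hST : ∀ x ∈ S, ∀ y ∈ T, x ≠ y ∧ ¬ D.Unlinked x y) (hcard : (S ∪ T).card = k + p)
    (ih : ∀ A, A = S ∨ A = T → ∀ k p, D.IsVertexCritical A k → A.card = k + p →
      D.missing A ≤ maxMissing p ∧ (1 ≤ p → D.missing A = maxMissing p → D.HasDiracGallaiCore A p)) :
    D.missing (S ∪ T) ≤ maxMissing p ∧
      (1 ≤ p → D.missing (S ∪ T) = maxMissing p → D.HasDiracGallaiCore (S ∪ T) p) := by
  obtain ⟨a, b, hab, ha, hb⟩ := h.split hST
  have hd : Disjoint S T := Finset.disjoint_left.2 fun x h1 h2 => (hST x h1 x h2).1 rfl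
  rw [Finset.card_union_of_disjoint hd] at hcard
  rw [missing_union hST]
  obtain ⟨q, hq⟩ := Nat.exists_eq_add_of_le ha.le_card
  obtain ⟨r, hr⟩ := Nat.exists_eq_add_of_le hb.le_card
  obtain rfl : p = q + r := by omega
  obtain ⟨i1, i2⟩ := ih S (Or.inl rfl) a q ha hq
  obtain ⟨j1, j2⟩ := ih T (Or.inr rfl) b r hb hr
  rcases Nat.eq_zero_or_pos q with rfl | hq0
  · rw [maxMissing_zero] at i1
    rw [zero_add]
    refine ⟨by omega, fun hp heq => ?_⟩
    obtain ⟨U, hU, hUc, hUD, hUl⟩ := j2 hp (by omega)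
    refine ⟨U, hU.trans Finset.subset_union_right, hUc, hUD, fun x hx hxU y hy => ?_⟩
    rcases Finset.mem_union.1 hx with hx | hx <;> rcases Finset.mem_union.1 hy with hy | hy
    · exact not_unlinked_of_missing_eq_zero (by omega) hx hy
    · exact (hST x hx y hy).2
    · exact fun hu => (hST y hy x hx).2 hu.symm
    · exact hUl x hx hxU y hy
  rcases Nat.eq_zero_or_pos r with rfl | hr0
  · rw [maxMissing_zero] at j1
    rw [add_zero]
    refine ⟨by omega, fun hp heq => ?_⟩
    obtain ⟨U, hU, hUc, hUD, hUl⟩ := i2 hp (by omega)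
    refine ⟨U, hU.trans Finset.subset_union_left, hUc, hUD, fun x hx hxU y hy => ?_⟩
    rcases Finset.mem_union.1 hx with hx | hx <;> rcases Finset.mem_union.1 hy with hy | hy
    · exact hUl x hx hxU y hy
    · exact (hST x hx y hy).2
    · exact fun hu => (hST y hy x hx).2 hu.symm
    · exact not_unlinked_of_missing_eq_zero (by omega) hx hy
  · have := maxMissing_superadditive hq0 hr0
    exact ⟨by omega, fun _ heq => by omega⟩

/-- A vertex-critical digraph of order `k + p` misses at most `maxMissing p` arcs, with equality only
for the joins of complete digraphs with Dirac–Gallai digraphs. -/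
theorem IsVertexCritical.bound (hloop : D.IsLoopless) (S : Finset V) : ∀ k p,
    D.IsVertexCritical S k → S.card = k + p → D.missing S ≤ maxMissing p ∧
      (1 ≤ p → D.missing S = maxMissing p → D.HasDiracGallaiCore S p) := by
  induction S using Finset.strongInduction with
  | H S ih =>
  intro k p h hcard
  have hdeg := h.missing_le hcard
  rcases Nat.eq_zero_or_pos p with rfl | hp
  · exact ⟨by omega, fun h => absurd h (by omega)⟩
  by_cases hkp : k ≤ p
  · have h1 := two_mul_sq_lt_maxMissing hp
    have h2 : S.card * p ≤ 2 * p ^ 2 := by rw [hcard]; nlinarith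
    exact ⟨by omega, fun _ _ => by omega⟩
  by_cases hsplit : ∃ A ⊆ S, A.Nonempty ∧ A ≠ S ∧ ∀ x ∈ A, ∀ y ∈ S \ A, ¬ D.Unlinked x y
  · obtain ⟨A, hAS, hA, hne, hl⟩ := hsplit
    have e : A ∪ S \ A = S := Finset.union_sdiff_of_subset hAS
    rw [← e] at h hcard ⊢
    refine h.bound_of_split (fun x hx y hy => ⟨fun hxy => ?_, hl x hx y hy⟩) hcard fun B hB => ?_
    · rw [hxy] at hx; exact (Finset.mem_sdiff.1 hy).2 hx
    · refine ih B ?_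
      rcases hB with rfl | rfl
      · exact hAS.ssubset_of_ne hne
      · exact Finset.sdiff_ssubset hAS hA
  · push Not at hsplit
    let e : (S : Set V) ↪ V := Function.Embedding.subtype _
    have he : ∀ x y, (D.induced (S : Set V)).Adj x y ↔ D.Adj (e x) (e y) := fun _ _ => Iff.rfl
    have hmap : (Finset.univ : Finset (S : Set V)).map e = S := by
      ext x; simp [e]
    have hcardW : Fintype.card (S : Set V) = S.card := by simp
    have hVC : (D.induced (S : Set V)).IsVertexCritical Finset.univ k := by
      rw [← isVertexCritical_map he, hmap]; exact h
    have hconn : ∀ B : Finset (S : Set V), B.Nonempty →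
        (∀ x ∈ B, ∀ y, (D.induced (S : Set V)).Unlinked x y → y ∈ B) → B = Finset.univ := by
      intro B hB hcl
      by_contra hne
      have hsub : B.map e ⊆ S :=
        (Finset.map_subset_map.2 (Finset.subset_univ B)).trans hmap.subset
      obtain ⟨x, hx, y, hy, hu⟩ := hsplit (B.map e) hsub hB.map
        fun h' => hne (Finset.map_injective e (h'.trans hmap.symm))
      obtain ⟨x', hx', rfl⟩ := Finset.mem_map.1 hx
      obtain ⟨hyS, hyB⟩ := Finset.mem_sdiff.1 hy
      have := hcl x' hx' ⟨y, hyS⟩ ((unlinked_map he).1 hu)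
      exact hyB (Finset.mem_map.2 ⟨_, this, rfl⟩)
    obtain ⟨j, rfl⟩ : ∃ j, k = j + 1 := ⟨k - 1, by omega⟩
    obtain ⟨h1, h2⟩ := hVC.card_ge_and_isFactorCritical hconn rfl
    rw [hcardW] at h1 h2
    obtain rfl : p = j := by omega
    have hFC := h2 (by omega)
    obtain ⟨k1, k2⟩ := hFC.missing_le_maxMissing (p := p) (by omega) hp
    rw [← missing_map he, hmap] at k1 k2
    exact ⟨k1, fun _ heq => ⟨S, subset_rfl, by omega, k2 (fun x => hloop x) heq,
      fun x hx hx' => absurd hx hx'⟩⟩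

end Bound

/-! ### Critical digraphs and vertex-critical sets -/

section Critical

variable {V : Type u} [Fintype V] {D : Digraph V}

theorem exists_isAcyclicColoring_iff {k : ℕ} :
    (∃ φ : V → Fin k, D.IsAcyclicColoring φ) ↔ D.AcyclicCover Finset.univ k := by
  constructor
  · rintro ⟨φ, hφ⟩
    refine ⟨Finset.univ.image fun c => Finset.univ.filter fun x => φ x = c,
      Finset.card_image_le.trans (by simp), fun Q hQ => ?_, fun x _ =>
      ⟨_, Finset.mem_image_of_mem _ (Finset.mem_univ (φ x)), by simp⟩⟩
    obtain ⟨c, -, rfl⟩ := Finset.mem_image.1 hQ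
    have := isAcyclic_induced.1 (hφ c)
    simpa using this
  · intro h
    obtain ⟨φ, h1, h2⟩ := h.exists_partition (acyclic_mono D)
    let g : V → Fin k := fun x =>
      Fin.castLE h1 ((Finset.univ.image φ).equivFin ⟨φ x, Finset.mem_image_of_mem _ (Finset.mem_univ x)⟩)
    have hg : ∀ x y, g x = g y → φ x = φ y := fun x y hxy => by
      have := (Finset.univ.image φ).equivFin.injective (Fin.castLE_injective h1 hxy)
      exact congrArg Subtype.val this
    refine ⟨g, fun c => isAcyclic_induced.2 ?_⟩
    by_cases hc : ∃ x, g x = c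
    · obtain ⟨x, rfl⟩ := hc
      refine (h2 (φ x) (Finset.mem_image_of_mem _ (Finset.mem_univ x))).mono fun y hy => ?_
      simpa using hg y x hy
    · refine (isAcyclicOn_empty (D := D)).mono fun y hy => hc ⟨y, hy⟩

theorem dichromaticNumber_le_iff {m : ℕ} :
    D.dichromaticNumber ≤ m ↔ D.AcyclicCover Finset.univ m := by
  have e : {k : ℕ | ∃ φ : V → Fin k, D.IsAcyclicColoring φ} =
      {k | D.AcyclicCover Finset.univ k} := Set.ext fun k => exists_isAcyclicColoring_iff
  unfold dichromaticNumber
  rw [e]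
  constructor
  · intro h
    have : sInf {k | D.AcyclicCover Finset.univ k} ∈ {k | D.AcyclicCover Finset.univ k} :=
      Nat.sInf_mem ⟨_, acyclicCover_card D _⟩
    exact IsCoverable.mono this subset_rfl h
  · exact fun h => Nat.sInf_le h

theorem dichromaticNumber_eq_iff {k : ℕ} : D.dichromaticNumber = k ↔
    D.AcyclicCover Finset.univ k ∧ ∀ m, D.AcyclicCover Finset.univ m → k ≤ m := by
  simp only [← dichromaticNumber_le_iff]
  constructor
  · rintro rfl; exact ⟨le_rfl, fun m hm => hm⟩
  · exact fun h => le_antisymm h.1 (h.2 _ le_rfl)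

omit [Fintype V] in
theorem IsAcyclicOn.anti {D' : Digraph V} (hD : ∀ x y, D'.Adj x y → D.Adj x y) {Q : Set V}
    (h : D.IsAcyclicOn Q) : D'.IsAcyclicOn Q := by
  rintro ⟨n, hn, f, hf, h1, h2⟩
  exact h ⟨n, hn, f, hf, h1, fun i => hD _ _ (h2 i)⟩

omit [Fintype V] in
theorem AcyclicCover.anti {D' : Digraph V} (hD : ∀ x y, D'.Adj x y → D.Adj x y) {S : Finset V} {m : ℕ}
    (h : D.AcyclicCover S m) : D'.AcyclicCover S m := by
  obtain ⟨𝒬, h1, h2, h3⟩ := h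
  exact ⟨𝒬, h1, fun Q hQ => (h2 Q hQ).anti hD, h3⟩

theorem Subdigraph.dichromaticNumber_le_iff (S : D.Subdigraph) {m : ℕ} :
    S.toDigraph.dichromaticNumber ≤ m ↔
      (⟨S.Adj⟩ : Digraph V).AcyclicCover (Finset.univ.filter (· ∈ S.verts)) m := by
  rw [Digraph.dichromaticNumber_le_iff, ← acyclicCover_map (D := ⟨S.Adj⟩)
    (e := Function.Embedding.subtype (· ∈ S.verts)) (fun _ _ => Iff.rfl)]
  have : Finset.univ.map (Function.Embedding.subtype (· ∈ S.verts)) =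
      Finset.univ.filter (· ∈ S.verts) := by ext x; simp
  rw [← this]

theorem IsCritical.isVertexCritical {k : ℕ} (h : D.IsCritical k) : D.IsVertexCritical Finset.univ k := by
  obtain ⟨hk, hS⟩ := h
  obtain ⟨h1, h2⟩ := dichromaticNumber_eq_iff.1 hk
  refine ⟨h1, h2, fun x _ => ?_⟩
  obtain ⟨S, hSv, hSA⟩ : ∃ S : D.Subdigraph, S.verts = {x}ᶜ ∧
      ∀ y z, S.Adj y z ↔ D.Adj y z ∧ y ≠ x ∧ z ≠ x :=
    ⟨{  verts := {x}ᶜ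
        Adj := fun y z => D.Adj y z ∧ y ≠ x ∧ z ≠ x
        adj_sub := fun h => h.1
        left_mem := fun h => h.2.1
        right_mem := fun h => h.2.2 }, rfl, fun _ _ => Iff.rfl⟩
  have hlt := hS S (Or.inl fun h => by
    have : x ∈ S.verts := h ▸ Set.mem_univ x
    rw [hSv] at this
    exact this rfl)
  rw [hk] at hlt
  refine ⟨_, hlt, ?_⟩
  obtain ⟨𝒬, k1, k2, k3⟩ := S.dichromaticNumber_le_iff.1 le_rfl
  refine ⟨𝒬.image (·.erase x), Finset.card_image_le.trans k1, fun Q hQ => ?_, fun y hy => ?_⟩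
  · obtain ⟨R, hR, rfl⟩ := Finset.mem_image.1 hQ
    rintro ⟨n, hn, f, hf, f1, f2⟩
    have f3 : ∀ i, f i ≠ x ∧ f i ∈ R := fun i => Finset.mem_erase.1 (Finset.mem_coe.1 (f1 i))
    exact k2 R hR ⟨n, hn, f, hf, fun i => (f3 i).2, fun i => (hSA _ _).2 ⟨f2 i, (f3 i).1, (f3 _).1⟩⟩
  · have hyx := Finset.ne_of_mem_erase hy
    obtain ⟨Q, hQ, hyQ⟩ := k3 y (Finset.mem_filter.2 ⟨Finset.mem_univ _, by rw [hSv]; exact hyx⟩)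
    exact ⟨_, Finset.mem_image_of_mem _ hQ, Finset.mem_erase.2 ⟨hyx, hyQ⟩⟩

/-- A vertex-critical digraph with the largest possible number of missing arcs is critical, as the
deletion of an arc would give a vertex-critical digraph missing even more arcs. -/
theorem IsVertexCritical.isCritical {k p : ℕ} (h : D.IsVertexCritical Finset.univ k)
    (hloop : D.IsLoopless) (hcard : Fintype.card V = k + p)
    (hM : D.missing Finset.univ = maxMissing p) : D.IsCritical k := by
  have hk := dichromaticNumber_eq_iff.2 ⟨h.cover, h.minimal⟩
  refine ⟨hk, fun S hS => ?_⟩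
  rw [hk]
  have hsub : ∀ x y, (⟨S.Adj⟩ : Digraph V).Adj x y → D.Adj x y := fun _ _ h => S.adj_sub h
  by_cases hv : S.verts = Set.univ
  · have hA : S.Adj ≠ D.Adj := hS.resolve_left fun h => h hv
    by_contra hge
    have huniv : Finset.univ.filter (· ∈ S.verts) = (Finset.univ : Finset V) := by simp [hv]
    have hVC : (⟨S.Adj⟩ : Digraph V).IsVertexCritical Finset.univ k := by
      refine ⟨h.cover.anti hsub, fun m hm => ?_, fun x hx => ?_⟩
      · rw [← huniv, ← S.dichromaticNumber_le_iff] at hm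
        omega
      · obtain ⟨m, hm, hc⟩ := h.erase x hx
        exact ⟨m, hm, hc.anti hsub⟩
    have hb := (hVC.bound (fun x hx => hloop x (hsub _ _ hx)) _ k p (by rwa [Finset.card_univ])).1
    obtain ⟨x, y, hxy, hnot⟩ : ∃ x y, D.Adj x y ∧ ¬ S.Adj x y := by
      by_contra! hc
      exact hA (funext fun x => funext fun y => propext ⟨S.adj_sub, hc x y⟩)
    have hle : ∀ x y, D.missingArc x y ≤ (⟨S.Adj⟩ : Digraph V).missingArc x y := fun x y => by
      unfold missingArc
      have := hsub x y
      split_ifs <;> first | omega | tauto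
    have hne : x ≠ y := fun e => hloop x (by rw [← e] at hxy; exact hxy)
    have hlt : D.missingArc x y < (⟨S.Adj⟩ : Digraph V).missingArc x y := by
      unfold missingArc
      rw [if_neg (by tauto), if_pos ⟨hne, hnot⟩]; simp
    have : D.missing Finset.univ < (⟨S.Adj⟩ : Digraph V).missing Finset.univ := by
      refine Finset.sum_lt_sum (fun x _ => Finset.sum_le_sum fun y _ => hle x y)
        ⟨x, Finset.mem_univ x, Finset.sum_lt_sum (fun y _ => hle x y) ⟨y, Finset.mem_univ y, hlt⟩⟩
    omega
  · obtain ⟨x, hx⟩ := (Set.ne_univ_iff_exists_notMem _).1 hv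
    obtain ⟨m, hm, hc⟩ := h.erase x (Finset.mem_univ x)
    refine lt_of_le_of_lt (S.dichromaticNumber_le_iff.2 ((hc.anti hsub).mono (fun y hy => ?_) le_rfl)) hm
    refine Finset.mem_erase.2 ⟨fun e => hx ?_, Finset.mem_univ _⟩
    rw [← e]; exact (Finset.mem_filter.1 hy).2

theorem ncard_arcs_add_missing (hloop : D.IsLoopless) :
    D.arcs.ncard + D.missing Finset.univ = Fintype.card V * (Fintype.card V - 1) := by
  have h1 : D.arcs.ncard = ∑ x, ∑ y, if D.Adj x y then 1 else 0 := by
    have e : D.arcs = ((Finset.univ.filter fun a : V × V => D.Adj a.1 a.2 : Finset (V × V)) :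
        Set (V × V)) := by ext a; simp [arcs]
    rw [e, Set.ncard_coe_finset, Finset.card_filter, ← Finset.univ_product_univ, Finset.sum_product]
  rw [h1, missing, ← Finset.sum_add_distrib]
  have h2 : ∀ x, (∑ y, if D.Adj x y then 1 else 0) + ∑ y, D.missingArc x y = Fintype.card V - 1 := by
    intro x
    rw [← Finset.sum_add_distrib, ← Finset.card_univ, ← Finset.card_erase_of_mem (Finset.mem_univ x),
      Finset.card_eq_sum_ones, ← Finset.sum_erase Finset.univ (a := x)]
    · refine Finset.sum_congr rfl fun y hy => ?_
      have := (Finset.ne_of_mem_erase hy).symm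
      unfold missingArc
      split_ifs <;> first | rfl | tauto
    · simp [missingArc, hloop x]
  rw [Finset.sum_congr rfl fun x _ => h2 x, Finset.sum_const, Finset.card_univ, smul_eq_mul]

end Critical

/-! ### The extremal examples -/

section Examples

theorem IsVertexCritical.union {V : Type u} {D : Digraph V} {S T : Finset V} {a b : ℕ}
    (hS : D.IsVertexCritical S a) (hT : D.IsVertexCritical T b)
    (hST : ∀ x ∈ S, ∀ y ∈ T, x ≠ y ∧ ¬ D.Unlinked x y) : D.IsVertexCritical (S ∪ T) (a + b) := by
  have hd : Disjoint S T := Finset.disjoint_left.2 fun x h1 h2 => (hST x h1 x h2).1 rfl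
  refine ⟨hS.cover.union hT.cover, fun m hm => ?_, fun x hx => ?_⟩
  · obtain ⟨c, d, hcd, h1, h2⟩ := AcyclicCover.split hm hST
    have := hS.minimal _ h1
    have := hT.minimal _ h2
    omega
  · rw [Finset.erase_union_distrib]
    rcases Finset.mem_union.1 hx with hx | hx
    · obtain ⟨m, hm, hc⟩ := hS.erase x hx
      rw [Finset.erase_eq_of_notMem (Finset.disjoint_left.1 hd hx)]
      exact ⟨m + b, by omega, hc.union hT.cover⟩
    · obtain ⟨m, hm, hc⟩ := hT.erase x hx
      rw [Finset.erase_eq_of_notMem (Finset.disjoint_right.1 hd hx)]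
      exact ⟨a + m, by omega, hS.cover.union hc⟩

variable {V : Type u} [Fintype V] {D : Digraph V}

theorem isVertexCritical_of_forall_not_unlinked (h : ∀ x y, ¬ D.Unlinked x y) :
    D.IsVertexCritical Finset.univ (Fintype.card V) := by
  refine ⟨acyclicCover_card D _, fun m hm => ?_, fun x hx => ?_⟩
  · obtain ⟨φ, h1, h2⟩ := hm.exists_partition (acyclic_mono D)
    rw [Finset.card_image_of_injective, Finset.card_univ] at h1
    · exact h1
    intro x y hxy
    by_contra hne
    refine h x y ((h2 (φ x) (Finset.mem_image_of_mem _ (Finset.mem_univ x))).unlinked ?_ ?_ hne) <;>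
      simp [hxy]
  · refine ⟨_, ?_, acyclicCover_card D _⟩
    rw [← Finset.card_univ]
    exact Finset.card_erase_lt_of_mem hx

theorem missing_eq_zero (h : ∀ x y, ¬ D.Unlinked x y) : D.missing Finset.univ = 0 :=
  Finset.sum_eq_zero fun x _ => Finset.sum_eq_zero fun y _ =>
    missingArc_eq_zero_of_not_unlinked (h x y)

omit [Fintype V] in
theorem acyclicCover_of_unlinked (m : ℕ) : ∀ S T : Finset V, S.card ≤ m → T.card ≤ m →
    (∀ x ∈ S, ∀ y ∈ T, D.Unlinked x y) → D.AcyclicCover (S ∪ T) m := by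
  induction m with
  | zero =>
    intro S T hS hT _
    rw [Finset.card_eq_zero.1 (Nat.le_zero.1 hS), Finset.card_eq_zero.1 (Nat.le_zero.1 hT)]
    exact isCoverable_empty 0
  | succ m ih =>
    intro S T hS hT h
    rcases S.eq_empty_or_nonempty with rfl | ⟨s, hs⟩
    · rw [Finset.empty_union]
      exact (acyclicCover_card D T).mono subset_rfl hT
    rcases T.eq_empty_or_nonempty with rfl | ⟨t, ht⟩
    · rw [Finset.union_empty]
      exact (acyclicCover_card D S).mono subset_rfl hS
    have := ih (S.erase s) (T.erase t) (by rw [Finset.card_erase_of_mem hs]; omega)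
      (by rw [Finset.card_erase_of_mem ht]; omega)
      fun x hx y hy => h x (Finset.mem_of_mem_erase hx) y (Finset.mem_of_mem_erase hy)
    refine (this.union (isCoverable_one (acyclic_pair D s t (h s hs t ht)))).mono ?_ le_rfl
    intro x hx
    simp only [Finset.mem_union, Finset.mem_erase, Finset.mem_insert, Finset.mem_singleton] at hx ⊢
    tauto

/-- The complete biorientation of the complement of a blow-up of the five-cycle, with class sizes as in a
Dirac–Gallai graph; `φ` gives the classes. -/
structure IsFiveBlowUp (D : Digraph V) (φ : V → Fin 5) (p : ℕ) : Prop where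
  adj : ∀ x y, D.Adj x y ↔ x ≠ y ∧ fiveAdj (φ x) (φ y) = false
  card_zero : (Finset.univ.filter fun x => φ x = 0).card = 1
  card_one : (Finset.univ.filter fun x => φ x = 1).card = 1
  card_two_pos : 0 < (Finset.univ.filter fun x => φ x = 2).card
  card_four_pos : 0 < (Finset.univ.filter fun x => φ x = 4).card
  card_two_add_four : (Finset.univ.filter fun x => φ x = 2).card +
    (Finset.univ.filter fun x => φ x = 4).card = p
  card_three : (Finset.univ.filter fun x => φ x = 3).card + 1 = p

variable {φ : V → Fin 5} {p : ℕ}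

theorem IsFiveBlowUp.unlinked (h : D.IsFiveBlowUp φ p) (x y : V) :
    D.Unlinked x y ↔ fiveAdj (φ x) (φ y) := by
  unfold Unlinked
  rw [h.adj, h.adj, fiveAdj_comm (φ y)]
  constructor
  · intro hh
    by_contra hc
    have hc' : fiveAdj (φ x) (φ y) = false := by simpa using hc
    exact hh.2 ⟨⟨hh.1, hc'⟩, hh.1.symm, hc'⟩
  · intro hh
    refine ⟨fun e => ?_, fun hc => ?_⟩
    · rw [e, fiveAdj_self] at hh; simp at hh
    · rw [hh] at hc; simp at hc

theorem IsFiveBlowUp.isLoopless (h : D.IsFiveBlowUp φ p) : D.IsLoopless :=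
  fun x hx => ((h.adj x x).1 hx).1 rfl

theorem sum_comp_five (φ : V → Fin 5) (g : Fin 5 → ℕ) :
    ∑ x, g (φ x) = ∑ i, (Finset.univ.filter fun x => φ x = i).card * g i := by
  rw [← Finset.sum_fiberwise Finset.univ φ]
  refine Finset.sum_congr rfl fun i _ => ?_
  rw [Finset.sum_congr rfl (g := fun _ => g i) (fun x hx => by rw [(Finset.mem_filter.1 hx).2]),
    Finset.sum_const, smul_eq_mul]

theorem IsFiveBlowUp.card (h : D.IsFiveBlowUp φ p) : Fintype.card V = 2 * p + 1 := by
  have := sum_comp_five φ fun _ => 1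
  rw [Fin.sum_univ_five] at this
  simp only [Finset.sum_const, Finset.card_univ, smul_eq_mul, mul_one] at this
  have := h.card_zero
  have := h.card_one
  have := h.card_two_add_four
  have := h.card_three
  omega

theorem IsFiveBlowUp.two_le (h : D.IsFiveBlowUp φ p) : 2 ≤ p := by
  have := h.card_two_pos
  have := h.card_four_pos
  have := h.card_two_add_four
  omega

theorem IsFiveBlowUp.missing_eq (h : D.IsFiveBlowUp φ p) : D.missing Finset.univ = maxMissing p := by
  have e : ∀ x y, D.missingArc x y = if fiveAdj (φ x) (φ y) then 1 else 0 := by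
    intro x y
    unfold missingArc
    rw [h.adj]
    have : fiveAdj (φ x) (φ y) → x ≠ y := fun hh => ((h.unlinked x y).2 hh).1
    by_cases hh : fiveAdj (φ x) (φ y)
    · simp [hh, this hh]
    · simp [hh]
  unfold missing
  simp only [e]
  have e2 : ∀ x, ∑ y, (if fiveAdj (φ x) (φ y) then 1 else 0) =
      ∑ j, (Finset.univ.filter fun x => φ x = j).card * (if fiveAdj (φ x) j then 1 else 0) :=
    fun x => sum_comp_five φ fun j => if fiveAdj (φ x) j then 1 else 0
  simp only [e2]
  rw [sum_comp_five φ fun i => ∑ j, (Finset.univ.filter fun x => φ x = j).card *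
    (if fiveAdj i j then 1 else 0)]
  simp only [Fin.sum_univ_five, h.card_zero, h.card_one]
  rw [maxMissing_of_two_le h.two_le]
  have h3 := h.card_three
  have h4 := h.card_two_add_four
  generalize (Finset.univ.filter fun x => φ x = 2).card = a at *
  generalize (Finset.univ.filter fun x => φ x = 3).card = q at *
  generalize (Finset.univ.filter fun x => φ x = 4).card = b at *
  simp [fiveAdj]
  have : b = q + 1 - a := by omega
  subst h3
  have h5 : a * q + b * q = (q + 1) * q := by rw [← add_mul, h4]
  nlinarith

theorem IsFiveBlowUp.isVertexCritical (h : D.IsFiveBlowUp φ p) :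
    D.IsVertexCritical Finset.univ (p + 1) := by
  set N : Fin 5 → Finset V := fun i => Finset.univ.filter fun x => φ x = i with hN
  have hmem : ∀ {i x}, x ∈ N i ↔ φ x = i := by simp [hN]
  have hNU : ∀ {i j}, fiveAdj i j → ∀ x ∈ N i, ∀ y ∈ N j, D.Unlinked x y := by
    intro i j hij x hx y hy
    rw [h.unlinked, hmem.1 hx, hmem.1 hy]; exact hij
  have hcase : ∀ x, x ∈ N 0 ∨ x ∈ N 1 ∨ x ∈ N 2 ∨ x ∈ N 3 ∨ x ∈ N 4 := fun x => by
    simp only [hmem]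
    exact (show ∀ j : Fin 5, j = 0 ∨ j = 1 ∨ j = 2 ∨ j = 3 ∨ j = 4 by decide) _
  obtain ⟨a, ha⟩ := Finset.card_eq_one.1 h.card_zero
  obtain ⟨b, hb⟩ := Finset.card_eq_one.1 h.card_one
  obtain ⟨y₁, hy₁⟩ := Finset.card_pos.1 h.card_two_pos
  obtain ⟨y₂, hy₂⟩ := Finset.card_pos.1 h.card_four_pos
  change N 0 = {a} at ha
  change N 1 = {b} at hb
  change y₁ ∈ N 2 at hy₁
  change y₂ ∈ N 4 at hy₂
  have hd : Disjoint (N 2) (N 4) := Finset.disjoint_left.2 fun x h1 h2 => by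
    have := (hmem.1 h1).symm.trans (hmem.1 h2); simp at this
  have h3 : (N 3).card + 1 = p := h.card_three
  have h24 : (N 2 ∪ N 4).card = p := by
    rw [Finset.card_union_of_disjoint hd]; exact h.card_two_add_four
  have hX : ∀ x ∈ N 3, ∀ y ∈ N 2 ∪ N 4, D.Unlinked x y := fun x hx y hy => by
    rcases Finset.mem_union.1 hy with hy | hy
    exacts [hNU (by decide) x hx y hy, hNU (by decide) x hx y hy]
  have haN : a ∈ N 0 := by rw [ha]; simp
  have hbN : b ∈ N 1 := by rw [hb]; simp
  have hay := hNU (by decide) a haN y₂ hy₂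
  have hby := hNU (by decide) b hbN y₁ hy₁
  have hab := hNU (by decide) a haN b hbN
  have hy12 : y₁ ≠ y₂ := fun e => Finset.disjoint_left.1 hd hy₁ (e ▸ hy₂)
  -- every vertex-deleted subdigraph is covered by unlinked pairs
  have herase : ∀ x, D.AcyclicCover (Finset.univ.erase x) p := by
    intro x
    rcases hcase x with hx | hx | hx
    · have c1 := acyclicCover_of_unlinked (D := D) (p - 1) (N 3) ((N 2 ∪ N 4).erase y₁) (by omega)
        (by rw [Finset.card_erase_of_mem (Finset.mem_union_left _ hy₁)]; omega)
        fun u hu v hv => hX u hu v (Finset.mem_of_mem_erase hv)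
      refine (c1.union (isCoverable_one (acyclic_pair D _ _ hby))).mono (fun z hz => ?_) (by omega)
      have hzx := Finset.ne_of_mem_erase hz
      rw [ha, Finset.mem_singleton] at hx
      have := hcase z
      rw [ha, hb] at this
      simp only [Finset.mem_union, Finset.mem_erase, Finset.mem_insert, Finset.mem_singleton] at this ⊢
      rw [hx] at hzx
      tauto
    · have c1 := acyclicCover_of_unlinked (D := D) (p - 1) (N 3) ((N 2 ∪ N 4).erase y₂) (by omega)
        (by rw [Finset.card_erase_of_mem (Finset.mem_union_right _ hy₂)]; omega)
        fun u hu v hv => hX u hu v (Finset.mem_of_mem_erase hv)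
      refine (c1.union (isCoverable_one (acyclic_pair D _ _ hay))).mono (fun z hz => ?_) (by omega)
      have hzx := Finset.ne_of_mem_erase hz
      rw [hb, Finset.mem_singleton] at hx
      have := hcase z
      rw [ha, hb] at this
      simp only [Finset.mem_union, Finset.mem_erase, Finset.mem_insert, Finset.mem_singleton] at this ⊢
      rw [hx] at hzx
      tauto
    have hx' : x ∈ N 3 ∨ x ∈ N 2 ∪ N 4 := by rw [Finset.mem_union]; tauto
    rcases hx' with hx | hx
    · have hy₂' : y₂ ∈ (N 2 ∪ N 4).erase y₁ :=
        Finset.mem_erase.2 ⟨hy12.symm, Finset.mem_union_right _ hy₂⟩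
      have c1 := acyclicCover_of_unlinked (D := D) (p - 2) ((N 3).erase x)
        (((N 2 ∪ N 4).erase y₁).erase y₂) (by rw [Finset.card_erase_of_mem hx]; omega)
        (by rw [Finset.card_erase_of_mem hy₂',
          Finset.card_erase_of_mem (Finset.mem_union_left _ hy₁)]; omega)
        fun u hu v hv => hX u (Finset.mem_of_mem_erase hu) v
          (Finset.mem_of_mem_erase (Finset.mem_of_mem_erase hv))
      have h2 := h.two_le
      refine ((c1.union (isCoverable_one (acyclic_pair D _ _ hay))).union
        (isCoverable_one (acyclic_pair D _ _ hby))).mono (fun z hz => ?_) (by omega)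
      have hzx := Finset.ne_of_mem_erase hz
      have := hcase z
      rw [ha, hb] at this
      simp only [Finset.mem_union, Finset.mem_erase, Finset.mem_insert, Finset.mem_singleton] at this ⊢
      tauto
    · have c1 := acyclicCover_of_unlinked (D := D) (p - 1) (N 3) ((N 2 ∪ N 4).erase x) (by omega)
        (by rw [Finset.card_erase_of_mem hx]; omega)
        fun u hu v hv => hX u hu v (Finset.mem_of_mem_erase hv)
      refine (c1.union (isCoverable_one (acyclic_pair D _ _ hab))).mono (fun z hz => ?_) (by omega)
      have hzx := Finset.ne_of_mem_erase hz
      have := hcase z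
      rw [ha, hb] at this
      simp only [Finset.mem_union, Finset.mem_erase, Finset.mem_insert, Finset.mem_singleton] at this ⊢
      tauto
  refine ⟨?_, fun m hm => ?_, fun x _ => ⟨p, by omega, herase x⟩⟩
  · refine ((herase a).union (isCoverable_one (acyclic_singleton D a))).mono (fun z _ => ?_) le_rfl
    by_cases hz : z = a <;> simp [hz]
  -- the unlinked pairs form a triangle-free graph, so acyclic sets have at most two vertices
  · obtain ⟨𝒬, h1, h2, h4⟩ := hm
    have h5 : ∀ Q ∈ 𝒬, Q.card ≤ 2 := by
      intro Q hQ
      by_contra hc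
      obtain ⟨x, hx, y, hy, z, hz, hxy, hxz, hyz⟩ := Finset.two_lt_card.1 (not_le.1 hc)
      have k1 := (h.unlinked x y).1 ((h2 Q hQ).unlinked hx hy hxy)
      have k2 := (h.unlinked x z).1 ((h2 Q hQ).unlinked hx hz hxz)
      have k3 := (h.unlinked y z).1 ((h2 Q hQ).unlinked hy hz hyz)
      rw [fiveAdj_triangle _ _ _ k1 k2] at k3
      simp at k3
    have h6 : Finset.univ.card ≤ 𝒬.card * 2 :=
      (Finset.card_le_card (fun x _ => by
        obtain ⟨Q, hQ, hxQ⟩ := h4 x (Finset.mem_univ x)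
        exact Finset.mem_biUnion.2 ⟨Q, hQ, hxQ⟩ : Finset.univ ⊆ 𝒬.biUnion id)).trans
        (Finset.card_biUnion_le_card_mul _ _ _ h5)
    rw [Finset.card_univ, h.card] at h6
    omega

end Examples

/-! ### Dirac–Gallai digraphs and their joins -/

section DiracGallai

variable {V : Type u} [Fintype V]

theorem card_filter_eq_ncard (φ : V → Fin 5) {i : Fin 5} {S : Set V} (h : ∀ x, φ x = i ↔ x ∈ S) :
    (Finset.univ.filter fun x => φ x = i).card = S.ncard := by
  rw [← Set.ncard_coe_finset]
  congr 1
  ext x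
  simp [h]

/-- The classes are `{v₁}`, `{v₂}`, `Y₁`, `X`, `Y₂` in this cyclic order. -/
theorem IsDiracGallaiGraph.exists_isFiveBlowUp {G : SimpleGraph V} {p : ℕ}
    (h : IsDiracGallaiGraph G (p + 1)) : ∃ φ, (biorientation G).IsFiveBlowUp φ p := by
  obtain ⟨X, Y₁, Y₂, v₁, v₂, hX, hY₁, hY₂, d1, d2, d3, hv, h1, h2, hcov, hc1, hc2, cX, cY, hXY, n1,
    n2⟩ := h
  simp only [Set.mem_union, not_or] at h1 h2
  rw [Set.disjoint_left] at d1 d2 d3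
  set φ : V → Fin 5 := fun x => if x = v₁ then 0 else if x = v₂ then 1 else if x ∈ Y₁ then 2 else
    if x ∈ X then 3 else 4 with hφ
  have hcase : ∀ x, (x ∈ X ∨ x ∈ Y₁ ∨ x ∈ Y₂) ∨ x = v₁ ∨ x = v₂ := fun x => by
    have := Set.eq_univ_iff_forall.1 hcov x
    simp only [Set.mem_union, Set.mem_insert_iff, Set.mem_singleton_iff] at this
    tauto
  have f0 : ∀ x, φ x = 0 ↔ x = v₁ := fun x => by
    simp only [hφ]; split_ifs <;> simp [*, hv.symm]
  have f1 : ∀ x, φ x = 1 ↔ x = v₂ := fun x => by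
    by_cases e : x = v₁
    · subst e; simp [hφ, hv]
    by_cases e' : x = v₂
    · subst e'; simp [hφ, e]
    simp only [hφ]; split_ifs <;> simp [*]
  have f2 : ∀ x, φ x = 2 ↔ x ∈ Y₁ := fun x => by
    by_cases e : x = v₁
    · subst e; simp [hφ, h1]
    by_cases e' : x = v₂
    · subst e'; simp [hφ, h2, e]
    simp only [hφ]; split_ifs <;> simp [*]
  have f3 : ∀ x, φ x = 3 ↔ x ∈ X := fun x => by
    by_cases e : x = v₁
    · subst e; simp [hφ, h1]
    by_cases e' : x = v₂
    · subst e'; simp [hφ, h2, e]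
    by_cases e'' : x ∈ Y₁
    · simp only [hφ, e, e', e'', if_true, if_false]
      exact iff_of_false (by decide) fun hx => d1 hx e''
    simp only [hφ]; split_ifs <;> simp [*]
  have f4 : ∀ x, φ x = 4 ↔ x ∈ Y₂ := fun x => by
    have := (show ∀ j : Fin 5, j = 4 ↔ ¬ j = 0 ∧ ¬ j = 1 ∧ ¬ j = 2 ∧ ¬ j = 3 by decide) (φ x)
    rw [this, f0, f1, f2, f3]
    constructor
    · have := hcase x; tauto
    · intro hx
      exact ⟨fun e => h1.2 (e ▸ hx), fun e => h2.2 (e ▸ hx), fun e => d3 e hx, fun e => d2 e hx⟩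
  have hf : ∀ x, φ x = 0 ∨ φ x = 1 ∨ φ x = 2 ∨ φ x = 3 ∨ φ x = 4 := fun x =>
    (show ∀ j : Fin 5, j = 0 ∨ j = 1 ∨ j = 2 ∨ j = 3 ∨ j = 4 by decide) _
  -- adjacency, seen from each of the five classes
  have a0 : ∀ x y, φ x = 0 → (G.Adj x y ↔ x ≠ y ∧ fiveAdj 0 (φ y) = false) := by
    intro x y hx
    obtain rfl := (f0 x).1 hx
    have e : G.Adj x y ↔ y ∈ X ∪ Y₁ := by rw [← n1]; rfl
    rw [e, Set.mem_union, ← f2, ← f3]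
    have : x ≠ y ↔ φ y ≠ 0 := by rw [ne_comm]; exact not_congr (f0 y).symm
    rw [this]
    generalize φ y = j
    revert j; decide
  have a1 : ∀ x y, φ x = 1 → (G.Adj x y ↔ x ≠ y ∧ fiveAdj 1 (φ y) = false) := by
    intro x y hx
    obtain rfl := (f1 x).1 hx
    have e : G.Adj x y ↔ y ∈ X ∪ Y₂ := by rw [← n2]; rfl
    rw [e, Set.mem_union, ← f4, ← f3]
    have : x ≠ y ↔ φ y ≠ 1 := by rw [ne_comm]; exact not_congr (f1 y).symm
    rw [this]
    generalize φ y = j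
    revert j; decide
  have a3 : ∀ x y, x ∈ X → (y ∈ X ∨ y ∈ Y₁ ∨ y ∈ Y₂) →
      (G.Adj x y ↔ x ≠ y ∧ fiveAdj 3 (φ y) = false) := by
    intro x y hx hy
    rcases hy with hy | hy
    · rw [(f3 y).2 hy, fiveAdj_self]
      exact ⟨fun h => ⟨h.ne, rfl⟩, fun h => cX hx hy h.1⟩
    · have hn : ¬ G.Adj x y := hXY x hx y hy
      have : fiveAdj 3 (φ y) = true := by
        rcases hy with hy | hy
        · rw [(f2 y).2 hy]; rfl
        · rw [(f4 y).2 hy]; rfl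
      simp [hn, this]
  have aY : ∀ x y, (x ∈ Y₁ ∨ x ∈ Y₂) → (y ∈ Y₁ ∨ y ∈ Y₂) →
      (G.Adj x y ↔ x ≠ y ∧ fiveAdj (φ x) (φ y) = false) := by
    intro x y hx hy
    have e1 : fiveAdj (φ x) (φ y) = false := by
      rw [← f2, ← f4] at hx hy
      rcases hx with hx | hx <;> rcases hy with hy | hy <;> rw [hx, hy] <;> rfl
    exact ⟨fun h => ⟨h.ne, e1⟩, fun h => cY hx hy h.1⟩
  have hsymm : ∀ x y, (G.Adj y x ↔ y ≠ x ∧ fiveAdj (φ y) (φ x) = false) →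
      (G.Adj x y ↔ x ≠ y ∧ fiveAdj (φ x) (φ y) = false) := fun x y h => by
    rw [G.adj_comm, h, ne_comm, fiveAdj_comm]
  refine ⟨φ, fun x y => ?_, ?_, ?_, ?_, ?_, ?_, ?_⟩
  · change G.Adj x y ↔ _
    rcases hcase x with hx | rfl | rfl
    · rcases hcase y with hy | rfl | rfl
      · rcases hx with hx | hx
        · have := a3 x y hx hy
          rwa [← (f3 x).2 hx] at this
        · rcases hy with hy | hy
          · refine hsymm x y ?_
            have := a3 y x hy (Or.inr hx)
            rwa [← (f3 y).2 hy] at this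
          · exact aY x y hx hy
      · refine hsymm _ _ ?_
        have e := (f0 y).2 rfl
        rw [a0 y x e, e]
      · refine hsymm _ _ ?_
        have e := (f1 y).2 rfl
        rw [a1 y x e, e]
    · have e := (f0 x).2 rfl
      rw [a0 x y e, e]
    · have e := (f1 x).2 rfl
      rw [a1 x y e, e]
  · rw [card_filter_eq_ncard φ (S := {v₁}) (fun x => f0 x), Set.ncard_singleton]
  · rw [card_filter_eq_ncard φ (S := {v₂}) (fun x => f1 x), Set.ncard_singleton]
  · rw [card_filter_eq_ncard φ f2]; exact (Set.ncard_pos).2 hY₁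
  · rw [card_filter_eq_ncard φ f4]; exact (Set.ncard_pos).2 hY₂
  · rw [card_filter_eq_ncard φ f2, card_filter_eq_ncard φ f4]; omega
  · rw [card_filter_eq_ncard φ f3]; omega

/-- A digraph attaining the bound for vertex-critical digraphs with dichromatic number `k` and order
`k + p`. -/
structure IsExtremal (D : Digraph V) (k p : ℕ) : Prop where
  loopless : D.IsLoopless
  card : Fintype.card V = k + p
  vertexCritical : D.IsVertexCritical Finset.univ k
  missing : D.missing Finset.univ = maxMissing p

theorem IsFiveBlowUp.isExtremal {D : Digraph V} {φ : V → Fin 5} {p : ℕ} (h : D.IsFiveBlowUp φ p) :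
    D.IsExtremal (p + 1) p :=
  ⟨h.isLoopless, by rw [h.card]; ring, h.isVertexCritical, h.missing_eq⟩

theorem IsExtremal.of_equiv {W : Type v} [Fintype W] {D : Digraph V} {E : Digraph W} {k p : ℕ}
    (h : E.IsExtremal k p) (e : V ≃ W) (he : ∀ x y, D.Adj x y ↔ E.Adj (e x) (e y)) :
    D.IsExtremal k p := by
  have hmap : Finset.univ.map e.toEmbedding = Finset.univ := Finset.map_univ_equiv e
  refine ⟨fun x hx => h.loopless _ ((he x x).1 hx), by rw [Fintype.card_congr e, h.card], ?_, ?_⟩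
  · rw [← isVertexCritical_map (e := e.toEmbedding) he, hmap]; exact h.vertexCritical
  · rw [← missing_map (e := e.toEmbedding) he, hmap]; exact h.missing

theorem zmod_three (x y : ZMod 3) : (x ≠ y → ¬ (y = x + 1 ∧ x = y + 1)) ∧
    (y ≠ x → y = x + 1 ∨ y = x + 2) ∧ x + 1 ≠ x + 2 ∧ x ≠ x + 1 ∧
      (x ≠ y ∧ ¬ y = x + 1 ↔ y = x + 2) := by
  revert x y; decide

theorem dirCycle_three_isExtremal [Fintype (ZMod 3)] : (dirCycle 3).IsExtremal 2 1 := by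
  have hcard : Fintype.card (ZMod 3) = 3 := by rw [← Nat.card_eq_fintype_card, Nat.card_zmod]
  have hU : ∀ x y : ZMod 3, x ≠ y → (dirCycle 3).Unlinked x y :=
    fun x y hxy => ⟨hxy, (zmod_three x y).1 hxy⟩
  have hnot : ¬ (dirCycle 3).IsAcyclicOn Set.univ := fun h =>
    h ⟨3, by norm_num, id, Function.injective_id, fun _ => Set.mem_univ _, fun _ => rfl⟩
  have hpair : ∀ (x : ZMod 3) (S : Finset (ZMod 3)), x ∉ S → (dirCycle 3).AcyclicCover S 1 :=
    fun x S hx => by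
      refine (isCoverable_one (acyclic_pair _ _ _ (hU _ _ (zmod_three x x).2.2.1))).mono
        (fun y hy => ?_) le_rfl
      have := (zmod_three x y).2.1 fun e => hx (e ▸ hy)
      simpa only [Finset.mem_insert, Finset.mem_singleton] using this
  refine ⟨?_, hcard, ⟨?_, fun m hm => ?_, fun x _ => ⟨1, by norm_num, hpair x _ (by simp)⟩⟩, ?_⟩
  · exact fun x => (zmod_three x x).2.2.2.1
  · refine ((hpair 0 (Finset.univ.erase 0) (by simp)).union
      (isCoverable_one (acyclic_singleton _ 0))).mono (fun x _ => ?_) le_rfl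
    by_cases hx : x = 0 <;> simp [hx]
  · by_contra hlt
    obtain ⟨𝒬, h1, h2, h3⟩ := hm
    obtain ⟨Q, hQ, -⟩ := h3 0 (Finset.mem_univ 0)
    refine hnot ((h2 Q hQ).mono fun x _ => ?_)
    obtain ⟨R, hR, hx⟩ := h3 x (Finset.mem_univ x)
    have : R = Q := Finset.card_le_one.1 (by omega) R hR Q hQ
    exact this ▸ hx
  · have e : ∀ x y, (dirCycle 3).missingArc x y = if y = x + 2 then 1 else 0 := by
      intro x y
      unfold missingArc
      have : (x ≠ y ∧ ¬ (dirCycle 3).Adj x y) ↔ y = x + 2 := (zmod_three x y).2.2.2.2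
      simp only [this]
    unfold Digraph.missing
    simp only [e, Finset.sum_ite_eq', Finset.mem_univ, if_true]
    simp [hcard, maxMissing_one]

theorem IsDiracGallaiDigraph.isExtremal {E : Digraph V} {p : ℕ}
    (h : E.IsDiracGallaiDigraph (p + 1)) : E.IsExtremal (p + 1) p := by
  rcases h with ⟨hp, ⟨e⟩⟩ | ⟨-, G, hG, rfl⟩
  · obtain rfl : p = 1 := by omega
    have : Fintype (ZMod 3) := Fintype.ofEquiv _ e.toEquiv
    exact dirCycle_three_isExtremal.of_equiv e.toEquiv fun x y => e.map_rel_iff.symm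
  · obtain ⟨φ, hφ⟩ := hG.exists_isFiveBlowUp
    exact hφ.isExtremal

omit [Fintype V] in
theorem eq_union_of_forall_mem {U S T : Finset V} (h : ∀ x, x ∈ U ↔ x ∈ S ∨ x ∈ T) : U = S ∪ T :=
  Finset.ext fun x => (h x).trans Finset.mem_union.symm

/-- A complete join with `q` further vertices raises the dichromatic number by `q` and misses no arc, so the
excess `p` of the order is unchanged. -/
theorem IsExtremal.join_complete {E : Digraph V} {k p : ℕ} (h : E.IsExtremal k p) (q : ℕ) :
    ((biorientation (SimpleGraph.completeGraph (Fin q))).diracJoin E).IsExtremal (q + k) p := by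
  set K := biorientation (SimpleGraph.completeGraph (Fin q)) with hK
  have hKa : ∀ x y, K.Adj x y ↔ x ≠ y := fun x y => Iff.rfl
  have hKU : ∀ x y, ¬ K.Unlinked x y := fun x y hu => hu.2 ⟨hu.1, hu.1.symm⟩
  have h1 : ∀ x y, K.Adj x y ↔ (K.diracJoin E).Adj (Function.Embedding.inl x)
    (Function.Embedding.inl y) := fun _ _ => Iff.rfl
  have h2 : ∀ x y, E.Adj x y ↔ (K.diracJoin E).Adj (Function.Embedding.inr x)
    (Function.Embedding.inr y) := fun _ _ => Iff.rfl
  have hun := eq_union_of_forall_mem (U := (Finset.univ : Finset (Fin q ⊕ V)))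
    (S := Finset.univ.map Function.Embedding.inl) (T := Finset.univ.map Function.Embedding.inr)
    fun x => by cases x <;> simp
  have hST : ∀ x ∈ (Finset.univ : Finset (Fin q)).map Function.Embedding.inl,
      ∀ y ∈ (Finset.univ : Finset V).map Function.Embedding.inr,
      x ≠ y ∧ ¬ (K.diracJoin E).Unlinked x y := by
    intro x hx y hy
    obtain ⟨a, -, rfl⟩ := Finset.mem_map.1 hx
    obtain ⟨b, -, rfl⟩ := Finset.mem_map.1 hy
    exact ⟨Sum.inl_ne_inr, fun hu => hu.2 ⟨trivial, trivial⟩⟩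
  have hVK := isVertexCritical_of_forall_not_unlinked hKU
  rw [Fintype.card_fin] at hVK
  refine ⟨?_, ?_, ?_, ?_⟩
  · rintro (x | x) hx
    · exact hx rfl
    · exact h.loopless x hx
  · rw [Fintype.card_sum, Fintype.card_fin, h.card, add_assoc]
  · rw [hun]
    exact IsVertexCritical.union ((isVertexCritical_map h1).2 hVK)
      ((isVertexCritical_map h2).2 h.vertexCritical) hST
  · rw [hun, missing_union hST, missing_map h1, missing_map h2, missing_eq_zero hKU, zero_add,
      h.missing]

theorem exists_isExtremal {p : ℕ} (hp : 1 ≤ p) :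
    ∃ (W : Type) (_ : Fintype W) (E : Digraph W), E.IsExtremal (p + 1) p := by
  rcases (show p = 1 ∨ 2 ≤ p by omega) with rfl | hp2
  · exact ⟨ZMod 3, inferInstance, dirCycle 3, dirCycle_three_isExtremal⟩
  let s : Fin 5 → ℕ := ![1, 1, 1, p - 1, p - 1]
  let φ : (Σ i, Fin (s i)) → Fin 5 := Sigma.fst
  let E : Digraph (Σ i, Fin (s i)) := ⟨fun x y => x ≠ y ∧ fiveAdj (φ x) (φ y) = false⟩
  have hc : ∀ i, (Finset.univ.filter fun x => φ x = i).card = s i := by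
    intro i
    have : (Finset.univ.filter fun x => φ x = i) =
        (Finset.univ : Finset (Fin (s i))).map (Function.Embedding.sigmaMk i) := by
      ext ⟨j, x⟩
      simp only [Finset.mem_filter, Finset.mem_univ, true_and, Finset.mem_map,
        Function.Embedding.sigmaMk_apply, φ]
      constructor
      · rintro rfl; exact ⟨x, rfl⟩
      · rintro ⟨y, hy⟩; exact (congrArg Sigma.fst hy).symm
    rw [this, Finset.card_map, Finset.card_univ, Fintype.card_fin]
  refine ⟨_, inferInstance, E, IsFiveBlowUp.isExtremal (φ := φ) ⟨fun x y => Iff.rfl, hc 0, hc 1, ?_, ?_,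
    ?_, ?_⟩⟩
  · rw [hc]; exact Nat.one_pos
  · rw [hc]; change 0 < p - 1; omega
  · rw [hc, hc]; change 1 + (p - 1) = p; omega
  · rw [hc]; change p - 1 + 1 = p; omega

end DiracGallai

/-! ### The minimum number of arcs and the extremal digraphs -/

section Extremal

variable {V : Type u} [Fintype V] {D : Digraph V} {k p : ℕ}

theorem IsExtremal.isCRI (h : D.IsExtremal k p) : D.IsCRI k (k + p) :=
  ⟨h.loopless, h.vertexCritical.isCritical h.loopless h.card h.missing, h.card⟩

theorem IsCRI.missing_le (h : D.IsCRI k (k + p)) : D.missing Finset.univ ≤ maxMissing p :=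
  (h.2.1.isVertexCritical.bound h.1 _ k p (by rw [Finset.card_univ, h.2.2])).1

theorem IsCRI.isExtremal_iff (h : D.IsCRI k (k + p)) :
    D.IsExtremal k p ↔ D.missing Finset.univ = maxMissing p :=
  ⟨fun h => h.missing, fun hM => ⟨h.1, h.2.2, h.2.1.isVertexCritical, hM⟩⟩

/-- Extremal digraphs exist on the standard vertex sets. -/
theorem exists_isExtremal_fin (hp : 1 ≤ p) (hpk : p + 1 ≤ k) :
    ∃ D : Digraph (Fin (k + p)), D.IsExtremal k p := by
  obtain ⟨W, _, E, hE⟩ := exists_isExtremal hp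
  have hJ := hE.join_complete (k - p - 1)
  rw [show k - p - 1 + (p + 1) = k by omega] at hJ
  let e : Fin (k + p) ≃ Fin (k - p - 1) ⊕ W := (Fintype.equivFinOfCardEq hJ.card).symm
  let D : Digraph (Fin (k + p)) :=
    ⟨fun x y => ((biorientation (SimpleGraph.completeGraph (Fin (k - p - 1)))).diracJoin E).Adj
      (e x) (e y)⟩
  exact ⟨D, hJ.of_equiv e fun _ _ => Iff.rfl⟩

/-- The minimum number of arcs; written as a sum, so that `maxMissing p` need not be subtracted in `ℕ`. -/
theorem extMin_spec (hp : 1 ≤ p) (hpk : p + 1 ≤ k) : (criticalArcCounts k (k + p)).Nonempty ∧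
    extMin k (k + p) + maxMissing p = (k + p) * (k + p - 1) := by
  obtain ⟨D, hD⟩ := exists_isExtremal_fin hp hpk
  have hmem : D.arcs.ncard ∈ criticalArcCounts k (k + p) := ⟨D, hD.isCRI, rfl⟩
  have hcount := ncard_arcs_add_missing hD.loopless
  rw [Fintype.card_fin, hD.missing] at hcount
  refine ⟨⟨_, hmem⟩, ?_⟩
  rw [← hcount, Nat.add_right_cancel_iff]
  refine le_antisymm (Nat.sInf_le hmem) (le_csInf ⟨_, hmem⟩ ?_)
  rintro _ ⟨E, hE, rfl⟩
  have h1 := ncard_arcs_add_missing hE.1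
  have h2 := hE.missing_le
  rw [Fintype.card_fin] at h1
  omega

/-- The digraphs with the fewest arcs are those that attain the bound, because critical ones among them exist. -/
theorem isEXT_iff_isExtremal (hp : 1 ≤ p) (hpk : p + 1 ≤ k) :
    D.IsEXT k (k + p) ↔ D.IsExtremal k p := by
  have hext := (extMin_spec hp hpk).2
  constructor
  · rintro ⟨h, hA⟩
    have hcount := ncard_arcs_add_missing h.1
    rw [h.2.2] at hcount
    exact h.isExtremal_iff.2 (by omega)
  · intro h
    have hcount := ncard_arcs_add_missing h.loopless
    rw [h.card, h.missing] at hcount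
    exact ⟨h.isCRI, by omega⟩

/-- An extremal digraph is the join of a complete digraph and its Dirac–Gallai core. -/
theorem IsExtremal.exists_iso (h : D.IsExtremal k p) (hp : 1 ≤ p) (hpk : p + 1 ≤ k) :
    ∃ (W : Type u) (_ : Fintype W) (E : Digraph W), E.IsDiracGallaiDigraph (p + 1) ∧
      Nonempty (D.Adj ≃r
        (diracJoin (biorientation (SimpleGraph.completeGraph (Fin (k - p - 1)))) E).Adj) := by
  obtain ⟨T, -, hTc, hTD, hTl⟩ := (h.vertexCritical.bound h.loopless _ k p
    (by rw [Finset.card_univ, h.card])).2 hp h.missing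
  have hc : Fintype.card {x // x ∉ T} = k - p - 1 := by
    rw [Fintype.card_subtype_compl, Fintype.card_coe, h.card, hTc]; omega
  let σ : Fin (k - p - 1) ≃ {x // x ∉ T} := (Fintype.equivFinOfCardEq hc).symm
  let e : V ≃ Fin (k - p - 1) ⊕ (T : Set V) :=
    (((Equiv.sumComm _ _).trans (Equiv.sumCompl (· ∈ T))).symm.trans
      (Equiv.sumCongr σ.symm (Equiv.refl _)))
  have he1 : ∀ i, e.symm (.inl i) = (σ i : V) := fun i => rfl
  have he2 : ∀ x, e.symm (.inr x) = (x : V) := fun x => rfl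
  have hout : ∀ x y, x ∉ T → (D.Adj x y ↔ x ≠ y) ∧ (D.Adj y x ↔ x ≠ y) := by
    intro x y hx
    have hl := hTl x (Finset.mem_univ x) hx y (Finset.mem_univ y)
    by_cases hxy : x = y
    · subst hxy
      simp [h.loopless x]
    · have : D.Adj x y ∧ D.Adj y x := by
        by_contra hc
        exact hl ⟨hxy, hc⟩
      simp [this, hxy]
  refine ⟨(T : Set V), inferInstance, D.induced (T : Set V), hTD, ⟨RelIso.symm ⟨e.symm, ?_⟩⟩⟩
  intro a b
  rcases a with i | x <;> rcases b with j | y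
  · rw [he1, he1, (hout _ _ (σ i).2).1]
    change ((σ i : V) ≠ σ j) ↔ i ≠ j
    rw [Ne, Subtype.coe_inj, σ.apply_eq_iff_eq]
  · rw [he1, he2, (hout _ _ (σ i).2).1]
    exact iff_of_true (fun hc => (σ i).2 (hc ▸ y.2)) trivial
  · rw [he1, he2, (hout _ _ (σ j).2).2]
    exact iff_of_true (fun hc => (σ j).2 (hc ▸ x.2)) trivial
  · rw [he2, he2]; rfl

end Extremal

end Digraph

theorem theorem4p1 (k p n : ℕ) (hp : 1 ≤ p) (hpk : p + 1 ≤ k) (hn : n = k + p) :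
    (∀ (V : Type u) [Fintype V] (D : Digraph V),
      D.IsEXT k n ↔
        ∃ (W : Type u) (_ : Fintype W) (E : Digraph W),
          E.IsDiracGallaiDigraph (p + 1) ∧
          Nonempty (D.Adj ≃r
            (Digraph.diracJoin
              (Digraph.biorientation (SimpleGraph.completeGraph (Fin (k - p - 1)))) E).Adj)) ∧
    (Digraph.criticalArcCounts k n).Nonempty ∧
    (p = 1 → (Digraph.extMin k n : ℤ) = 2 * (n.choose 2 : ℤ) - 3) ∧
    (2 ≤ p → (Digraph.extMin k n : ℤ) = 2 * ((n.choose 2 : ℤ) - ((p : ℤ) ^ 2 + 1))) := by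
  subst hn
  obtain ⟨hne, hext⟩ := Digraph.extMin_spec hp hpk
  have h2 : (k + p).choose 2 * 2 = (k + p) * (k + p - 1) := by
    rw [Nat.choose_two_right, Nat.div_mul_cancel (Nat.even_mul_pred_self _).two_dvd]
  rw [← h2] at hext
  refine ⟨fun V _ D => ?_, hne, ?_, fun hp2 => ?_⟩
  · rw [Digraph.isEXT_iff_isExtremal hp hpk]
    constructor
    · exact fun h => h.exists_iso hp hpk
    · rintro ⟨W, _, E, hE, ⟨e⟩⟩
      have hJ := hE.isExtremal.join_complete (k - p - 1)
      rw [show k - p - 1 + (p + 1) = k by omega] at hJ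
      exact hJ.of_equiv e.toEquiv fun x y => e.map_rel_iff.symm
  · rintro rfl
    rw [Digraph.maxMissing_one] at hext
    omega
  · rw [Digraph.maxMissing_of_two_le hp2] at hext
    zify at hext
    linarith
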